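/- Let $E=\bigoplus_{\gamma\in\Gamma}E_\gamma$ be a graded division ring (a nonzero ring, graded by an abelian group $\Gamma$, in which every nonzero homogeneous element is invertible). Suppose that the grade group $\Gamma_E=\{\gamma\in\Gamma : E_\gamma\neq 0\}$ is torsion-free, and that $E$ is finite-dimensional (finitely generated as a module) over its center $T=Z(E)$. Let $q(T)$ be the quotient field of $T$ and $Q=q(E)=q(T)\otimes_T E$ the quotient division ring of $E$. For an algebra $A$ over a commutative ring $R$ for which there are a commutative faithfully flat $R$-algebra $S$ and an isomorphism of $S$-algebras $\varphi\colon S\otimes_R A\cong M_n(S)$, let $\mathrm{Nrd}_A\colon A\to R$ be the reduced norm, $\mathrm{Nrd}_A(a)=\det\varphi(1\otimes a)$ (which lies in $R$ and does not depend on $S$ and $\varphi$), let $A^{(1)}=\{a\in A^* : \mathrm{Nrd}_A(a)=1\}$, let $A'$ be the commutator subgroup of $A^*$, and put $\mathrm{SK}_1(A)=A^{(1)}/A'$. Then such a splitting exists for $E$ over $T$ and for $Q$ over $q(T)$, so that $\mathrm{SK}_1(E)$ and $\mathrm{SK}_1(Q)$ are defined; the inclusion $E\hookrightarrow Q$ maps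 $E^{(1)}$ into $Q^{(1)}$; and the map that it induces, $$\mathrm{SK}_1(E)\longrightarrow \mathrm{SK}_1(q(E)),\qquad aE'\longmapsto aQ',$$ is an isomorphism of groups. -/

import Mathlib

open scoped TensorProduct

/-! ### Splitting rings and the reduced norm -/

universe u v

/-- A commutative, faithfully flat `R`-algebra `S` that splits the `R`-algebra `A`:
it comes with an isomorphism `S ⊗ A ≅ Mₙ(S)`. -/
structure SplittingDatum (R : Type u) (A : Type v) [CommRing R] [Ring A] [Algebra R A] where
  S : Type (max u v)
  [commRing : CommRing S]
  [algebra : Algebra R S]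
  [faithfullyFlat : Module.FaithfullyFlat R S]
  n : ℕ
  iso : S ⊗[R] A ≃ₐ[S] Matrix (Fin n) (Fin n) S

attribute [instance] SplittingDatum.commRing SplittingDatum.algebra
  SplittingDatum.faithfullyFlat

namespace SplittingDatum

variable {R : Type u} {A : Type v} [CommRing R] [Ring A] [Algebra R A]

/-- The determinant of `1 ⊗ a`, viewed as an `n × n` matrix over the splitting ring. -/
noncomputable def det (s : SplittingDatum R A) : A →* s.S where
  toFun a := (s.iso (1 ⊗ₜ[R] a)).det
  map_one' := by
    rw [← Algebra.TensorProduct.one_def, map_one, Matrix.det_one]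
  map_mul' a b := by
    rw [← Matrix.det_mul, ← map_mul, Algebra.TensorProduct.tmul_mul_tmul, one_mul]

/-- Automorphisms of a matrix algebra over a commutative ring preserve determinants. -/
theorem det_algEquiv {W : Type*} [CommRing W] {n : ℕ}
    (f : Matrix (Fin n) (Fin n) W ≃ₐ[W] Matrix (Fin n) (Fin n) W)
    (X : Matrix (Fin n) (Fin n) W) : (f X).det = X.det := by
  rcases Nat.eq_zero_or_pos n with rfl | hn
  · simp
  let o : Fin n := ⟨0, hn⟩
  let e : Fin n → Fin n → Matrix (Fin n) (Fin n) W := fun i j => Matrix.single i j 1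
  have key : ∀ i j : Fin n, (f (e o o) i j) ^ n * ((f X).det - X.det) = 0 := by
    intro i j
    let P : Matrix (Fin n) (Fin n) W := Matrix.of fun k l => f (e l o) k j
    let B : Matrix (Fin n) (Fin n) W := Matrix.of fun l k => f.symm (e k i) l o
    have hP : ∀ Y, P * Y = f Y * P := by
      intro Y
      have h1 : ∀ l, Y * e l o = ∑ m, Y m l • e m o := by
        intro l
        ext a b
        simp only [e, Matrix.sum_apply, Matrix.smul_apply, Matrix.mul_apply, Matrix.single_apply]
        by_cases hb : o = b <;> simp [hb]
      ext k l
      have h2 : (f Y * f (e l o)) k j = (∑ m, Y m l • f (e m o)) k j := by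
        rw [← map_mul, h1, map_sum]; simp only [map_smul]
      simp only [Matrix.sum_apply, Matrix.smul_apply, smul_eq_mul] at h2
      rw [Matrix.mul_apply] at h2
      simp only [Matrix.mul_apply, P, Matrix.of_apply]
      rw [h2]
      exact Finset.sum_congr rfl fun _ _ => mul_comm _ _
    have hPB : P * B = (f (e o o) i j) • (1 : Matrix (Fin n) (Fin n) W) := by
      ext a k
      have h3 := congrFun (congrFun (hP (f.symm (e k i))) a) o
      rw [f.apply_symm_apply] at h3
      have h4 : (P * B) a k = (P * f.symm (e k i)) a o := by
        simp only [Matrix.mul_apply, B, Matrix.of_apply]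
      rw [h4, h3]
      simp only [e, Matrix.mul_apply, P, Matrix.of_apply, Matrix.single_apply, Matrix.smul_apply,
        Matrix.one_apply, smul_eq_mul]
      by_cases hk : k = a
      · subst hk; simp
      · simp [hk, Ne.symm hk]
    have hd : P.det * B.det = (f (e o o) i j) ^ n := by
      rw [← Matrix.det_mul, hPB, Matrix.det_smul, Matrix.det_one]; simp
    have h5 : P.det * X.det = (f X).det * P.det := by
      rw [← Matrix.det_mul, hP, Matrix.det_mul]
    rw [← hd]
    linear_combination (-B.det) * h5
  have hspan : Ideal.span (Set.range fun p : Fin n × Fin n => f (e o o) p.1 p.2) = ⊤ := by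
    rw [Ideal.eq_top_iff_one]
    have h1 : (1 : Matrix (Fin n) (Fin n) W) = ∑ i, f (e i o) * f (e o o) * f (e o i) := by
      have : (1 : Matrix (Fin n) (Fin n) W) = ∑ i, e i o * e o o * e o i := by
        simp [e, Matrix.sum_single_one]
      rw [← map_one f, this, map_sum]
      simp only [map_mul]
    have h2 : (1 : W) = (1 : Matrix (Fin n) (Fin n) W) o o := by simp
    rw [h2, h1, Matrix.sum_apply]
    refine Ideal.sum_mem _ fun i _ => ?_
    rw [Matrix.mul_apply]
    refine Ideal.sum_mem _ fun k _ => Ideal.mul_mem_right _ _ ?_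
    rw [Matrix.mul_apply]
    exact Ideal.sum_mem _ fun l _ => Ideal.mul_mem_left _ _ (Ideal.subset_span ⟨(l, k), rfl⟩)
  have hpow := Ideal.span_pow_eq_top _ hspan n
  have : (1 : W) * ((f X).det - X.det) = 0 := by
    have h1 : (1 : W) ∈ Ideal.span
        ((fun x => x ^ n) '' (Set.range fun p : Fin n × Fin n => f (e o o) p.1 p.2)) := by
      rw [hpow]; trivial
    refine Submodule.span_induction (p := fun x _ => x * ((f X).det - X.det) = 0)
      ?_ (by simp) ?_ ?_ h1
    · rintro _ ⟨_, ⟨p, rfl⟩, rfl⟩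
      exact key p.1 p.2
    · intro x y _ _ hx hy; rw [add_mul, hx, hy, add_zero]
    · intro a x _ hx; rw [smul_eq_mul, mul_assoc, hx, mul_zero]
  rwa [one_mul, sub_eq_zero] at this

theorem exists_baseChange (s : SplittingDatum R A) {W : Type*} [CommRing W] [Algebra R W]
    (g : s.S →ₐ[R] W) :
    ∃ ψ : W ⊗[R] A ≃ₐ[W] Matrix (Fin s.n) (Fin s.n) W,
      ∀ a : A, ψ (1 ⊗ₜ[R] a) = (s.iso (1 ⊗ₜ[R] a)).map g := by
  let _ : Algebra s.S W := g.toRingHom.toAlgebra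
  have _ : IsScalarTower R s.S W := IsScalarTower.of_algebraMap_eq fun r => (g.commutes r).symm
  let L : W ⊗[R] A ≃ₗ[W] Matrix (Fin s.n) (Fin s.n) W :=
    ((TensorProduct.AlgebraTensorModule.cancelBaseChange R s.S W W A).symm.trans
      (TensorProduct.AlgebraTensorModule.congr (LinearEquiv.refl W W) s.iso.toLinearEquiv)).trans
      { (matrixEquivTensor (Fin s.n) s.S W).symm.toLinearEquiv with
        map_smul' := fun w x => by
          simp only [AlgEquiv.toLinearEquiv_toLinearMap, AddHom.toFun_eq_coe,
            LinearMap.coe_toAddHom, AlgEquiv.toLinearMap_apply, RingHom.id_apply]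
          induction x with
          | zero => simp
          | add x y hx hy => simp only [smul_add, map_add, hx, hy]
          | tmul x y =>
            rw [TensorProduct.smul_tmul', matrixEquivTensor_apply_symm,
              matrixEquivTensor_apply_symm, smul_assoc] }
  have hL : ∀ w a, L (w ⊗ₜ a) = w • (s.iso (1 ⊗ₜ[R] a)).map g := fun w a => by
    change (matrixEquivTensor (Fin s.n) s.S W).symm (w ⊗ₜ s.iso (1 ⊗ₜ a)) = _
    rw [matrixEquivTensor_apply_symm]
    rfl
  refine ⟨Algebra.TensorProduct.algEquivOfLinearEquivTensorProduct L (fun w₁ w₂ a₁ a₂ => ?_) ?_,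
    fun a => ?_⟩
  · have h : (1 : s.S) ⊗ₜ[R] (a₁ * a₂) = (1 ⊗ₜ a₁) * (1 ⊗ₜ a₂) := by
      rw [Algebra.TensorProduct.tmul_mul_tmul, one_mul]
    rw [hL, hL, hL, h, map_mul, Matrix.map_mul, smul_mul_smul_comm]
  · rw [hL, ← Algebra.TensorProduct.one_def, map_one, one_smul,
      Matrix.map_one _ (map_zero g) (map_one g)]
  · exact (hL 1 a).trans (one_smul _ _)

/-- The determinants computed in two splittings agree over any common extension of the two
splitting rings. -/
theorem map_det_eq (s t : SplittingDatum R A) {W : Type*} [CommRing W] [Algebra R W]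
    (g : s.S →ₐ[R] W) (h : t.S →ₐ[R] W) (a : A) : g (s.det a) = h (t.det a) := by
  nontriviality W
  obtain ⟨ψ, hψ⟩ := s.exists_baseChange g
  obtain ⟨χ, hχ⟩ := t.exists_baseChange h
  have hn : s.n = t.n := by
    have := (ψ.symm.trans χ).toLinearEquiv.finrank_eq
    simp only [Module.finrank_matrix, Fintype.card_fin, Module.finrank_self, mul_one] at this
    exact Nat.mul_self_inj.mp this
  have hdet : ∀ {m k : ℕ} (_ : m = k)
      (f : Matrix (Fin m) (Fin m) W ≃ₐ[W] Matrix (Fin k) (Fin k) W) (X), (f X).det = X.det := by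
    rintro m _ rfl f X
    exact det_algEquiv f X
  have h1 := hdet hn (ψ.symm.trans χ) (ψ (1 ⊗ₜ a))
  rw [AlgEquiv.trans_apply, AlgEquiv.symm_apply_apply, hψ, hχ] at h1
  have h2 : ∀ {m : ℕ} {S : Type (max u v)} [CommRing S] [Algebra R S] (k : S →ₐ[R] W)
      (M : Matrix (Fin m) (Fin m) S), (M.map k).det = k M.det := by
    intro m S _ _ k M
    exact (RingHom.map_det k.toRingHom M).symm
  rw [h2, h2] at h1
  exact h1.symm

theorem exists_forall_algebraMap_eq_det [Nonempty (SplittingDatum R A)] (a : A) :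
    ∃ r : R, ∀ s : SplittingDatum R A, algebraMap R s.S r = s.det a := by
  obtain ⟨s⟩ := ‹Nonempty (SplittingDatum R A)›
  have h : s.det a ∈ RingHom.range (algebraMap R s.S) := by
    have h := map_det_eq s s (Algebra.TensorProduct.includeLeft : s.S →ₐ[R] s.S ⊗[R] s.S)
      Algebra.TensorProduct.includeRight a
    refine (Algebra.IsEffective.of_faithfullyFlat R s.S (s.det a)).mp ?_
    rw [Algebra.TensorProduct.includeLeftSubRight_apply]
    exact sub_eq_zero.mpr h
  obtain ⟨r, hr⟩ := h
  refine ⟨r, fun t => ?_⟩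
  have h1 := map_det_eq s t (Algebra.TensorProduct.includeLeft : s.S →ₐ[R] s.S ⊗[R] t.S)
    Algebra.TensorProduct.includeRight a
  rw [← hr, AlgHom.commutes] at h1
  apply Algebra.TensorProduct.includeRight_injective (R := R) (A := s.S) (B := t.S)
    (FaithfulSMul.algebraMap_injective R s.S)
  rw [← h1, AlgHom.commutes]

theorem algebraMap_injective (s : SplittingDatum R A) :
    Function.Injective (algebraMap R s.S) :=
  FaithfulSMul.algebraMap_injective R s.S

end SplittingDatum

open scoped Classical in
/-- The reduced norm of an Azumaya algebra `A` over `R`: the determinant of `1 ⊗ a` in any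
splitting of `A`, which lies in `R` and does not depend on the splitting. (On algebras that have
no splitting at all, so are not Azumaya of constant rank `n ^ 2`, it is the constant `1`.) -/
noncomputable def reducedNorm (R : Type u) (A : Type v) [CommRing R] [Ring A] [Algebra R A] :
    A →* R :=
  if h : Nonempty (SplittingDatum R A) then
    haveI := h
    { toFun := fun a => (SplittingDatum.exists_forall_algebraMap_eq_det (R := R) a).choose
      map_one' := h.some.algebraMap_injective <| by
        rw [(SplittingDatum.exists_forall_algebraMap_eq_det (R := R) (1 : A)).choose_spec,
          map_one, map_one]
      map_mul' := fun a b => h.some.algebraMap_injective <| by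
        rw [map_mul, (SplittingDatum.exists_forall_algebraMap_eq_det (R := R) (a * b)).choose_spec,
          (SplittingDatum.exists_forall_algebraMap_eq_det (R := R) a).choose_spec,
          (SplittingDatum.exists_forall_algebraMap_eq_det (R := R) b).choose_spec, map_mul] }
  else 1

/-- The defining property of the reduced norm. -/
theorem algebraMap_reducedNorm {R : Type u} {A : Type v} [CommRing R] [Ring A] [Algebra R A]
    (s : SplittingDatum R A) (a : A) : algebraMap R s.S (reducedNorm R A a) = s.det a := by
  have h : Nonempty (SplittingDatum R A) := ⟨s⟩
  rw [reducedNorm, dif_pos h]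
  exact (SplittingDatum.exists_forall_algebraMap_eq_det (R := R) a).choose_spec s

/-! ### The reduced Whitehead group -/

/-- `A⁽¹⁾`, the group of elements of `A` of reduced norm `1`. (Such elements are automatically
units of `A`.) -/
noncomputable def reducedNormOne (R : Type u) (A : Type v) [CommRing R] [Ring A] [Algebra R A] :
    Subgroup Aˣ :=
  ((reducedNorm R A).comp (Units.coeHom A)).ker

/-- The reduced Whitehead group `SK₁(A) = A⁽¹⁾ / [Aˣ, Aˣ]`. (The commutator subgroup is contained
in `A⁽¹⁾`, since the reduced norm has commutative values.) -/
abbrev SK1 (R : Type u) (A : Type v) [CommRing R] [Ring A] [Algebra R A] : Type v :=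
  reducedNormOne R A ⧸ (commutator Aˣ).subgroupOf (reducedNormOne R A)

/-! ### Graded division rings -/

/-- The ring `E` with its grading `E = ⨁ E_γ` is a graded division ring with torsion-free
grade group `{γ | E_γ ≠ 0}`. -/
structure IsGradedDivisionRing {Γ : Type*} [AddCommGroup Γ] [DecidableEq Γ] {E : Type*} [Ring E]
    (𝒜 : Γ → AddSubgroup E) [GradedRing 𝒜] : Prop where
  nontrivial : Nontrivial E
  isUnit_of_mem : ∀ (γ : Γ) (a : E), a ∈ 𝒜 γ → a ≠ 0 → IsUnit a
  torsionFree : ∀ γ : Γ, 𝒜 γ ≠ ⊥ → ∀ k : ℕ, k ≠ 0 → k • γ = 0 → γ = 0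

/-- The quotient division ring `q(E) = q(T) ⊗_T E` of `E`, where `T` is the center of `E` and
`q(T)` its field of fractions. -/
abbrev QuotientDivisionRing (E : Type*) [Ring E] :=
  FractionRing (Subring.center E) ⊗[Subring.center E] E

/-- The inclusion `E → q(E)`, `a ↦ 1 ⊗ a`. -/
abbrev toQuotientDivisionRing (E : Type*) [Ring E] : E →+* QuotientDivisionRing E :=
  (Algebra.TensorProduct.includeRight :
    E →ₐ[Subring.center E] QuotientDivisionRing E).toRingHom

/-!
Let `T` be the center of the graded division ring `E`, and `Q` its quotient division ring. The idea
is that the reduced norm sees the irreducible factors of an element, up to conjugation, and that the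
conjugations that are needed can be made inside `Q`.

*The reduced norms.* The centralizer `L` of a maximal set of commuting homogeneous elements is a
commutative graded subring that is its own centralizer. A graded form of Jacobson's density theorem
(`exists_dual`) shows that the action of `L ⊗ E` on the free `L`-module `E` is an isomorphism onto a
matrix ring (`exists_splittingDatum`); `Q` is split by base change, and the reduced norm of `Q`
extends that of `E`.

*Injectivity.* The grade group is torsion-free, hence can be ordered. Leading terms are then
multiplicative, and define a homomorphism from the units of `Q` to the units of `E`. As units of `E`
are homogeneous, it is a retraction (`exists_retraction`), so a unit of `E` that is a product of
commutators in `Q` is one in `E`.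

*Surjectivity.* An element `e / t` of `Q` with central `t` has reduced norm `1` if and only if `e`
and `t` have the same reduced norm. So it suffices that two elements of `E` whose norms differ by a
central unit have the same class in the abelianization of the units of `Q`, modulo units of `E`
(`IsNorm.unitClass_div_mem`). This is proved by induction on the finitely generated, hence free,
group of degrees that occur (`CyclicStep.induction`). Let `Δ` be generated by `Δ'` and one degree
`δ`. Inverting the central elements with degrees in `Δ'` turns the elements with degrees in `Δ` into
twisted Laurent polynomials over a division ring (`laurent`). This ring is Euclidean, so its
elements are products of irreducible ones. Two facts allow the factors of two elements with associated norms
to be cancelled until only elements with degrees in `Δ'` are left (`IsNorm.prod_div_prod_mem`):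

* irreducible elements either divide the same central elements or have coprime norms
  (`GeneratesMaximal.eq_or_comaximal`, `IsNorm.isCoprime_localNorm`);
* in the first case one is similar to a conjugate of the other by a homogeneous unit of `E`, and
  similar elements of a Euclidean ring have the same class, by the Euclidean algorithm
  (`unitClass_div_mem_of_forall_iff`, `IsLeftEuclidean.div_mem_of_similar`).
-/

namespace GradedDivisionRing

/-! ### Supports of elements of a graded ring -/

section Support

variable {Γ : Type*} [AddCommGroup Γ] [DecidableEq Γ] {E : Type*} [Ring E]
  (𝒜 : Γ → AddSubgroup E) [GradedRing 𝒜]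

/-- The elements all of whose nonzero homogeneous components have degree in `s`. -/
def supportedIn (s : Set Γ) : AddSubgroup E where
  carrier := {x | ∀ γ, γ ∉ s → (DirectSum.decompose 𝒜 x γ : E) = 0}
  zero_mem' := by simp
  add_mem' {x y} hx hy γ hγ := by simp [hx γ hγ, hy γ hγ]
  neg_mem' {x} hx γ hγ := by
    rw [DirectSum.decompose_neg, DFinsupp.neg_apply, NegMemClass.coe_neg, hx γ hγ, neg_zero]

open scoped Classical in
/-- The sum of the homogeneous components whose degree lies in `s`. -/
noncomputable def restrict (s : Set Γ) : E →+ E :=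
  ((DirectSum.decomposeAddEquiv 𝒜).symm : (DirectSum Γ fun γ => 𝒜 γ) →+ E).comp
    ((DFinsupp.filterAddMonoidHom (fun γ => 𝒜 γ) (· ∈ s)).comp
      ((DirectSum.decomposeAddEquiv 𝒜) : E →+ (DirectSum Γ fun γ => 𝒜 γ)))

open scoped Classical in
theorem decompose_restrict (s : Set Γ) (x : E) (γ : Γ) :
    (DirectSum.decompose 𝒜 (restrict 𝒜 s x) γ : E) =
      if γ ∈ s then (DirectSum.decompose 𝒜 x γ : E) else 0 := by
  have h : DirectSum.decompose 𝒜 (restrict 𝒜 s x) =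
      DFinsupp.filterAddMonoidHom (fun γ => 𝒜 γ) (· ∈ s) (DirectSum.decompose 𝒜 x) :=
    (DirectSum.decompose 𝒜).apply_symm_apply _
  rw [h]
  change ((DFinsupp.filter (· ∈ s) (DirectSum.decompose 𝒜 x)) γ : E) = _
  rw [DFinsupp.filter_apply]
  split_ifs <;> rfl

variable {𝒜}

theorem ext_decompose {x y : E}
    (h : ∀ γ, (DirectSum.decompose 𝒜 x γ : E) = DirectSum.decompose 𝒜 y γ) : x = y := by
  apply (DirectSum.decompose 𝒜).injective
  exact DFinsupp.ext fun γ => Subtype.ext (h γ)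

theorem mem_supportedIn_of_mem {s : Set Γ} {γ : Γ} {a : E} (ha : a ∈ 𝒜 γ) (hγ : γ ∈ s) :
    a ∈ supportedIn 𝒜 s := fun γ' h =>
  DirectSum.decompose_of_mem_ne 𝒜 ha (by rintro rfl; exact h hγ)

theorem supportedIn_mono {s t : Set Γ} (h : s ⊆ t) : supportedIn 𝒜 s ≤ supportedIn 𝒜 t :=
  fun _ hx γ hγ => hx γ fun h' => hγ (h h')

theorem mem_supportedIn_univ (x : E) : x ∈ supportedIn 𝒜 Set.univ := fun _ h => (h trivial).elim

theorem mem_supportedIn_singleton {γ : Γ} {x : E} : x ∈ supportedIn 𝒜 {γ} ↔ x ∈ 𝒜 γ := by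
  refine ⟨fun h => ?_, fun h => mem_supportedIn_of_mem h rfl⟩
  have : x = (DirectSum.decompose 𝒜 x γ : E) := by
    refine ext_decompose (𝒜 := 𝒜) fun γ' => ?_
    by_cases hγ : γ' = γ
    · subst hγ
      rw [DirectSum.decompose_of_mem_same 𝒜 (SetLike.coe_mem _)]
    · rw [h γ' hγ, DirectSum.decompose_of_mem_ne 𝒜 (SetLike.coe_mem _) (Ne.symm hγ)]
  rw [this]
  exact SetLike.coe_mem _

theorem restrict_mem (s : Set Γ) (x : E) : restrict 𝒜 s x ∈ supportedIn 𝒜 s := fun γ hγ => by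
  classical rw [decompose_restrict, if_neg hγ]

theorem restrict_mem_of_mem {s t : Set Γ} {x : E} (hx : x ∈ supportedIn 𝒜 t) :
    restrict 𝒜 s x ∈ supportedIn 𝒜 (t ∩ s) := fun γ hγ => by
  classical
  rw [decompose_restrict]
  split_ifs with h
  · exact hx γ fun h' => hγ ⟨h', h⟩
  · rfl

theorem restrict_of_mem {s : Set Γ} {x : E} (hx : x ∈ supportedIn 𝒜 s) :
    restrict 𝒜 s x = x := ext_decompose (𝒜 := 𝒜) fun γ => by
  classical
  rw [decompose_restrict]
  split_ifs with h
  · rfl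
  · exact (hx γ h).symm

theorem restrict_eq_zero {s t : Set Γ} {x : E} (hx : x ∈ supportedIn 𝒜 t)
    (h : ∀ γ ∈ t, γ ∉ s) : restrict 𝒜 s x = 0 := ext_decompose (𝒜 := 𝒜) fun γ => by
  classical
  rw [decompose_restrict]
  split_ifs with h'
  · rw [hx γ fun h'' => h γ h'' h']; simp
  · simp

theorem restrict_singleton (γ : Γ) (x : E) :
    restrict 𝒜 {γ} x = DirectSum.decompose 𝒜 x γ := ext_decompose (𝒜 := 𝒜) fun γ' => by
  classical
  rw [decompose_restrict]
  by_cases h : γ' = γ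
  · subst h
    rw [if_pos (Set.mem_singleton _), DirectSum.decompose_of_mem_same 𝒜 (SetLike.coe_mem _)]
  · rw [if_neg (by simpa using h), DirectSum.decompose_of_mem_ne 𝒜 (SetLike.coe_mem _) (Ne.symm h)]

theorem supportedIn_induction {s : Set Γ} {p : E → Prop} (zero : p 0)
    (hom : ∀ γ ∈ s, ∀ a ∈ 𝒜 γ, p a) (add : ∀ x y, p x → p y → p (x + y)) {x : E}
    (hx : x ∈ supportedIn 𝒜 s) : p x := by
  classical
  rw [← DirectSum.sum_support_decompose 𝒜 x]
  refine Finset.sum_induction _ p add zero fun γ hγ => hom γ ?_ _ (SetLike.coe_mem _)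
  by_contra h
  exact (DFinsupp.mem_support_iff.mp hγ) (Subtype.ext (hx γ h))

theorem homogeneous_induction {p : E → Prop} (x : E) (zero : p 0)
    (hom : ∀ γ, ∀ a ∈ 𝒜 γ, p a) (add : ∀ x y, p x → p y → p (x + y)) : p x :=
  supportedIn_induction (𝒜 := 𝒜) zero (fun γ _ => hom γ) add (mem_supportedIn_univ x)

theorem mul_mem_supportedIn {s t r : Set Γ} {x y : E} (hx : x ∈ supportedIn 𝒜 s)
    (hy : y ∈ supportedIn 𝒜 t) (h : ∀ a ∈ s, ∀ b ∈ t, a + b ∈ r) :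
    x * y ∈ supportedIn 𝒜 r := by
  refine supportedIn_induction (p := fun x => x * y ∈ supportedIn 𝒜 r) (by simp) ?_
    (fun x x' hx hx' => by rw [add_mul]; exact add_mem hx hx') hx
  intro γ hγ a ha
  refine supportedIn_induction (p := fun y => a * y ∈ supportedIn 𝒜 r) (by simp) ?_
    (fun x x' hx hx' => by rw [mul_add]; exact add_mem hx hx') hy
  intro γ' hγ' b hb
  exact mem_supportedIn_of_mem (SetLike.mul_mem_graded ha hb) (h _ hγ _ hγ')

theorem one_mem_supportedIn {s : Set Γ} (h : 0 ∈ s) : (1 : E) ∈ supportedIn 𝒜 s :=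
  mem_supportedIn_of_mem (SetLike.one_mem_graded 𝒜) h

open scoped Classical in
theorem restrict_of_mem_graded {s : Set Γ} {γ : Γ} {a : E} (ha : a ∈ 𝒜 γ) :
    restrict 𝒜 s a = if γ ∈ s then a else 0 := by
  split_ifs with h
  · exact restrict_of_mem (mem_supportedIn_of_mem ha h)
  · exact restrict_eq_zero (t := {γ}) (mem_supportedIn_of_mem ha rfl) (by rintro _ rfl; exact h)

theorem restrict_mul_of_right_mem {s t r : Set Γ} (x : E) {y : E} (hy : y ∈ supportedIn 𝒜 t)
    (h : ∀ a, ∀ b ∈ t, a + b ∈ r ↔ a ∈ s) : restrict 𝒜 r (x * y) = restrict 𝒜 s x * y := by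
  classical
  refine homogeneous_induction (𝒜 := 𝒜)
    (p := fun x => restrict 𝒜 r (x * y) = restrict 𝒜 s x * y) x (by simp) ?_
    (fun x x' hx hx' => by rw [add_mul, map_add, map_add, add_mul, hx, hx'])
  intro γ a ha
  refine supportedIn_induction (p := fun y => restrict 𝒜 r (a * y) = restrict 𝒜 s a * y) (by simp)
    ?_ (fun x x' hx hx' => by rw [mul_add, map_add, mul_add, hx, hx']) hy
  intro γ' hγ' b hb
  rw [restrict_of_mem_graded (SetLike.mul_mem_graded ha hb), restrict_of_mem_graded ha,
    if_congr (h γ γ' hγ') rfl rfl]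
  split_ifs <;> simp

theorem restrict_mul_of_left_mem {s t r : Set Γ} {x : E} (y : E) (hx : x ∈ supportedIn 𝒜 t)
    (h : ∀ a ∈ t, ∀ b, a + b ∈ r ↔ b ∈ s) : restrict 𝒜 r (x * y) = x * restrict 𝒜 s y := by
  classical
  refine homogeneous_induction (𝒜 := 𝒜)
    (p := fun y => restrict 𝒜 r (x * y) = x * restrict 𝒜 s y) y (by simp) ?_
    (fun x x' hx hx' => by rw [mul_add, map_add, map_add, mul_add, hx, hx'])
  intro γ a ha
  refine supportedIn_induction (p := fun x => restrict 𝒜 r (x * a) = x * restrict 𝒜 s a) (by simp)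
    ?_ (fun x x' hx hx' => by rw [add_mul, map_add, add_mul, hx, hx']) hx
  intro γ' hγ' b hb
  rw [restrict_of_mem_graded (SetLike.mul_mem_graded hb ha), restrict_of_mem_graded ha,
    if_congr (h γ' hγ' γ) rfl rfl]
  split_ifs <;> simp

/-- Leading parts with respect to a weight `w` are multiplicative. -/
theorem restrict_mul_of_le {O : Type*} [AddCommGroup O] [LinearOrder O] [IsOrderedAddMonoid O]
    (w : Γ →+ O) {a b : O} {x y : E} (hx : x ∈ supportedIn 𝒜 {γ | w γ ≤ a})
    (hy : y ∈ supportedIn 𝒜 {γ | w γ ≤ b}) :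
    restrict 𝒜 {γ | w γ = a + b} (x * y) =
      restrict 𝒜 {γ | w γ = a} x * restrict 𝒜 {γ | w γ = b} y := by
  classical
  refine supportedIn_induction (p := fun x => restrict 𝒜 {γ | w γ = a + b} (x * y) =
      restrict 𝒜 {γ | w γ = a} x * restrict 𝒜 {γ | w γ = b} y) (by simp) ?_
    (fun x x' hx hx' => by rw [add_mul, map_add, map_add, add_mul, hx, hx']) hx
  intro γ hγ c hc
  refine supportedIn_induction (p := fun y => restrict 𝒜 {γ | w γ = a + b} (c * y) =
      restrict 𝒜 {γ | w γ = a} c * restrict 𝒜 {γ | w γ = b} y) (by simp) ?_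
    (fun x x' hx hx' => by rw [mul_add, map_add, map_add, mul_add, hx, hx']) hy
  intro γ' hγ' d hd
  rw [restrict_of_mem_graded (SetLike.mul_mem_graded hc hd), restrict_of_mem_graded hc,
    restrict_of_mem_graded hd]
  simp only [Set.mem_ofPred_eq, map_add] at hγ hγ' ⊢
  by_cases h1 : w γ = a
  · simp [h1]
  · have h2 : w γ + w γ' ≠ a + b := (add_lt_add_of_lt_of_le (lt_of_le_of_ne hγ h1) hγ').ne
    simp [h1, h2]

/-- `a` is the largest weight of a nonzero homogeneous component of `x`. -/
def IsTop {O : Type*} [AddCommGroup O] [LinearOrder O] (𝒜 : Γ → AddSubgroup E) [GradedRing 𝒜]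
    (w : Γ →+ O) (a : O) (x : E) : Prop :=
  x ∈ supportedIn 𝒜 {γ | w γ ≤ a} ∧ restrict 𝒜 {γ | w γ = a} x ≠ 0

section Top

variable {O : Type*} [AddCommGroup O] [LinearOrder O] {w : Γ →+ O}

theorem IsTop.ne_zero {a : O} {x : E} (h : IsTop 𝒜 w a x) : x ≠ 0 := by
  rintro rfl
  exact h.2 (map_zero _)

theorem IsTop.le {a b : O} {x : E} (ha : IsTop 𝒜 w a x) (hb : x ∈ supportedIn 𝒜 {γ | w γ ≤ b}) :
    a ≤ b := by
  by_contra! h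
  refine ha.2 (restrict_eq_zero hb fun γ hγ h' => ?_)
  simp only [Set.mem_ofPred_eq] at hγ h'
  exact absurd (h'.symm.le.trans hγ) h.not_ge

theorem IsTop.unique {a b : O} {x : E} (ha : IsTop 𝒜 w a x) (hb : IsTop 𝒜 w b x) : a = b :=
  le_antisymm (ha.le hb.1) (hb.le ha.1)

theorem exists_decompose_ne_zero {x : E} (hx : x ≠ 0) :
    ∃ γ, (DirectSum.decompose 𝒜 x γ : E) ≠ 0 := by
  by_contra! h
  exact hx (ext_decompose (𝒜 := 𝒜) fun γ => by rw [h γ]; simp)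

theorem exists_isTop {x : E} (hx : x ≠ 0) : ∃ γ, (DirectSum.decompose 𝒜 x γ : E) ≠ 0 ∧
    IsTop 𝒜 w (w γ) x := by
  classical
  obtain ⟨γ₀, hγ₀⟩ := exists_decompose_ne_zero (𝒜 := 𝒜) hx
  have hmem : ∀ γ, γ ∈ (DirectSum.decompose 𝒜 x).support ↔
      (DirectSum.decompose 𝒜 x γ : E) ≠ 0 := fun γ => by
    rw [DFinsupp.mem_support_iff, not_iff_not]
    exact ⟨fun h => by rw [h]; rfl, fun h => Subtype.ext h⟩
  obtain ⟨γ, hγ, hmax⟩ := (DirectSum.decompose 𝒜 x).support.exists_max_image w ⟨γ₀, (hmem _).2 hγ₀⟩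
  rw [hmem] at hγ
  refine ⟨γ, hγ, fun γ' hγ' => ?_, fun h => hγ ?_⟩
  · by_contra h
    exact hγ' (hmax γ' ((hmem _).2 h))
  · have := decompose_restrict 𝒜 {γ' | w γ' = w γ} x γ
    rw [h, if_pos (by simp)] at this
    rw [← this]
    simp

theorem isTop_of_mem {a : O} {x : E} (hx : x ≠ 0) (h : x ∈ supportedIn 𝒜 {γ | w γ = a}) :
    IsTop 𝒜 w a x :=
  ⟨supportedIn_mono (fun _ h => le_of_eq h) h, by rwa [restrict_of_mem h]⟩

theorem IsTop.mul [IsOrderedAddMonoid O] [NoZeroDivisors E] {a b : O} {x y : E} (hx : IsTop 𝒜 w a x)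
    (hy : IsTop 𝒜 w b y) : IsTop 𝒜 w (a + b) (x * y) := by
  refine ⟨mul_mem_supportedIn hx.1 hy.1 fun γ h γ' h' => ?_, ?_⟩
  · simp only [Set.mem_ofPred_eq, map_add] at h h' ⊢
    exact add_le_add h h'
  · rw [restrict_mul_of_le w hx.1 hy.1]
    exact mul_ne_zero hx.2 hy.2

variable (𝒜 w) in
/-- The largest weight of a nonzero homogeneous component of `x`; it is `0` for `x = 0`. -/
noncomputable def top (x : E) : O :=
  open scoped Classical in if h : x ≠ 0 then w (exists_isTop (𝒜 := 𝒜) (w := w) h).choose else 0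

theorem isTop_top {x : E} (hx : x ≠ 0) : IsTop 𝒜 w (top 𝒜 w x) x := by
  rw [top, dif_pos hx]
  exact (exists_isTop (𝒜 := 𝒜) (w := w) hx).choose_spec.2

theorem IsTop.top_eq {a : O} {x : E} (h : IsTop 𝒜 w a x) : top 𝒜 w x = a :=
  (isTop_top h.ne_zero).unique h

theorem top_mul [IsOrderedAddMonoid O] [NoZeroDivisors E] {x y : E} (hx : x ≠ 0) (hy : y ≠ 0) :
    top 𝒜 w (x * y) = top 𝒜 w x + top 𝒜 w y :=
  ((isTop_top hx).mul (isTop_top hy)).top_eq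

variable (𝒜 w) in
/-- The difference between the largest and the smallest weight of a homogeneous component. -/
noncomputable def width (x : E) : O := top 𝒜 w x + top 𝒜 (-w) x

theorem width_mul [IsOrderedAddMonoid O] [NoZeroDivisors E] {x y : E} (hx : x ≠ 0) (hy : y ≠ 0) :
    width 𝒜 w (x * y) = width 𝒜 w x + width 𝒜 w y := by
  rw [width, width, width, top_mul hx hy, top_mul hx hy]
  abel

variable [IsOrderedAddMonoid O]

theorem mem_supportedIn_neg {x : E} (hx : x ≠ 0) :
    x ∈ supportedIn 𝒜 {γ | -top 𝒜 (-w) x ≤ w γ} := by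
  refine supportedIn_mono (fun γ hγ => ?_) (isTop_top (𝒜 := 𝒜) (w := -w) hx).1
  simp only [Set.mem_ofPred_eq, AddMonoidHom.neg_apply] at hγ ⊢
  exact neg_le_of_neg_le hγ

theorem neg_top_neg_le_top {x : E} (hx : x ≠ 0) : -top 𝒜 (-w) x ≤ top 𝒜 w x := by
  obtain ⟨γ, hγ⟩ := exists_decompose_ne_zero (𝒜 := 𝒜) hx
  have h1 : w γ ≤ top 𝒜 w x := by
    by_contra h
    exact hγ ((isTop_top hx).1 γ h)
  have h2 : -top 𝒜 (-w) x ≤ w γ := by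
    by_contra h
    exact hγ (mem_supportedIn_neg hx γ h)
  exact h2.trans h1

theorem width_nonneg {x : E} (hx : x ≠ 0) : 0 ≤ width 𝒜 w x := by
  have := neg_top_neg_le_top (𝒜 := 𝒜) (w := w) hx
  rw [width]
  exact neg_le_iff_add_nonneg.mp this

theorem mem_supportedIn_of_width_eq_zero {x : E} (hx : x ≠ 0) (h : width 𝒜 w x = 0) :
    x ∈ supportedIn 𝒜 {γ | w γ = top 𝒜 w x} := fun γ hγ => by
  by_contra h0
  have h1 : w γ ≤ top 𝒜 w x := by
    by_contra h
    exact h0 ((isTop_top hx).1 γ h)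
  have h2 : -top 𝒜 (-w) x ≤ w γ := by
    by_contra h
    exact h0 (mem_supportedIn_neg hx γ h)
  rw [width] at h
  rw [neg_eq_of_add_eq_zero_left h] at h2
  exact hγ (le_antisymm h1 h2)

theorem width_le {a b : O} {x : E} (hx : x ≠ 0) (h : x ∈ supportedIn 𝒜 {γ | a ≤ w γ ∧ w γ ≤ b}) :
    width 𝒜 w x ≤ b - a := by
  have h1 := (isTop_top (𝒜 := 𝒜) (w := w) hx).le (supportedIn_mono (fun _ h => h.2) h)
  have h2 := (isTop_top (𝒜 := 𝒜) (w := -w) hx).le (b := -a)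
    (supportedIn_mono (fun _ h => neg_le_neg h.1) h)
  rw [width, sub_eq_add_neg]
  exact add_le_add h1 h2

theorem width_eq_zero_of_mem {a : O} {x : E} (hx : x ≠ 0)
    (h : x ∈ supportedIn 𝒜 {γ | w γ = a}) : width 𝒜 w x = 0 :=
  le_antisymm ((width_le hx (supportedIn_mono (t := {γ | a ≤ w γ ∧ w γ ≤ a})
    (fun _ h => ⟨(le_of_eq h.symm), le_of_eq h⟩) h)).trans
    (sub_self a).le) (width_nonneg hx)

end Top

end Support

/-! ### Torsion-free abelian groups are orderable -/

/-- Every abelian group has a homomorphism to a linearly ordered group whose kernel is the torsion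
subgroup: the coordinates of `ℚ ⊗ Γ` in some basis, ordered lexicographically. -/
theorem exists_addMonoidHom_linearOrder (Γ : Type v) [AddCommGroup Γ] :
    ∃ (O : Type v) (_ : AddCommGroup O) (_ : LinearOrder O) (_ : IsOrderedAddMonoid O)
      (o : Γ →+ O), ∀ γ, o γ = 0 → ∃ k : ℕ, k ≠ 0 ∧ k • γ = 0 := by
  let b := Module.Basis.ofVectorSpace ℚ (ℚ ⊗[ℤ] Γ)
  let I := Module.Basis.ofVectorSpaceIndex ℚ (ℚ ⊗[ℤ] Γ)
  let _ : LinearOrder I := IsWellOrder.linearOrder WellOrderingRel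
  let f : Γ →ₗ[ℤ] ℚ ⊗[ℤ] Γ := TensorProduct.mk ℤ ℚ Γ 1
  have hf : IsLocalizedModule (nonZeroDivisors ℤ) f :=
    (isLocalizedModule_iff_isBaseChange (nonZeroDivisors ℤ) ℚ f).mpr
      (TensorProduct.isBaseChange ℤ Γ ℚ)
  refine ⟨Lex (I →₀ ℚ), inferInstance, inferInstance, inferInstance,
    { toFun := fun γ => toLex (b.repr (f γ))
      map_zero' := by simp
      map_add' := fun x y => by simp }, fun γ h => ?_⟩
  have h1 : b.repr (f γ) = 0 := toLex.injective h
  have h2 : f γ = 0 := by simpa using h1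
  obtain ⟨⟨k, hk⟩, hk'⟩ := (IsLocalizedModule.eq_zero_iff (nonZeroDivisors ℤ) f).mp h2
  have hk0 : k ≠ 0 := nonZeroDivisors.ne_zero hk
  refine ⟨k.natAbs, Int.natAbs_ne_zero.mpr hk0, ?_⟩
  have hk2 : k • γ = 0 := hk'
  rcases Int.natAbs_eq k with h | h
  · rw [h] at hk2
    exact_mod_cast hk2
  · rw [h, neg_smul, neg_eq_zero] at hk2
    exact_mod_cast hk2

/-! ### Homogeneous elements, zero divisors and units -/

section Basic

variable {Γ : Type v} [AddCommGroup Γ] [DecidableEq Γ] {E : Type u} [Ring E]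
  {𝒜 : Γ → AddSubgroup E} [GradedRing 𝒜]

theorem exists_inverse (hE : IsGradedDivisionRing 𝒜) {γ : Γ} {a : E} (ha : a ∈ 𝒜 γ) (h0 : a ≠ 0) :
    ∃ b ∈ 𝒜 (-γ), a * b = 1 ∧ b * a = 1 := by
  obtain ⟨u, rfl⟩ := hE.isUnit_of_mem γ a ha h0
  have h1 := DirectSum.coe_decompose_mul_add_of_left_mem 𝒜 (j := -γ) (b := (↑u⁻¹ : E)) ha
  rw [Units.mul_inv, add_neg_cancel,
    DirectSum.decompose_of_mem_same 𝒜 (SetLike.one_mem_graded 𝒜)] at h1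
  have h2 : (↑u⁻¹ : E) = (DirectSum.decompose 𝒜 (↑u⁻¹ : E) (-γ) : E) := by
    rw [← mul_one (↑u⁻¹ : E)]
    conv_lhs => rw [h1]
    rw [← mul_assoc, Units.inv_mul, one_mul, mul_one]
  exact ⟨↑u⁻¹, by rw [h2]; exact SetLike.coe_mem _, by simp, by simp⟩

/-- The group of degrees of nonzero homogeneous elements. -/
def gradeGroup (hE : IsGradedDivisionRing 𝒜) : AddSubgroup Γ where
  carrier := {γ | ∃ a ∈ 𝒜 γ, a ≠ 0}
  zero_mem' := ⟨1, SetLike.one_mem_graded 𝒜, by have := hE.nontrivial; exact one_ne_zero⟩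
  add_mem' := by
    rintro γ γ' ⟨a, ha, ha0⟩ ⟨b, hb, hb0⟩
    refine ⟨a * b, SetLike.mul_mem_graded ha hb, fun h => hb0 ?_⟩
    exact (hE.isUnit_of_mem γ a ha ha0).mul_right_eq_zero.mp h
  neg_mem' := by
    rintro γ ⟨a, ha, ha0⟩
    have := hE.nontrivial
    obtain ⟨b, hb, hab, -⟩ := exists_inverse hE ha ha0
    exact ⟨b, hb, right_ne_zero_of_mul_eq_one hab⟩

theorem mem_gradeGroup (hE : IsGradedDivisionRing 𝒜) {γ : Γ} {a : E} (ha : a ∈ 𝒜 γ) (h0 : a ≠ 0) :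
    γ ∈ gradeGroup hE := ⟨a, ha, h0⟩

theorem gradeGroup_torsionFree (hE : IsGradedDivisionRing 𝒜) {γ : Γ} (hγ : γ ∈ gradeGroup hE)
    {k : ℕ} (hk : k ≠ 0) (h : k • γ = 0) : γ = 0 := by
  obtain ⟨a, ha, ha0⟩ := hγ
  exact hE.torsionFree γ (fun h => ha0 (by rw [h] at ha; exact ha)) k hk h

/-- An ordering of the grade group, given by a homomorphism of `Γ` to a linearly ordered group that
is injective on the grade group. -/
theorem exists_order (hE : IsGradedDivisionRing 𝒜) :
    ∃ (O : Type v) (_ : AddCommGroup O) (_ : LinearOrder O) (_ : IsOrderedAddMonoid O)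
      (o : Γ →+ O), ∀ γ ∈ gradeGroup hE, ∀ γ' ∈ gradeGroup hE, o γ = o γ' → γ = γ' := by
  obtain ⟨O, i1, i2, i3, o, ho⟩ := exists_addMonoidHom_linearOrder Γ
  refine ⟨O, i1, i2, i3, o, fun γ hγ γ' hγ' h => ?_⟩
  obtain ⟨k, hk, hk'⟩ := ho (γ - γ') (by rw [map_sub, h, sub_self])
  exact sub_eq_zero.mp (gradeGroup_torsionFree hE (sub_mem hγ hγ') hk hk')

variable {O : Type*} [AddCommGroup O] [LinearOrder O] [IsOrderedAddMonoid O] {o : Γ →+ O}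

omit [LinearOrder O] [IsOrderedAddMonoid O] in
theorem exists_mem_of_mem_supportedIn_fiber (hE : IsGradedDivisionRing 𝒜)
    (ho : ∀ γ ∈ gradeGroup hE, ∀ γ' ∈ gradeGroup hE, o γ = o γ' → γ = γ') {a : O} {x : E}
    (hx : x ≠ 0) (h : x ∈ supportedIn 𝒜 {γ | o γ = a}) : ∃ γ, o γ = a ∧ x ∈ 𝒜 γ := by
  obtain ⟨γ, hγ⟩ := exists_decompose_ne_zero (𝒜 := 𝒜) hx
  have hγa : o γ = a := by
    by_contra h'
    exact hγ (h γ h')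
  refine ⟨γ, hγa, mem_supportedIn_singleton.mp fun γ' hγ' => ?_⟩
  by_contra h0
  have hγ'a : o γ' = a := by
    by_contra h'
    exact h0 (h γ' h')
  exact hγ' (ho γ' (mem_gradeGroup hE (SetLike.coe_mem _) h0) γ
    (mem_gradeGroup hE (SetLike.coe_mem _) hγ) (hγ'a.trans hγa.symm))

omit [IsOrderedAddMonoid O] in
theorem isUnit_restrict_top (hE : IsGradedDivisionRing 𝒜)
    (ho : ∀ γ ∈ gradeGroup hE, ∀ γ' ∈ gradeGroup hE, o γ = o γ' → γ = γ') {a : O} {x : E}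
    (hx : IsTop 𝒜 o a x) : IsUnit (restrict 𝒜 {γ | o γ = a} x) := by
  obtain ⟨γ, -, hγ⟩ := exists_mem_of_mem_supportedIn_fiber hE ho hx.2 (restrict_mem _ x)
  exact hE.isUnit_of_mem γ _ hγ hx.2

theorem noZeroDivisors (hE : IsGradedDivisionRing 𝒜) : NoZeroDivisors E where
  eq_zero_or_eq_zero_of_mul_eq_zero {x y} hxy := by
    obtain ⟨O, i1, i2, i3, o, ho⟩ := exists_order hE
    by_contra! h
    have hx := isTop_top (𝒜 := 𝒜) (w := o) h.1
    have hy := isTop_top (𝒜 := 𝒜) (w := o) h.2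
    have h1 := restrict_mul_of_le o hx.1 hy.1
    rw [hxy, map_zero, eq_comm] at h1
    exact hy.2 ((isUnit_restrict_top hE ho hx).mul_right_eq_zero.mp h1)

theorem isDomain (hE : IsGradedDivisionRing 𝒜) : IsDomain E := by
  have := hE.nontrivial
  have := noZeroDivisors hE
  exact NoZeroDivisors.to_isDomain E

/-- Units are homogeneous, as the highest and the lowest degree of a product are additive. -/
theorem exists_mem_of_isUnit (hE : IsGradedDivisionRing 𝒜) {x : E} (hx : IsUnit x) :
    ∃ γ, x ∈ 𝒜 γ := by
  obtain ⟨O, i1, i2, i3, o, ho⟩ := exists_order hE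
  have := isDomain hE
  obtain ⟨u, rfl⟩ := hx
  have h1 := width_mul (𝒜 := 𝒜) (w := o) u.ne_zero u⁻¹.ne_zero
  rw [Units.mul_inv, width_eq_zero_of_mem (a := 0) one_ne_zero
    (one_mem_supportedIn (by simp))] at h1
  have h2 := width_nonneg (𝒜 := 𝒜) (w := o) u.ne_zero
  have h3 := width_nonneg (𝒜 := 𝒜) (w := o) u⁻¹.ne_zero
  have h4 := ((add_eq_zero_iff_of_nonneg h2 h3).mp h1.symm).1
  obtain ⟨γ, -, hγ⟩ := exists_mem_of_mem_supportedIn_fiber hE ho u.ne_zero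
    (mem_supportedIn_of_width_eq_zero u.ne_zero h4)
  exact ⟨γ, hγ⟩

end Basic

/-! ### The center, and integrality over it -/

section Center

variable {Γ : Type v} [AddCommGroup Γ] [DecidableEq Γ] {E : Type u} [Ring E]
  {𝒜 : Γ → AddSubgroup E} [GradedRing 𝒜]

theorem restrict_mem_center (s : Set Γ) {c : E} (hc : c ∈ Subring.center E) :
    restrict 𝒜 s c ∈ Subring.center E := by
  rw [Subring.mem_center_iff] at hc ⊢
  intro x
  refine homogeneous_induction (𝒜 := 𝒜)
    (p := fun x => x * restrict 𝒜 s c = restrict 𝒜 s c * x) x (by simp) ?_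
    (fun x y hx hy => by rw [add_mul, mul_add, hx, hy])
  intro γ a ha
  have h1 := restrict_mul_of_right_mem (𝒜 := 𝒜) (s := s) (t := {γ}) (r := {b | b - γ ∈ s}) c
    (mem_supportedIn_singleton.mpr ha) (by simp)
  have h2 := restrict_mul_of_left_mem (𝒜 := 𝒜) (s := s) (t := {γ}) (r := {b | b - γ ∈ s}) c
    (mem_supportedIn_singleton.mpr ha) (by simp)
  rw [← h1, ← h2, hc]

theorem pow_mem_supportedIn (Δ : AddSubgroup Γ) {x : E} (hx : x ∈ supportedIn 𝒜 (Δ : Set Γ))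
    (n : ℕ) : x ^ n ∈ supportedIn 𝒜 (Δ : Set Γ) := by
  induction n with
  | zero => rw [pow_zero]; exact one_mem_supportedIn Δ.zero_mem
  | succ n ih =>
    rw [pow_succ]
    exact mul_mem_supportedIn ih hx fun a ha b hb => Δ.add_mem ha hb

theorem restrict_addSubgroup_mul (Δ : AddSubgroup Γ) (x : E) {y : E}
    (hy : y ∈ supportedIn 𝒜 (Δ : Set Γ)) :
    restrict 𝒜 Δ (x * y) = restrict 𝒜 Δ x * y :=
  restrict_mul_of_right_mem x hy fun _ _ hb => Δ.add_mem_cancel_right hb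

/-- An integral equation over the center may be restricted to any subgroup of degrees. -/
theorem exists_integral_equation [Module.Finite (Subring.center E) E] (Δ : AddSubgroup Γ) {e : E}
    (he : e ∈ supportedIn 𝒜 (Δ : Set Γ)) :
    ∃ (n : ℕ) (c : ℕ → E), (∀ i, c i ∈ Subring.center E ∧ c i ∈ supportedIn 𝒜 (Δ : Set Γ)) ∧
      e ^ n = ∑ i ∈ Finset.range n, c i * e ^ i := by
  have := Algebra.IsIntegral.of_finite (Subring.center E) E
  obtain ⟨p, hp, hpe⟩ := Algebra.IsIntegral.isIntegral (R := Subring.center E) e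
  have h1 : Polynomial.aeval e p = 0 := hpe
  rw [Polynomial.aeval_eq_sum_range, Finset.sum_range_succ, hp.coeff_natDegree, one_smul,
    add_comm, add_eq_zero_iff_eq_neg] at h1
  refine ⟨p.natDegree, fun i => -restrict 𝒜 Δ (p.coeff i : E), fun i => ⟨?_, ?_⟩, ?_⟩
  · exact neg_mem (restrict_mem_center _ (p.coeff i).2)
  · exact neg_mem (restrict_mem _ _)
  · have h2 := congrArg (restrict 𝒜 (Δ : Set Γ)) h1
    rw [restrict_of_mem (pow_mem_supportedIn Δ he _), map_neg, map_sum] at h2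
    rw [h2, ← Finset.sum_neg_distrib]
    refine Finset.sum_congr rfl fun i _ => ?_
    rw [Subring.smul_def, smul_eq_mul,
      restrict_addSubgroup_mul Δ _ (pow_mem_supportedIn Δ he i), neg_mul]

theorem mul_eq_comm_of_mem_center [NoZeroDivisors E] {a e t : E} (he : e ≠ 0)
    (ht : t ∈ Subring.center E) (h : a * e = t) : e * a = t := by
  have h1 : (e * a - t) * e = 0 := by
    rw [sub_mul, mul_assoc, h, sub_eq_zero]
    exact Subring.mem_center_iff.mp ht e
  exact sub_eq_zero.mp ((mul_eq_zero.mp h1).resolve_right he)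

/-- Every nonzero element divides a nonzero central one, within any subgroup of degrees: the lowest
nonzero coefficient of an integral equation, after division by a power of the element. -/
theorem exists_mul_eq_center [IsDomain E] [Module.Finite (Subring.center E) E] (Δ : AddSubgroup Γ)
    {e : E} (he : e ∈ supportedIn 𝒜 (Δ : Set Γ)) (h0 : e ≠ 0) :
    ∃ a ∈ supportedIn 𝒜 (Δ : Set Γ), ∃ t ∈ Subring.center E,
      t ∈ supportedIn 𝒜 (Δ : Set Γ) ∧ t ≠ 0 ∧ a * e = t ∧ e * a = t := by
  have key : ∀ (n : ℕ) (c : ℕ → E),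
      (∀ i, c i ∈ Subring.center E ∧ c i ∈ supportedIn 𝒜 (Δ : Set Γ)) →
      (∃ i < n, c i ≠ 0) → ∑ i ∈ Finset.range n, c i * e ^ i = 0 →
      ∃ a ∈ supportedIn 𝒜 (Δ : Set Γ), ∃ t ∈ Subring.center E,
        t ∈ supportedIn 𝒜 (Δ : Set Γ) ∧ t ≠ 0 ∧ a * e = t ∧ e * a = t := by
    intro n
    induction n with
    | zero => rintro c - ⟨i, hi, -⟩; exact absurd hi (Nat.not_lt_zero i)
    | succ n ih =>
      intro c hc hne hsum
      rw [Finset.sum_range_succ', pow_zero, mul_one] at hsum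
      have h1 : (∑ i ∈ Finset.range n, c (i + 1) * e ^ i) * e =
          ∑ i ∈ Finset.range n, c (i + 1) * e ^ (i + 1) := by
        rw [Finset.sum_mul]
        exact Finset.sum_congr rfl fun i _ => by rw [pow_succ, mul_assoc]
      by_cases hc0 : c 0 = 0
      · rw [hc0, add_zero, ← h1] at hsum
        refine ih (fun i => c (i + 1)) (fun i => hc _) ?_
          ((mul_eq_zero.mp hsum).resolve_right h0)
        obtain ⟨i, hi, hci⟩ := hne
        cases i with
        | zero => exact absurd hc0 hci
        | succ i => exact ⟨i, by omega, hci⟩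
      · have h2 : (-∑ i ∈ Finset.range n, c (i + 1) * e ^ i) * e = c 0 := by
          rw [neg_mul, h1]
          exact neg_eq_of_add_eq_zero_right hsum
        refine ⟨_, neg_mem (sum_mem fun i _ => mul_mem_supportedIn (hc _).2
          (pow_mem_supportedIn Δ he i) fun a ha b hb => Δ.add_mem ha hb), c 0, (hc 0).1, (hc 0).2,
          hc0, h2, mul_eq_comm_of_mem_center h0 (hc 0).1 h2⟩
  obtain ⟨n, c, hc, h⟩ := exists_integral_equation (𝒜 := 𝒜) Δ he
  refine key (n + 1) (fun i => if i < n then c i else if i = n then -1 else 0) (fun i => ?_)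
    ⟨n, n.lt_succ_self, by simp⟩ ?_
  · split_ifs
    · exact hc i
    · exact ⟨neg_mem (one_mem _), neg_mem (one_mem_supportedIn Δ.zero_mem)⟩
    · exact ⟨zero_mem _, zero_mem _⟩
  · rw [Finset.sum_range_succ, if_neg (lt_irrefl n), if_pos rfl, h, neg_one_mul,
      add_neg_eq_zero]
    exact Finset.sum_congr rfl fun i hi => by rw [if_pos (Finset.mem_range.mp hi)]

end Center

/-! ### Homogeneous bases -/

section Bases

variable {Γ : Type v} [AddCommGroup Γ] [DecidableEq Γ] {E : Type u} [Ring E]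
  {𝒜 : Γ → AddSubgroup E} [GradedRing 𝒜]

variable (𝒜) in
/-- A subset of a graded ring is graded if it contains the homogeneous components of its
elements. -/
def IsGraded (M : Set E) : Prop := ∀ x ∈ M, ∀ γ, (DirectSum.decompose 𝒜 x γ : E) ∈ M

theorem decompose_mul_of_right_mem (x : E) {y : E} {β : Γ} (hy : y ∈ 𝒜 β) (γ : Γ) :
    (DirectSum.decompose 𝒜 (x * y) (γ + β) : E) = DirectSum.decompose 𝒜 x γ * y :=
  DirectSum.coe_decompose_mul_add_of_right_mem 𝒜 hy

/-- A graded left module over a graded subring whose homogeneous elements are invertible has a basis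
of homogeneous elements. -/
theorem exists_homogeneous_basis (K : Subring E) (hK : IsGraded 𝒜 (K : Set E))
    (hinv : ∀ γ, ∀ a ∈ 𝒜 γ, a ∈ K → a ≠ 0 → ∃ b ∈ K, b * a = 1)
    (M : Submodule K E) (hM : IsGraded 𝒜 (M : Set E)) :
    ∃ s : Set E, (∀ x ∈ s, x ∈ M ∧ ∃ γ, x ∈ 𝒜 γ) ∧ LinearIndepOn K id s ∧
      Submodule.span K s = M := by
  let v : {x : E // x ∈ M ∧ ∃ γ, x ∈ 𝒜 γ} → E := Subtype.val
  obtain ⟨s, hs, hmax⟩ := exists_maximal_linearIndepOn K v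
  have hsM : ∀ x ∈ v '' s, x ∈ M ∧ ∃ γ, x ∈ 𝒜 γ := by
    rintro _ ⟨x, -, rfl⟩
    exact x.2
  refine ⟨v '' s, hsM, hs.id_image, le_antisymm (Submodule.span_le.mpr fun x hx => (hsM x hx).1) ?_⟩
  have hgr : ∀ x ∈ Submodule.span K (v '' s), ∀ γ,
      (DirectSum.decompose 𝒜 x γ : E) ∈ Submodule.span K (v '' s) := by
    intro x hx
    refine Submodule.closure_induction
      (p := fun x _ => ∀ γ, (DirectSum.decompose 𝒜 x γ : E) ∈ Submodule.span K (v '' s)) ?_ ?_ ?_ hx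
    · intro γ
      simp
    · intro x y _ _ hx hy γ
      rw [DirectSum.decompose_add]
      exact add_mem (hx γ) (hy γ)
    · intro k x hx γ
      obtain ⟨β, hβ⟩ := (hsM x hx).2
      have h1 := decompose_mul_of_right_mem (𝒜 := 𝒜) (k : E) hβ (γ - β)
      rw [sub_add_cancel] at h1
      rw [Subring.smul_def, smul_eq_mul, h1]
      exact Submodule.smul_mem _ (⟨_, hK k k.2 (γ - β)⟩ : K) (Submodule.subset_span hx)
  have hom : ∀ x ∈ M, (∃ γ, x ∈ 𝒜 γ) → x ∈ Submodule.span K (v '' s) := by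
    rintro x hx ⟨β, hβ⟩
    by_cases hxs : (⟨x, hx, β, hβ⟩ : {x : E // x ∈ M ∧ ∃ γ, x ∈ 𝒜 γ}) ∈ s
    · exact Submodule.subset_span ⟨_, hxs, rfl⟩
    obtain ⟨a, ha, ha'⟩ := hmax _ hxs
    obtain ⟨γ, hγ⟩ := exists_decompose_ne_zero (𝒜 := 𝒜) (x := (a : E)) (by simpa using ha)
    have h1 := hgr _ ha' (γ + β)
    rw [Subring.smul_def, smul_eq_mul, decompose_mul_of_right_mem (𝒜 := 𝒜) (a : E) hβ γ] at h1
    obtain ⟨b, hb, hba⟩ := hinv γ _ (SetLike.coe_mem _) (hK a a.2 γ) hγ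
    have h2 := Submodule.smul_mem _ (⟨b, hb⟩ : K) h1
    rw [Subring.smul_def, smul_eq_mul, ← mul_assoc, hba, one_mul] at h2
    exact h2
  intro x hx
  classical
  rw [← DirectSum.sum_support_decompose 𝒜 x]
  exact sum_mem fun γ _ => hom _ (hM x hx γ) ⟨γ, SetLike.coe_mem _⟩

end Bases

/-! ### The graded density theorem -/

section Density

variable {Γ : Type v} [AddCommGroup Γ] [DecidableEq Γ] {E : Type u} [Ring E]
  {𝒜 : Γ → AddSubgroup E} [GradedRing 𝒜]

/-- The maps `x ↦ ∑ zₖ x eₖ` with `zₖ ∈ L` and `eₖ ∈ E`. -/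
def twoSided (L : Subring E) : AddSubgroup (E → E) :=
  AddSubgroup.closure {f | ∃ z ∈ L, ∃ e, f = fun x => z * x * e}

theorem twoSided_induction {L : Subring E} {f : E → E} (hf : f ∈ twoSided L) {x : E}
    (M : AddSubgroup E) (h : ∀ z ∈ L, ∀ e, z * x * e ∈ M) : f x ∈ M := by
  refine AddSubgroup.closure_induction (p := fun f _ => f x ∈ M) ?_ ?_ ?_ ?_ hf
  · rintro _ ⟨z, hz, e, rfl⟩
    exact h z hz e
  · exact zero_mem _
  · intro f g _ _ hf hg
    exact add_mem hf hg
  · intro f _ hf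
    exact neg_mem hf

theorem id_mem_twoSided (L : Subring E) : (fun x => x) ∈ twoSided L :=
  AddSubgroup.subset_closure ⟨1, one_mem _, 1, by simp⟩

theorem mul_right_mem_twoSided {L : Subring E} {f : E → E} (hf : f ∈ twoSided L) (e : E) :
    (fun x => f x * e) ∈ twoSided L := by
  refine AddSubgroup.closure_induction (p := fun f _ => (fun x => f x * e) ∈ twoSided L)
    ?_ ?_ ?_ ?_ hf
  · rintro _ ⟨z, hz, e', rfl⟩
    exact AddSubgroup.subset_closure ⟨z, hz, e' * e, by simp only [mul_assoc]⟩
  · simp only [Pi.zero_apply, zero_mul]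
    exact zero_mem (twoSided L)
  · intro f g _ _ hf hg
    simp only [Pi.add_apply, add_mul]
    exact add_mem hf hg
  · intro f _ hf
    simp only [Pi.neg_apply, neg_mul]
    exact neg_mem hf

theorem mul_left_mem_twoSided {L : Subring E} {f : E → E} (hf : f ∈ twoSided L) {z : E}
    (hz : z ∈ L) : (fun x => z * f x) ∈ twoSided L := by
  refine AddSubgroup.closure_induction (p := fun f _ => (fun x => z * f x) ∈ twoSided L)
    ?_ ?_ ?_ ?_ hf
  · rintro _ ⟨z', hz', e, rfl⟩
    exact AddSubgroup.subset_closure ⟨z * z', mul_mem hz hz', e, by simp only [mul_assoc]⟩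
  · simp only [Pi.zero_apply, mul_zero]
    exact zero_mem (twoSided L)
  · intro f g _ _ hf hg
    simp only [Pi.add_apply, mul_add]
    exact add_mem hf hg
  · intro f _ hf
    simp only [Pi.neg_apply, mul_neg]
    exact neg_mem hf

variable (𝒜) in
/-- The map `f` raises degrees by `δ`. -/
def HasDegree (δ : Γ) (f : E → E) : Prop := ∀ γ, ∀ x ∈ 𝒜 γ, f x ∈ 𝒜 (γ + δ)

open scoped Classical in
/-- A graded form of Jacobson's density theorem: if every element commuting with the homogeneous
elements of `L` lies in `K`, then the dual system of finitely many homogeneous elements that are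
left independent over `K` is given by maps `x ↦ ∑ zₖ x eₖ` with `zₖ ∈ L`. -/
theorem exists_dual (hE : IsGradedDivisionRing 𝒜) (L K : Subring E)
    (hLK : ∀ x, (∀ γ, ∀ z ∈ L, z ∈ 𝒜 γ → z * x = x * z) → x ∈ K)
    {ι : Type*} (b : ι → E) (β : ι → Γ) (hb : ∀ i, b i ∈ 𝒜 (β i)) (s : Finset ι)
    (hind : ∀ c : ι → E, (∀ i, c i ∈ K) → ∀ t ⊆ s, ∑ i ∈ t, c i * b i = 0 → ∀ i ∈ t, c i = 0) :
    ∃ θ : ι → E → E, ∀ i ∈ s, θ i ∈ twoSided L ∧ HasDegree 𝒜 (-β i) (θ i) ∧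
      ∀ j ∈ s, θ i (b j) = if i = j then 1 else 0 := by
  induction s using Finset.induction_on with
  | empty => exact ⟨fun _ _ => 0, by simp⟩
  | insert k s hks ih =>
    obtain ⟨θ, hθ⟩ := ih fun c hc t ht => hind c hc t (ht.trans (Finset.subset_insert k s))
    -- It suffices to find a map that kills the old elements, but not the new one.
    suffices ∃ (δ : Γ) (ψ : E → E), ψ ∈ twoSided L ∧ HasDegree 𝒜 δ ψ ∧ (∀ j ∈ s, ψ (b j) = 0) ∧
        ψ (b k) ≠ 0 by
      obtain ⟨δ, ψ₀, hψ₀, hdeg, hψs, hψk⟩ := this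
      obtain ⟨w, hw, hw1, -⟩ := exists_inverse hE (hdeg _ _ (hb k)) hψk
      let ψ : E → E := fun x => ψ₀ x * w
      have hψ : ψ ∈ twoSided L := mul_right_mem_twoSided hψ₀ w
      have hψd : HasDegree 𝒜 (-β k) ψ := fun γ x hx => by
        have := SetLike.mul_mem_graded (hdeg γ x hx) hw
        rwa [show γ + δ + -(β k + δ) = γ + -β k by abel] at this
      refine ⟨fun i => if i = k then ψ else fun x => θ i x - ψ x * θ i (b k), fun i hi => ?_⟩
      rcases Finset.mem_insert.mp hi with rfl | his
      · beta_reduce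
        rw [if_pos rfl]
        refine ⟨hψ, hψd, fun j hj => ?_⟩
        rcases Finset.mem_insert.mp hj with rfl | hjs
        · rw [if_pos rfl]
          exact hw1
        · rw [if_neg (by rintro rfl; exact hks hjs)]
          simp only [ψ, hψs j hjs, zero_mul]
      · obtain ⟨h1, h2, h3⟩ := hθ i his
        have hik : i ≠ k := by rintro rfl; exact hks his
        beta_reduce
        rw [if_neg hik]
        refine ⟨sub_mem h1 (mul_right_mem_twoSided hψ _), fun γ x hx => ?_, fun j hj => ?_⟩
        · have := SetLike.mul_mem_graded (hψd γ x hx) (h2 _ _ (hb k))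
          rw [show γ + -β k + (β k + -β i) = γ + -β i by abel] at this
          exact sub_mem (h2 γ x hx) this
        · rcases Finset.mem_insert.mp hj with rfl | hjs
          · rw [if_neg hik]
            simp only [ψ, hw1, one_mul, sub_self]
          · simp only [ψ, hψs j hjs, zero_mul, sub_zero]
            exact h3 j hjs
    by_cases hx : ∀ i ∈ s, θ i (b k) ∈ K
    -- Then `x - ∑ θ i x * b i` does not kill `b k`, by independence over `K`.
    · refine ⟨0, fun x => x - ∑ i ∈ s, θ i x * b i, ?_, ?_, ?_, ?_⟩
      · refine sub_mem (id_mem_twoSided L) ?_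
        have : (fun x => ∑ i ∈ s, θ i x * b i) = ∑ i ∈ s, fun x => θ i x * b i := by
          ext x; simp
        rw [this]
        exact sum_mem fun i hi => mul_right_mem_twoSided (hθ i hi).1 _
      · intro γ x hx
        rw [add_zero]
        refine sub_mem hx (sum_mem fun i hi => ?_)
        have := SetLike.mul_mem_graded ((hθ i hi).2.1 γ x hx) (hb i)
        rwa [neg_add_cancel_right] at this
      · intro j hj
        beta_reduce
        rw [Finset.sum_eq_single_of_mem j hj, (hθ j hj).2.2 j hj, if_pos rfl, one_mul, sub_self]
        intro i hi hij
        rw [(hθ i hi).2.2 j hj, if_neg hij, zero_mul]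
      · intro h0
        have hc := hind (fun i => if i = k then 1 else if i ∈ s then -θ i (b k) else 0) (fun i => by
          split_ifs with h1 h2
          · exact one_mem K
          · exact neg_mem (hx i h2)
          · exact zero_mem K) (insert k s) subset_rfl (by
            refine Eq.trans ?_ h0
            beta_reduce
            rw [Finset.sum_insert hks, if_pos rfl, one_mul, sub_eq_add_neg,
              ← Finset.sum_neg_distrib]
            congr 1
            refine Finset.sum_congr rfl fun i hi => ?_
            rw [if_neg (by rintro rfl; exact hks hi), if_pos hi, neg_mul]) k
            (Finset.mem_insert_self k s)
        rw [if_pos rfl] at hc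
        have := hE.nontrivial
        exact one_ne_zero hc
    -- Otherwise some `z ∈ L` does not commute with some `θ i (b k)`, but it commutes with the
    -- values `0` and `1` of `θ i` on the old elements.
    · push Not at hx
      obtain ⟨i, hi, hiK⟩ := hx
      have : ∃ γ, ∃ z ∈ L, z ∈ 𝒜 γ ∧ z * θ i (b k) ≠ θ i (b k) * z := by
        by_contra! h
        exact hiK (hLK _ h)
      obtain ⟨ζ, z, hzL, hz, hne⟩ := this
      obtain ⟨h1, h2, h3⟩ := hθ i hi
      refine ⟨-β i + ζ, fun x => z * θ i x - θ i x * z, ?_, ?_, ?_, sub_ne_zero.mpr hne⟩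
      · exact sub_mem (mul_left_mem_twoSided h1 hzL) (mul_right_mem_twoSided h1 z)
      · intro γ x hx
        have h4 := SetLike.mul_mem_graded hz (h2 γ x hx)
        have h5 := SetLike.mul_mem_graded (h2 γ x hx) hz
        rw [show ζ + (γ + -β i) = γ + (-β i + ζ) by abel] at h4
        rw [show γ + -β i + ζ = γ + (-β i + ζ) by abel] at h5
        exact sub_mem h4 h5
      · intro j hj
        beta_reduce
        rw [h3 j hj]
        split_ifs <;> simp

end Density

/-! ### Matrices of right multiplications -/

section Split

variable {R L A : Type*} [CommRing R] [CommRing L] [Ring A] [Algebra R L] [Algebra R A]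
  [Module L A] [IsScalarTower R L A] [IsScalarTower L A A] {n : ℕ}

/-- The matrix of the right multiplication by an element of `A`, in a basis of `A` as a left module
over `L`. -/
noncomputable def rightMulMatrix (b : Module.Basis (Fin n) L A) :
    A →ₐ[R] Matrix (Fin n) (Fin n) L where
  toFun a := Matrix.of fun i j => b.repr (b i * a) j
  map_one' := by
    ext i j
    simp [Matrix.one_apply, Finsupp.single_apply]
  map_zero' := by ext; simp
  map_add' x y := by ext; simp [mul_add]
  map_mul' x y := by
    ext i j
    have h : b i * (x * y) = ∑ k, b.repr (b i * x) k • (b k * y) := by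
      rw [← mul_assoc]
      conv_lhs => rw [← b.sum_repr (b i * x)]
      rw [Finset.sum_mul]
      exact Finset.sum_congr rfl fun k _ => smul_mul_assoc _ _ _
    simp only [Matrix.of_apply, Matrix.mul_apply]
    rw [h, map_sum, Finsupp.finsetSum_apply]
    simp
  commutes' r := by
    ext i j
    rw [Matrix.algebraMap_matrix_apply, Matrix.of_apply, ← Algebra.commutes, ← Algebra.smul_def,
      ← algebraMap_smul L r (b i), map_smul, b.repr_self]
    simp [Finsupp.single_apply, Algebra.algebraMap_eq_smul_one]

theorem rightMulMatrix_apply (b : Module.Basis (Fin n) L A) (a : A) (i j : Fin n) :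
    rightMulMatrix (R := R) b a i j = b.repr (b i * a) j := rfl

theorem sum_rightMulMatrix (b : Module.Basis (Fin n) L A) (a : A) (i : Fin n) :
    ∑ j, rightMulMatrix (R := R) b a i j • b j = b i * a := by
  simp only [rightMulMatrix_apply]
  exact b.sum_repr _

/-- The map `L ⊗ A → Mₙ(L)` that extends `rightMulMatrix`. -/
noncomputable def tensorToMatrix (b : Module.Basis (Fin n) L A) :
    L ⊗[R] A →ₐ[L] Matrix (Fin n) (Fin n) L :=
  Algebra.TensorProduct.lift (Algebra.ofId L _) (rightMulMatrix b) fun l _ =>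
    Algebra.commute_algebraMap_left l _

theorem tensorToMatrix_tmul (b : Module.Basis (Fin n) L A) (l : L) (a : A) :
    tensorToMatrix (R := R) b (l ⊗ₜ a) = l • rightMulMatrix (R := R) b a := by
  refine (Algebra.TensorProduct.lift_tmul _ _ _ l a).trans ?_
  rw [Algebra.ofId_apply, Algebra.smul_def]

theorem exists_tensor_of_twoSided (b : Module.Basis (Fin n) L A) {L' : Subring A}
    (hL' : ∀ z ∈ L', ∃ l : L, ∀ y : A, z * y = l • y) {f : A → A} (hf : f ∈ twoSided L') :
    ∃ x : L ⊗[R] A, ∀ i j, tensorToMatrix b x i j = b.repr (f (b i)) j := by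
  refine AddSubgroup.closure_induction (p := fun f _ => ∃ x : L ⊗[R] A, ∀ i j,
    tensorToMatrix b x i j = b.repr (f (b i)) j) ?_ ?_ ?_ ?_ hf
  · rintro _ ⟨z, hz, e, rfl⟩
    obtain ⟨l, hl⟩ := hL' z hz
    refine ⟨l ⊗ₜ e, fun i j => ?_⟩
    beta_reduce
    rw [tensorToMatrix_tmul, Matrix.smul_apply, rightMulMatrix_apply, hl, smul_mul_assoc, map_smul,
      Finsupp.smul_apply]
  · exact ⟨0, by simp⟩
  · rintro f g - - ⟨x, hx⟩ ⟨y, hy⟩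
    exact ⟨x + y, fun i j => by simp [hx, hy]⟩
  · rintro f - ⟨x, hx⟩
    exact ⟨-x, fun i j => by simp [hx]⟩

theorem tensorToMatrix_surjective (b : Module.Basis (Fin n) L A) {L' : Subring A}
    (hL' : ∀ z ∈ L', ∃ l : L, ∀ y : A, z * y = l • y)
    (θ : Fin n → A → A) (hθ : ∀ i, θ i ∈ twoSided L')
    (hθb : ∀ i j, θ i (b j) = if i = j then 1 else 0) :
    Function.Surjective (tensorToMatrix (R := R) b) := by
  have h1 : ∀ i j, ∃ x, tensorToMatrix (R := R) b x = Matrix.single i j 1 := by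
    intro i j
    obtain ⟨x, hx⟩ := exists_tensor_of_twoSided (R := R) b hL'
      (mul_right_mem_twoSided (hθ i) (b j))
    refine ⟨x, ?_⟩
    ext k l
    rw [hx, hθb, Matrix.single_apply]
    by_cases hik : i = k <;> simp [hik, Finsupp.single_apply]
  choose x hx using h1
  intro M
  refine ⟨∑ i, ∑ j, M i j • x i j, ?_⟩
  simp only [map_sum, map_smul, hx]
  conv_rhs => rw [Matrix.matrix_eq_sum_single M]
  simp

theorem tensorToMatrix_injective (b : Module.Basis (Fin n) L A) {κ : Type*} [Fintype κ]
    [DecidableEq κ] (c : Module.Basis κ R A) (hL : ∀ l : L, l • (1 : A) = 0 → l = 0)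
    (θ : κ → A → A) (hθ : ∀ i, θ i ∈ twoSided (⊤ : Subring A))
    (hθc : ∀ i j, θ i (c j) = if i = j then 1 else 0) :
    Function.Injective (tensorToMatrix (R := R) b) := by
  rw [injective_iff_map_eq_zero]
  intro x hx
  let B := Algebra.TensorProduct.basis L c
  have hB : ∀ k, B k = 1 ⊗ₜ c k := fun k => Algebra.TensorProduct.basis_apply c k
  let l : κ → L := fun k => B.repr x k
  have hxl : x = ∑ k, l k • B k := (B.sum_repr x).symm
  -- The map `y ↦ ∑ l k • (y * c k)` vanishes on the basis `b`, hence everywhere.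
  have h1 : ∀ y : A, ∑ k, l k • (y * c k) = 0 := by
    let g : A →ₗ[L] A := ∑ k, l k •
      { toFun := fun y => y * c k
        map_add' := fun y z => add_mul y z _
        map_smul' := fun r y => smul_mul_assoc r y _ }
    have hg : ∀ y, g y = ∑ k, l k • (y * c k) := fun y => by
      simp only [g, LinearMap.sum_apply]
      rfl
    suffices g = 0 by
      intro y
      rw [← hg, this, LinearMap.zero_apply]
    refine b.ext fun i => ?_
    rw [hg, LinearMap.zero_apply]
    have h2 : ∀ k, b i * c k = ∑ j, tensorToMatrix (R := R) b (B k) i j • b j := fun k => by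
      rw [hB, tensorToMatrix_tmul, one_smul, sum_rightMulMatrix]
    simp only [h2, Finset.smul_sum, smul_smul]
    rw [Finset.sum_comm]
    refine Finset.sum_eq_zero fun j _ => ?_
    rw [← Finset.sum_smul]
    have h3 := congrFun (congrFun hx i) j
    rw [hxl, map_sum, Matrix.sum_apply] at h3
    simp only [map_smul, Matrix.smul_apply, smul_eq_mul, Matrix.zero_apply] at h3
    rw [h3, zero_smul]
  have h2 : ∀ f ∈ twoSided (⊤ : Subring A), ∑ k, l k • f (c k) = 0 := by
    intro f hf
    refine AddSubgroup.closure_induction (p := fun f _ => ∑ k, l k • f (c k) = 0) ?_ ?_ ?_ ?_ hf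
    · rintro _ ⟨z, -, e, rfl⟩
      simp only [← smul_mul_assoc]
      rw [← Finset.sum_mul]
      simp only [smul_mul_assoc]
      rw [h1, zero_mul]
    · simp
    · intro f g _ _ hf hg
      simp only [Pi.add_apply, smul_add, Finset.sum_add_distrib, hf, hg, add_zero]
    · intro f _ hf
      simp only [Pi.neg_apply, smul_neg, Finset.sum_neg_distrib, hf, neg_zero]
  rw [hxl]
  refine Finset.sum_eq_zero fun k _ => ?_
  have h3 := h2 _ (hθ k)
  simp only [hθc] at h3
  rw [Finset.sum_eq_single k (fun j _ hj => by rw [if_neg hj.symm, smul_zero]) (by simp),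
    if_pos rfl] at h3
  rw [hL _ h3, zero_smul]

/-- The determinant of `a` is a left multiple of `a`, by the adjugate matrix. -/
theorem exists_mul_eq_of_det (b : Module.Basis (Fin n) L A) (a : A) (r : R)
    (h : algebraMap R L r = (rightMulMatrix (R := R) b a).det) : ∃ x : A, x * a = r • 1 := by
  let M := rightMulMatrix (R := R) b a
  let u : Fin n → A := fun i => ∑ k, M.adjugate i k • b k
  have hu : ∀ i, u i * a = r • b i := by
    intro i
    simp only [u, Finset.sum_mul, smul_mul_assoc]
    simp only [← sum_rightMulMatrix (R := R) b a, Finset.smul_sum, smul_smul]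
    rw [Finset.sum_comm]
    simp only [← Finset.sum_smul]
    have : ∀ j, ∑ k, M.adjugate i k * M k j = (M.adjugate * M) i j := fun j => rfl
    change ∑ j, (∑ k, M.adjugate i k * M k j) • b j = _
    simp only [this, Matrix.adjugate_mul, Matrix.smul_apply, Matrix.one_apply]
    rw [Finset.sum_eq_single i (fun j _ hj => by simp [hj.symm]) (by simp), if_pos rfl,
      smul_eq_mul, mul_one, ← h, algebraMap_smul]
  refine ⟨∑ i, b.repr 1 i • u i, ?_⟩
  simp only [Finset.sum_mul, smul_mul_assoc, hu]
  conv_rhs => rw [← b.sum_repr 1, Finset.smul_sum]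
  exact Finset.sum_congr rfl fun i _ => smul_comm _ _ _

end Split

/-! ### Base change of splittings and reduced norms -/

section BaseChange

variable {R F A : Type u} [CommRing R] [CommRing F] [Algebra R F] [Ring A] [Algebra R A]

variable (R F A) in
theorem exists_cancelBaseChange (W : Type u) [CommRing W] [Algebra R W] [Algebra F W]
    [IsScalarTower R F W] :
    ∃ e : W ⊗[F] (F ⊗[R] A) ≃ₐ[W] W ⊗[R] A, ∀ (w : W) (c : F) (a : A),
      e (w ⊗ₜ (c ⊗ₜ a)) = (c • w) ⊗ₜ a := by
  let L := TensorProduct.AlgebraTensorModule.cancelBaseChange R F W W A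
  have hL : ∀ (w : W) (c : F) (a : A), L (w ⊗ₜ (c ⊗ₜ a)) = (c • w) ⊗ₜ a := fun w c a =>
    TensorProduct.AlgebraTensorModule.cancelBaseChange_tmul R F W w a c
  refine ⟨Algebra.TensorProduct.algEquivOfLinearEquivTensorProduct L
    (fun w₁ w₂ x₁ x₂ => ?_) ?_, hL⟩
  · induction x₁ with
    | zero => simp
    | add x y hx hy => rw [add_mul, TensorProduct.tmul_add, TensorProduct.tmul_add, map_add,
        map_add, hx, hy, add_mul]
    | tmul c₁ a₁ =>
      induction x₂ with
      | zero => simp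
      | add x y hx hy => rw [mul_add, TensorProduct.tmul_add, TensorProduct.tmul_add, map_add,
          map_add, hx, hy, mul_add]
      | tmul c₂ a₂ =>
        rw [Algebra.TensorProduct.tmul_mul_tmul, hL, hL, hL, Algebra.TensorProduct.tmul_mul_tmul,
          smul_mul_smul_comm]
  · rw [Algebra.TensorProduct.one_def, hL, one_smul, Algebra.TensorProduct.one_def]

/-- Base change of a splitting. -/
theorem exists_splittingDatum_baseChange (s : SplittingDatum R A) :
    ∃ t : SplittingDatum F (F ⊗[R] A), ∀ (a : A) (r : R), algebraMap R s.S r = s.det a →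
      algebraMap F t.S (algebraMap R F r) = t.det (1 ⊗ₜ a) := by
  let W := F ⊗[R] s.S
  let g : s.S →ₐ[R] W := Algebra.TensorProduct.includeRight
  obtain ⟨ψ, hψ⟩ := s.exists_baseChange g
  obtain ⟨e, he⟩ := exists_cancelBaseChange R F A W
  refine ⟨{ S := W, n := s.n, iso := e.trans ψ }, fun a r h => ?_⟩
  have h1 : ψ (e (1 ⊗ₜ (1 ⊗ₜ a))) = (s.iso (1 ⊗ₜ a)).map g := by
    rw [he, one_smul, hψ]
  change _ = (ψ (e (1 ⊗ₜ (1 ⊗ₜ a)))).det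
  have h2 : ((s.iso (1 ⊗ₜ a)).map g).det = g (s.det a) :=
    (RingHom.map_det g.toRingHom _).symm
  rw [h1, h2, ← h, AlgHom.commutes, ← IsScalarTower.algebraMap_apply]

/-- The reduced norm commutes with base change. -/
theorem reducedNorm_baseChange (s : SplittingDatum R A) (a : A) :
    reducedNorm F (F ⊗[R] A) (1 ⊗ₜ a) = algebraMap R F (reducedNorm R A a) := by
  obtain ⟨t, ht⟩ := exists_splittingDatum_baseChange (F := F) s
  apply t.algebraMap_injective
  rw [algebraMap_reducedNorm t, ← ht a _ (algebraMap_reducedNorm s a)]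

theorem reducedNorm_algebraMap (s : SplittingDatum R A) (r : R) :
    reducedNorm R A (algebraMap R A r) = r ^ s.n := by
  apply s.algebraMap_injective
  rw [algebraMap_reducedNorm s]
  have h1 : (1 : s.S) ⊗ₜ[R] algebraMap R A r = algebraMap R s.S r • (1 : s.S ⊗[R] A) := by
    rw [algebraMap_smul, Algebra.TensorProduct.one_def, Algebra.algebraMap_eq_smul_one,
      TensorProduct.tmul_smul]
  change (s.iso (1 ⊗ₜ algebraMap R A r)).det = _
  rw [h1, map_smul, map_one, Matrix.det_smul, Matrix.det_one, mul_one, Fintype.card_fin, map_pow]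

end BaseChange

/-! ### Splitting by a maximal commutative graded subring -/

section MaxComm

variable {Γ : Type v} [AddCommGroup Γ] [DecidableEq Γ] {E : Type u} [Ring E]
  {𝒜 : Γ → AddSubgroup E} [GradedRing 𝒜]

/-- A graded commutative subring that is its own centralizer: the centralizer of a maximal set of
pairwise commuting homogeneous elements. -/
theorem exists_maximal_commutative (𝒜 : Γ → AddSubgroup E) [GradedRing 𝒜] :
    ∃ L : Subring E, IsGraded 𝒜 (L : Set E) ∧
      (∀ x ∈ L, ∀ y ∈ L, x * y = y * x) ∧
      ∀ x, (∀ γ, ∀ z ∈ L, z ∈ 𝒜 γ → z * x = x * z) → x ∈ L := by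
  let S : Set (Set E) := {X | (∀ x ∈ X, ∃ γ, x ∈ 𝒜 γ) ∧ ∀ x ∈ X, ∀ y ∈ X, x * y = y * x}
  obtain ⟨X, hX⟩ := zorn_subset S (by
    intro c hc hchain
    refine ⟨⋃₀ c, ⟨?_, ?_⟩, fun s hs => Set.subset_sUnion_of_mem hs⟩
    · rintro x ⟨s, hs, hx⟩
      exact (hc hs).1 x hx
    · rintro x ⟨s, hs, hx⟩ y ⟨t, ht, hy⟩
      rcases hchain.total hs ht with h | h
      · exact (hc ht).2 x (h hx) y hy
      · exact (hc hs).2 x hx y (h hy))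
  have hXS : X ∈ S := hX.prop
  have hmax : ∀ x, (∃ γ, x ∈ 𝒜 γ) → (∀ y ∈ X, y * x = x * y) → x ∈ X := by
    intro x hx hxy
    have h : insert x X ∈ S := by
      refine ⟨?_, ?_⟩
      · rintro y (rfl | hy)
        · exact hx
        · exact hXS.1 y hy
      · rintro y (rfl | hy) z (rfl | hz)
        · rfl
        · exact (hxy z hz).symm
        · exact hxy y hy
        · exact hXS.2 y hy z hz
    exact hX.le_of_ge h (Set.subset_insert x X) (Set.mem_insert x X)
  let L : Subring E := Subring.centralizer X
  have hmem : ∀ {x}, x ∈ L ↔ ∀ y ∈ X, y * x = x * y := Subring.mem_centralizer_iff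
  have hgr : IsGraded 𝒜 (L : Set E) := by
    intro x hx γ
    refine hmem.mpr fun y hy => ?_
    obtain ⟨β, hβ⟩ := hXS.1 y hy
    have h1 := DirectSum.coe_decompose_mul_add_of_left_mem 𝒜 (j := γ) (b := x) hβ
    have h2 := DirectSum.coe_decompose_mul_add_of_right_mem 𝒜 (i := γ) (a := x) hβ
    rw [← h1, ← h2, add_comm, hmem.mp hx y hy]
  have hXL : ∀ x ∈ L, ∀ y, y ∈ L → (∃ γ, y ∈ 𝒜 γ) → x * y = y * x := fun x hx y hy hyh =>
    (hmem.mp hx y (hmax y hyh (hmem.mp hy))).symm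
  refine ⟨L, hgr, fun x hx y hy => ?_, fun x hx => hmem.mpr fun y hy => ?_⟩
  · classical
    rw [← DirectSum.sum_support_decompose 𝒜 y, Finset.mul_sum, Finset.sum_mul]
    exact Finset.sum_congr rfl fun γ _ => hXL x hx _ (hgr y hy γ) ⟨γ, SetLike.coe_mem _⟩
  · obtain ⟨γ, hγ⟩ := hXS.1 y hy
    exact hx γ y (hmem.mpr fun z hz => hXS.2 z hz y hy) hγ

theorem isGraded_center : IsGraded 𝒜 (Subring.center E : Set E) := fun x hx γ => by
  rw [← restrict_singleton]
  exact restrict_mem_center _ hx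

theorem exists_inverse_mem_center (hE : IsGradedDivisionRing 𝒜) {γ : Γ} {a : E} (ha : a ∈ 𝒜 γ)
    (hac : a ∈ Subring.center E) (h0 : a ≠ 0) :
    ∃ b ∈ Subring.center E, b ∈ 𝒜 (-γ) ∧ b * a = 1 := by
  obtain ⟨b, hb, hab, hba⟩ := exists_inverse hE ha h0
  refine ⟨b, Subring.mem_center_iff.mpr fun x => ?_, hb, hba⟩
  calc x * b = b * a * (x * b) := by rw [hba, one_mul]
    _ = b * (a * x) * b := by simp only [mul_assoc]
    _ = b * x * (a * b) := by rw [← Subring.mem_center_iff.mp hac x]; simp only [mul_assoc]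
    _ = b * x := by rw [hab, mul_one]

theorem linearIndepOn_sum_eq_zero {K : Subring E} {s : Set E} (hs : LinearIndepOn K id s)
    (c : s → E) (hc : ∀ i, c i ∈ K) (t : Finset s) (h : ∑ i ∈ t, c i * (i : E) = 0) :
    ∀ i ∈ t, c i = 0 := by
  intro i hi
  have h1 := linearIndependent_iff'.mp hs t (fun i => ⟨c i, hc i⟩) h i hi
  exact congrArg Subtype.val h1

/-- A finite homogeneous basis of `E` over its center, whose coordinate functions are maps
`x ↦ ∑ aₖ x eₖ`. -/
theorem exists_center_basis (hE : IsGradedDivisionRing 𝒜)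
    (hfin : Module.Finite (Subring.center E) E) :
    ∃ (s : Set E) (_ : Fintype s) (c : Module.Basis s (Subring.center E) E) (β : s → Γ)
      (θ : s → E → E), (∀ i, c i ∈ 𝒜 (β i)) ∧ (∀ i, θ i ∈ twoSided (⊤ : Subring E)) ∧
      (∀ i, HasDegree 𝒜 (-β i) (θ i)) ∧
      ∀ x, ∀ i, θ i x = c.repr x i := by
  classical
  have := hE.nontrivial
  obtain ⟨s, hs, hli, hspan⟩ := exists_homogeneous_basis (𝒜 := 𝒜) (Subring.center E)
    isGraded_center (fun γ a ha hac h0 => by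
      obtain ⟨b, hb, -, hba⟩ := exists_inverse_mem_center hE ha hac h0
      exact ⟨b, hb, hba⟩) ⊤ (fun x _ γ => trivial)
  let c : Module.Basis s (Subring.center E) E := Module.Basis.mk hli (by
    simpa using hspan.ge)
  have hc : ∀ i, c i = i := fun i => Module.Basis.mk_apply _ _ i
  have : Finite s := Module.Finite.finite_basis c
  let _ : Fintype s := Fintype.ofFinite s
  choose β hβ using fun i : s => (hs i i.2).2
  obtain ⟨θ, hθ⟩ := exists_dual hE ⊤ (Subring.center E) (fun x hx => by
    rw [Subring.mem_center_iff]
    intro y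
    refine homogeneous_induction (𝒜 := 𝒜) (p := fun y => y * x = x * y) y (by simp)
      (fun γ a ha => hx γ a trivial ha) (fun a b ha hb => by rw [add_mul, mul_add, ha, hb]))
    (fun i : s => (i : E)) β hβ Finset.univ
    (fun d hd t _ ht => linearIndepOn_sum_eq_zero hli d hd t ht)
  refine ⟨s, inferInstance, c, β, θ, fun i => by rw [hc]; exact hβ i,
    fun i => (hθ i (Finset.mem_univ i)).1, fun i => (hθ i (Finset.mem_univ i)).2.1,
    fun x i => ?_⟩
  have hlin : ∀ f ∈ twoSided (⊤ : Subring E), (∀ x y, f (x + y) = f x + f y) ∧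
      ∀ t ∈ Subring.center E, ∀ x, f (t * x) = t * f x := by
    intro f hf
    refine AddSubgroup.closure_induction (p := fun f _ => (∀ x y, f (x + y) = f x + f y) ∧
      ∀ t ∈ Subring.center E, ∀ x, f (t * x) = t * f x) ?_ ?_ ?_ ?_ hf
    · rintro _ ⟨z, -, e, rfl⟩
      refine ⟨fun x y => by simp only [mul_add, add_mul], fun t ht x => ?_⟩
      simp only [← mul_assoc]
      rw [Subring.mem_center_iff.mp ht z]
    · simp
    · rintro f g - - ⟨h1, h2⟩ ⟨h3, h4⟩
      refine ⟨fun x y => ?_, fun t ht x => ?_⟩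
      · simp only [Pi.add_apply, h1, h3]
        abel
      · simp only [Pi.add_apply, h2 t ht, h4 t ht, mul_add]
    · rintro f - ⟨h1, h2⟩
      refine ⟨fun x y => ?_, fun t ht x => ?_⟩
      · simp only [Pi.neg_apply, h1]
        abel
      · simp only [Pi.neg_apply, h2 t ht, mul_neg]
  obtain ⟨h1, h2⟩ := hlin _ (hθ i (Finset.mem_univ i)).1
  let f : E →ₗ[Subring.center E] E :=
    { toFun := θ i, map_add' := h1, map_smul' := fun t x => h2 t t.2 x }
  let g : E →ₗ[Subring.center E] E :=
    { toFun := fun x => c.repr x i, map_add' := by simp, map_smul' := fun t x => by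
        simp only [map_smul, Finsupp.smul_apply, smul_eq_mul]
        rfl }
  suffices f = g from congrArg (fun h : E →ₗ[Subring.center E] E => h x) this
  refine c.ext fun j => ?_
  change θ i (c j) = (c.repr (c j) i : Subring.center E)
  rw [c.repr_self, hc, (hθ i (Finset.mem_univ i)).2.2 j (Finset.mem_univ j), Finsupp.single_apply]
  by_cases hij : i = j
  · simp [hij]
  · simp [hij, Ne.symm hij]

/-- `E` is split by a maximal commutative graded subring `L`, through the action of `L ⊗ E` on
`E`. -/
theorem exists_splittingDatum (hE : IsGradedDivisionRing 𝒜)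
    (hfin : Module.Finite (Subring.center E) E) :
    ∃ s : SplittingDatum (Subring.center E) E, ∀ (e : E) (r : Subring.center E),
      algebraMap (Subring.center E) s.S r = s.det e → ∃ x : E, x * e = r := by
  classical
  have := hE.nontrivial
  obtain ⟨L, hgr, hcomm, hmax⟩ := exists_maximal_commutative 𝒜
  have hcL : Subring.center E ≤ L := fun x hx =>
    hmax x fun γ z _ _ => Subring.mem_center_iff.mp hx z
  let _ : CommRing L := { (inferInstance : Ring L) with
    mul_comm := fun x y => Subtype.ext (hcomm x x.2 y y.2) }
  let _ : Algebra (Subring.center E) L := (Subring.inclusion hcL).toAlgebra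
  have _ : IsScalarTower (Subring.center E) L E := IsScalarTower.of_algebraMap_smul fun _ _ => rfl
  have _ : IsScalarTower L E E := ⟨fun x y z => mul_assoc _ _ _⟩
  have hinv : ∀ γ, ∀ a ∈ 𝒜 γ, a ∈ L → a ≠ 0 → ∃ b ∈ L, b * a = 1 := by
    intro γ a ha haL h0
    obtain ⟨b, hb, hab, hba⟩ := exists_inverse hE ha h0
    refine ⟨b, hmax b fun δ z hz _ => ?_, hba⟩
    calc z * b = b * a * (z * b) := by rw [hba, one_mul]
      _ = b * (a * z) * b := by simp only [mul_assoc]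
      _ = b * z * (a * b) := by rw [hcomm a haL z hz]; simp only [mul_assoc]
      _ = b * z := by rw [hab, mul_one]
  -- The subring `L` is free over the center.
  have hfree : Module.Free (Subring.center E) L := by
    let M : Submodule (Subring.center E) E :=
      { carrier := L
        add_mem' := L.add_mem
        zero_mem' := L.zero_mem
        smul_mem' := fun t x hx => L.mul_mem (hcL t.2) hx }
    obtain ⟨s, -, hli, hspan⟩ := exists_homogeneous_basis (𝒜 := 𝒜) (Subring.center E)
      isGraded_center (fun γ a ha hac h0 => by
        obtain ⟨b, hb, -, hba⟩ := exists_inverse_mem_center hE ha hac h0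
        exact ⟨b, hb, hba⟩) M hgr
    have hspan' : Submodule.span (Subring.center E) (Set.range fun i : s => (i : E)) = M := by
      rw [Subtype.range_coe]
      exact hspan
    let e : M ≃ₗ[Subring.center E] L :=
      { toFun := fun x => ⟨x, x.2⟩
        invFun := fun x => ⟨x, x.2⟩
        map_add' := fun _ _ => rfl
        map_smul' := fun _ _ => rfl }
    exact Module.Free.of_basis
      (((Module.Basis.span hli).map (LinearEquiv.ofEq _ _ hspan')).map e)
  -- A homogeneous basis of `E` as a left module over `L`, and its dual system.
  obtain ⟨s, hs, hli, hspan⟩ := exists_homogeneous_basis (𝒜 := 𝒜) L hgr hinv ⊤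
    (fun x _ γ => trivial)
  let b₀ : Module.Basis s L E := Module.Basis.mk hli (by simpa using hspan.ge)
  have hb₀ : ∀ i, b₀ i = i := fun i => Module.Basis.mk_apply _ _ i
  have : Module.Finite L E := Module.Finite.of_restrictScalars_finite (Subring.center E) L E
  have : Finite s := Module.Finite.finite_basis b₀
  let _ : Fintype s := Fintype.ofFinite s
  choose β hβ using fun i : s => (hs i i.2).2
  obtain ⟨θ, hθ⟩ := exists_dual hE L L hmax
    (fun i : s => (i : E)) β hβ Finset.univ
    (fun d hd t _ ht => linearIndepOn_sum_eq_zero hli d hd t ht)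
  let n := Fintype.card s
  let ε : s ≃ Fin n := Fintype.equivFin s
  let b : Module.Basis (Fin n) L E := b₀.reindex ε
  have hb : ∀ i, b i = (ε.symm i : E) := fun i => by rw [Module.Basis.reindex_apply, hb₀]
  have hsurj : Function.Surjective (tensorToMatrix (R := Subring.center E) b) := by
    refine tensorToMatrix_surjective b (L' := L) (fun z hz => ⟨⟨z, hz⟩, fun y => rfl⟩)
      (fun i => θ (ε.symm i)) (fun i => (hθ _ (Finset.mem_univ _)).1) fun i j => ?_
    rw [hb, (hθ _ (Finset.mem_univ _)).2.2 _ (Finset.mem_univ _)]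
    simp
  obtain ⟨κ, _, c, -, ψ, -, hψ, -, hψc⟩ := exists_center_basis hE hfin
  have hinj : Function.Injective (tensorToMatrix (R := Subring.center E) b) := by
    refine tensorToMatrix_injective b c (fun l hl => ?_) ψ hψ fun i j => ?_
    · rw [Subring.smul_def, smul_eq_mul, mul_one] at hl
      exact Subtype.ext hl
    · rw [hψc, c.repr_self, Finsupp.single_apply]
      by_cases hij : i = j
      · simp [hij]
      · simp [hij, Ne.symm hij]
  refine ⟨{ S := L, n := n, iso := AlgEquiv.ofBijective (tensorToMatrix b) ⟨hinj, hsurj⟩ },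
    fun e r h => ?_⟩
  have hdet : algebraMap (Subring.center E) L r =
      (tensorToMatrix (R := Subring.center E) b (1 ⊗ₜ e)).det := h
  rw [tensorToMatrix_tmul, one_smul] at hdet
  obtain ⟨x, hx⟩ := exists_mul_eq_of_det b e r hdet
  refine ⟨x, ?_⟩
  rw [hx, Subring.smul_def, smul_eq_mul, mul_one]

end MaxComm

/-! ### Factorization in noncommutative Euclidean domains -/

/-- The function `d` is an additive degree on the domain `B`, whose elements of degree `0` are
units, and `B` has division with remainder, the quotients being left factors. -/
structure IsLeftEuclidean (B : Type*) [Ring B] (d : B → ℕ) : Prop where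
  map_mul : ∀ a b, a ≠ 0 → b ≠ 0 → d (a * b) = d a + d b
  isUnit_of_eq_zero : ∀ a, a ≠ 0 → d a = 0 → IsUnit a
  exists_div : ∀ p b, b ≠ 0 → ∃ c r, p = c * b + r ∧ (r = 0 ∨ d r < d b)

/-- A nonzero element `p` that generates a maximal left ideal. -/
structure GeneratesMaximal {B : Type*} [Ring B] (p : B) : Prop where
  ne_zero : p ≠ 0
  not_isUnit : ¬IsUnit p
  exists_eq_one : ∀ c, (¬∃ z, c = z * p) → ∃ x y, x * p + y * c = 1

section Euclid

variable {B : Type*} [Ring B] [IsDomain B] {d : B → ℕ}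

theorem isUnit_of_mul_eq_one_left {x p : B} (h : x * p = 1) : IsUnit p := by
  have hp : p ≠ 0 := right_ne_zero_of_mul_eq_one h
  have h2 : (p * x - 1) * p = 0 := by rw [sub_mul, mul_assoc, h, mul_one, one_mul, sub_self]
  have h3 := sub_eq_zero.mp ((mul_eq_zero.mp h2).resolve_right hp)
  exact ⟨⟨p, x, h3, h⟩, rfl⟩

theorem IsLeftEuclidean.eq_zero_of_isUnit (hB : IsLeftEuclidean B d) {u : B} (hu : IsUnit u) :
    d u = 0 := by
  obtain ⟨u, rfl⟩ := hu
  have h1 := hB.map_mul 1 1 one_ne_zero one_ne_zero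
  have h2 := hB.map_mul u ↑u⁻¹ u.ne_zero u⁻¹.ne_zero
  rw [mul_one] at h1
  rw [Units.mul_inv] at h2
  omega

omit [IsDomain B] in
theorem IsLeftEuclidean.exists_gcd (hB : IsLeftEuclidean B d) {p : B} (hp : p ≠ 0) (c : B) :
    ∃ g x y z w, g ≠ 0 ∧ g = x * p + y * c ∧ p = z * g ∧ c = w * g := by
  classical
  have hex : ∃ n g, g ≠ 0 ∧ (∃ x y, g = x * p + y * c) ∧ d g = n :=
    ⟨d p, p, hp, ⟨1, 0, by simp⟩, rfl⟩
  obtain ⟨g, hg0, ⟨x, y, hg⟩, hgd⟩ := Nat.find_spec hex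
  have key : ∀ a, (∃ x y, a = x * p + y * c) → ∃ z, a = z * g := by
    rintro a ⟨x', y', ha⟩
    obtain ⟨z, r, hz, hr⟩ := hB.exists_div a g hg0
    refine ⟨z, ?_⟩
    rcases hr with rfl | hr
    · rw [hz, add_zero]
    · by_cases hr0 : r = 0
      · rw [hz, hr0, add_zero]
      · rw [hgd] at hr
        refine absurd ⟨r, hr0, ⟨x' - z * x, y' - z * y, ?_⟩, rfl⟩ (Nat.find_min hex hr)
        rw [eq_sub_of_add_eq' hz.symm, ha, hg]
        noncomm_ring
  obtain ⟨z, hz⟩ := key p ⟨1, 0, by simp⟩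
  obtain ⟨w, hw⟩ := key c ⟨0, 1, by simp⟩
  exact ⟨g, x, y, z, w, hg0, hg, hz, hw⟩

omit [IsDomain B] in
/-- A nonunit right divisor of least degree generates a maximal left ideal. -/
theorem IsLeftEuclidean.exists_right_factor (hB : IsLeftEuclidean B d) {b : B} (hb : b ≠ 0)
    (hu : ¬IsUnit b) : ∃ b' p, GeneratesMaximal p ∧ b = b' * p := by
  classical
  have hex : ∃ n p, ¬IsUnit p ∧ (∃ b', b = b' * p) ∧ d p = n := ⟨d b, b, hu, ⟨1, by simp⟩, rfl⟩
  obtain ⟨p, hpu, ⟨b', hbp⟩, hpd⟩ := Nat.find_spec hex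
  have hp0 : p ≠ 0 := by rintro rfl; exact hb (by rw [hbp, mul_zero])
  refine ⟨b', p, ⟨hp0, hpu, fun c hc => ?_⟩, hbp⟩
  obtain ⟨g, x, y, z, w, hg0, hg, hz, hw⟩ := hB.exists_gcd hp0 c
  have hz0 : z ≠ 0 := by rintro rfl; exact hp0 (by rw [hz, zero_mul])
  by_cases hgu : IsUnit g
  · obtain ⟨g, rfl⟩ := hgu
    refine ⟨↑g⁻¹ * x, ↑g⁻¹ * y, ?_⟩
    rw [mul_assoc, mul_assoc, ← mul_add, ← hg, Units.inv_mul]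
  · exfalso
    have h1 := hB.map_mul z g hz0 hg0
    rw [← hz] at h1
    have h2 : d p ≤ d g := by
      rw [hpd]
      exact Nat.find_min' hex ⟨g, hgu, ⟨b' * z, by rw [mul_assoc, ← hz, hbp]⟩, rfl⟩
    obtain ⟨z, rfl⟩ := hB.isUnit_of_eq_zero z hz0 (by omega)
    exact hc ⟨w * ↑z⁻¹, by rw [hz, mul_assoc, ← mul_assoc _ _ g, Units.inv_mul, one_mul, hw]⟩

omit [IsDomain B] in
theorem IsLeftEuclidean.exists_factorization (hB : IsLeftEuclidean B d) {b : B} (hb : b ≠ 0) :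
    ∃ (u : B) (l : List B), IsUnit u ∧ (∀ p ∈ l, GeneratesMaximal p) ∧ b = u * l.prod := by
  induction hn : d b using Nat.strong_induction_on generalizing b with
  | _ n ih =>
  by_cases hu : IsUnit b
  · exact ⟨b, [], hu, by simp, by simp⟩
  obtain ⟨b', p, hp, hbp⟩ := hB.exists_right_factor hb hu
  have hb' : b' ≠ 0 := by rintro rfl; exact hb (by rw [hbp, zero_mul])
  have h1 := hB.map_mul b' p hb' hp.ne_zero
  have h2 : d p ≠ 0 := fun h => hp.not_isUnit (hB.isUnit_of_eq_zero p hp.ne_zero h)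
  rw [← hbp] at h1
  obtain ⟨u, l, hu, hl, hbl⟩ := ih (d b') (by omega) hb' rfl
  refine ⟨u, l ++ [p], hu, fun q hq => ?_, by rw [hbp, hbl]; simp [mul_assoc]⟩
  rcases List.mem_append.mp hq with hq | hq
  · exact hl q hq
  · rw [List.mem_singleton.mp hq]
    exact hp

variable {A : Type*} [CommGroup A] (H : Subgroup A) (cl : B → A)

/-- If `B / Bq` and `B / Bp` are isomorphic through multiplication by `b`, then `q` and `p` agree up
to units and commutators. The Euclidean algorithm for the pair `(p, b)` reduces this to the case
`b = 0`. -/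
theorem IsLeftEuclidean.div_mem_of_relation (hB : IsLeftEuclidean B d)
    (hmul : ∀ a b, a ≠ 0 → b ≠ 0 → cl (a * b) = cl a * cl b) (hunit : ∀ u, IsUnit u → cl u ∈ H)
    {p b q a : B} (hp : p ≠ 0) (h : q * b = a * p) (hpb : ∃ x y, x * p + y * b = 1)
    (hrel : ∀ q' a', q' * b = a' * p → ∃ x, q' = x * q ∧ a' = x * a) :
    q ≠ 0 ∧ cl q / cl p ∈ H := by
  classical
  induction hn : (if b = 0 then 0 else d b + 1) using Nat.strong_induction_on
    generalizing p b q a with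
  | _ n ih =>
  by_cases hb : b = 0
  · subst hb
    obtain ⟨x, y, hxy⟩ := hpb
    rw [mul_zero, add_zero] at hxy
    obtain ⟨z, hz, -⟩ := hrel 1 0 (by simp)
    have hq := isUnit_of_mul_eq_one_left hz.symm
    exact ⟨hq.ne_zero, H.div_mem (hunit _ hq) (hunit _ (isUnit_of_mul_eq_one_left hxy))⟩
  · rw [if_neg hb] at hn
    obtain ⟨c, r, hr, hrd⟩ := hB.exists_div p b hb
    have hr' : r = p - c * b := eq_sub_of_add_eq' hr.symm
    obtain ⟨ha, hab⟩ := ih (if r = 0 then 0 else d r + 1) (by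
        rcases hrd with h | h
        · rw [if_pos h]; omega
        · split_ifs <;> omega) (p := b) (b := r) (q := a) (a := q - a * c) hb (by
        rw [hr', mul_sub, sub_mul, h, mul_assoc]) (by
        obtain ⟨x, y, hxy⟩ := hpb
        refine ⟨x * c + y, x, ?_⟩
        rw [← hxy, hr']
        noncomm_ring) (fun q' a' h' => by
        obtain ⟨x, hx1, hx2⟩ := hrel (a' + q' * c) q' (by
          rw [add_mul, ← h', hr']
          noncomm_ring)
        refine ⟨x, hx2, ?_⟩
        rw [eq_sub_of_add_eq hx1, hx2]
        noncomm_ring) rfl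
    have hq : q ≠ 0 := by
      rintro rfl
      rw [zero_mul] at h
      exact mul_ne_zero ha hp h.symm
    refine ⟨hq, ?_⟩
    have h1 := congrArg cl h
    rw [hmul q b hq hb, hmul a p ha hp] at h1
    have h2 : cl q / cl p = cl a / cl b := by rw [div_eq_div_iff_mul_eq_mul, h1, mul_comm]
    rwa [h2]

/-- Similar irreducible elements, those with isomorphic simple modules `B / Bq` and `B / Bp`, agree
up to units and commutators. -/
theorem IsLeftEuclidean.div_mem_of_similar (hB : IsLeftEuclidean B d)
    (hmul : ∀ a b, a ≠ 0 → b ≠ 0 → cl (a * b) = cl a * cl b) (hunit : ∀ u, IsUnit u → cl u ∈ H)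
    {p b q a : B} (hp : GeneratesMaximal p) (hq : GeneratesMaximal q) (h : q * b = a * p)
    (hb : ¬∃ z, b = z * p) : cl q / cl p ∈ H := by
  refine (hB.div_mem_of_relation H cl hmul hunit hp.ne_zero h (hp.exists_eq_one b hb)
    fun q' a' h' => ?_).2
  have h1 : ∃ x, q' = x * q := by
    by_contra hcon
    obtain ⟨x, y, hxy⟩ := hq.exists_eq_one q' hcon
    refine hb ⟨x * a + y * a', ?_⟩
    rw [add_mul, mul_assoc, mul_assoc, ← h, ← h', ← mul_assoc, ← mul_assoc, ← add_mul, hxy, one_mul]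
  obtain ⟨x, rfl⟩ := h1
  refine ⟨x, rfl, mul_right_cancel₀ hp.ne_zero ?_⟩
  rw [← h', mul_assoc, h, mul_assoc]

omit [IsDomain B] in
/-- Over a central subring `C` over which `B` is integral, a maximal left ideal lies over a maximal
ideal of `C`. -/
theorem GeneratesMaximal.exists_one_sub_mul {C : Subring B} (hC : ∀ c ∈ C, ∀ b, c * b = b * c)
    (hint : ∀ b : B, ∃ (k : ℕ) (c : ℕ → B), (∀ i, c i ∈ C) ∧
      b ^ k = ∑ i ∈ Finset.range k, c i * b ^ i)
    {p : B} (hp : GeneratesMaximal p) {c : B} (hc : c ∈ C) (hcp : ¬∃ z, c = z * p) :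
    ∃ c' ∈ C, ∃ z, 1 - c' * c = z * p := by
  obtain ⟨x, y, hxy⟩ := hp.exists_eq_one c hcp
  -- The element `y` inverts `c` modulo `p`, and an integral equation of `y` expresses this inverse
  -- through elements of `C`.
  obtain ⟨k, e, he, hk⟩ := hint y
  have hpow : ∀ i, ∃ w, y ^ i * c ^ i = 1 - w * p := by
    intro i
    induction i with
    | zero => exact ⟨0, by simp⟩
    | succ i ih =>
      obtain ⟨w, hw⟩ := ih
      refine ⟨x + w - w * p * x, ?_⟩
      have h1 : y ^ (i + 1) * c ^ (i + 1) = (y ^ i * c ^ i) * (y * c) := by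
        have h2 := hC (c ^ i) (C.pow_mem hc i) y
        rw [pow_succ, pow_succ, mul_assoc, ← mul_assoc y, ← h2]
        simp only [mul_assoc]
      rw [h1, hw, eq_sub_of_add_eq' hxy]
      noncomm_ring
  choose w hw using hpow
  refine ⟨∑ i ∈ Finset.range k, e i * c ^ (k - 1 - i), sum_mem fun i _ =>
    mul_mem (he i) (pow_mem hc _), w k - ∑ i ∈ Finset.range k, e i * c ^ (k - i) * w i, ?_⟩
  have h1 : y ^ k * c ^ k = ∑ i ∈ Finset.range k, e i * c ^ (k - i) * (1 - w i * p) := by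
    rw [hk, Finset.sum_mul]
    refine Finset.sum_congr rfl fun i hi => ?_
    rw [← hw, mul_assoc (e i) (c ^ (k - i)), ← mul_assoc (c ^ (k - i)),
      hC _ (C.pow_mem hc (k - i)) (y ^ i), mul_assoc (y ^ i), ← pow_add,
      Nat.sub_add_cancel (Finset.mem_range.mp hi).le, mul_assoc]
  have h2 : (∑ i ∈ Finset.range k, e i * c ^ (k - 1 - i)) * c =
      ∑ i ∈ Finset.range k, e i * c ^ (k - i) := by
    rw [Finset.sum_mul]
    refine Finset.sum_congr rfl fun i hi => ?_
    have hik : k - i = k - 1 - i + 1 := by have := Finset.mem_range.mp hi; omega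
    rw [hik, pow_succ, mul_assoc]
  rw [hw k] at h1
  simp only [mul_sub, mul_one, Finset.sum_sub_distrib, ← mul_assoc] at h1
  rw [← Finset.sum_mul] at h1
  rw [h2, sub_mul]
  rw [sub_eq_sub_iff_add_eq_add] at h1 ⊢
  rw [h1]
  abel

omit [IsDomain B] in
/-- Two maximal left ideals have the same or comaximal intersections with `C`. -/
theorem GeneratesMaximal.eq_or_comaximal {C : Subring B} (hC : ∀ c ∈ C, ∀ b, c * b = b * c)
    (hint : ∀ b : B, ∃ (k : ℕ) (c : ℕ → B), (∀ i, c i ∈ C) ∧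
      b ^ k = ∑ i ∈ Finset.range k, c i * b ^ i)
    {p r : B} (hp : GeneratesMaximal p) (hr : GeneratesMaximal r) :
    (∀ c ∈ C, (∃ z, c = z * p) ↔ ∃ z, c = z * r) ∨
      ∃ x ∈ C, ∃ y ∈ C, (∃ z, x = z * p) ∧ (∃ z, y = z * r) ∧ x + y = 1 := by
  by_contra! h
  obtain ⟨⟨c, hc, hne⟩, h⟩ := h
  rcases hne with ⟨⟨z, hz⟩, h2⟩ | ⟨h1, ⟨z, hz⟩⟩
  · obtain ⟨c', hc', w, hw⟩ := hr.exists_one_sub_mul hC hint hc (by simpa using h2)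
    exact h (c' * c) (mul_mem hc' hc) (1 - c' * c) (sub_mem (one_mem _) (mul_mem hc' hc))
      ⟨c' * z, by rw [hz, mul_assoc]⟩ ⟨w, hw⟩ (by simp)
  · obtain ⟨c', hc', w, hw⟩ := hp.exists_one_sub_mul hC hint hc (by simpa using h1)
    exact h (1 - c' * c) (sub_mem (one_mem _) (mul_mem hc' hc)) (c' * c) (mul_mem hc' hc)
      ⟨w, hw⟩ ⟨c' * z, by rw [hz, mul_assoc]⟩ (by simp)

end Euclid

/-! ### Extensions of groups of degrees with infinite cyclic quotient -/

section Step

variable {Γ : Type v} [AddCommGroup Γ] [DecidableEq Γ] {E : Type u} [Ring E]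
  (𝒜 : Γ → AddSubgroup E) [GradedRing 𝒜]

/-- The subring of the elements whose degrees lie in the subgroup `Δ`. -/
def degSubring (Δ : AddSubgroup Γ) : Subring E where
  carrier := supportedIn 𝒜 (Δ : Set Γ)
  zero_mem' := zero_mem _
  add_mem' := add_mem
  neg_mem' := neg_mem
  one_mem' := one_mem_supportedIn Δ.zero_mem
  mul_mem' hx hy := mul_mem_supportedIn hx hy fun _ ha _ hb => Δ.add_mem ha hb

/-- The central elements whose degrees lie in the subgroup `Δ`. -/
def degCenter (Δ : AddSubgroup Γ) : Subring E := degSubring 𝒜 Δ ⊓ Subring.center E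

variable {𝒜}

theorem degSubring_mono {Δ' Δ : AddSubgroup Γ} (h : Δ' ≤ Δ) : degSubring 𝒜 Δ' ≤ degSubring 𝒜 Δ :=
  supportedIn_mono h

theorem degCenter_le {Δ' Δ : AddSubgroup Γ} (h : Δ' ≤ Δ) : degCenter 𝒜 Δ' ≤ degSubring 𝒜 Δ :=
  inf_le_left.trans (degSubring_mono h)

theorem zpow_mem_graded {u : Eˣ} {δ : Γ} (hu : (u : E) ∈ 𝒜 δ) (hu' : (↑u⁻¹ : E) ∈ 𝒜 (-δ)) (i : ℤ) :
    ((u ^ i : Eˣ) : E) ∈ 𝒜 (i • δ) := by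
  obtain ⟨n, rfl | rfl⟩ := i.eq_nat_or_neg
  · rw [zpow_natCast, Units.val_pow_eq_pow_val, natCast_zsmul]
    exact SetLike.pow_mem_graded n hu
  · rw [zpow_neg, zpow_natCast, ← inv_pow, Units.val_pow_eq_pow_val, neg_smul, natCast_zsmul,
      ← smul_neg]
    exact SetLike.pow_mem_graded n hu'

variable (𝒜) in
/-- The subgroup `Δ` of `Γ` is generated by `Δ'` and the degree `δ` of a homogeneous unit, which
has infinite order modulo `Δ'`; the last condition is expressed by a weight `w` that vanishes on
`Δ'` and not at `δ`. -/
structure CyclicStep (Δ' Δ : AddSubgroup Γ) where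
  le : Δ' ≤ Δ
  unit : Eˣ
  δ : Γ
  unit_mem : (unit : E) ∈ 𝒜 δ
  inv_mem : (↑unit⁻¹ : E) ∈ 𝒜 (-δ)
  w : Γ →+ ℚ
  w_eq_zero : ∀ γ ∈ Δ', w γ = 0
  w_δ : w δ = 1
  δ_mem : δ ∈ Δ
  exists_sub_mem : ∀ γ ∈ Δ, ∃ i : ℤ, γ - i • δ ∈ Δ'

namespace CyclicStep

variable {Δ' Δ : AddSubgroup Γ} (c : CyclicStep 𝒜 Δ' Δ)

omit [DecidableEq Γ] [GradedRing 𝒜] in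
theorem exists_int {γ : Γ} (hγ : γ ∈ Δ) : ∃ i : ℤ, c.w γ = i ∧ γ - i • c.δ ∈ Δ' := by
  obtain ⟨i, hi⟩ := c.exists_sub_mem γ hγ
  refine ⟨i, ?_, hi⟩
  have := c.w_eq_zero _ hi
  rw [map_sub, map_zsmul, c.w_δ, sub_eq_zero] at this
  simpa using this

omit [DecidableEq Γ] [GradedRing 𝒜] in
theorem sub_mem_of_w_eq {γ : Γ} (hγ : γ ∈ Δ) {i : ℤ} (h : c.w γ = i) : γ - i • c.δ ∈ Δ' := by
  obtain ⟨j, hj, hj'⟩ := c.exists_int hγ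
  have : i = j := by exact_mod_cast h.symm.trans hj
  rwa [this]

theorem exists_int_top {x : E} (hx : x ∈ degSubring 𝒜 Δ) (h0 : x ≠ 0) :
    (∃ i : ℤ, top 𝒜 c.w x = i) ∧ ∃ i : ℤ, top 𝒜 (-c.w) x = i := by
  constructor
  · obtain ⟨γ, hγ, htop⟩ := exists_isTop (𝒜 := 𝒜) (w := c.w) h0
    obtain ⟨i, hi, -⟩ := c.exists_int (γ := γ) (by
      by_contra h
      exact hγ (hx γ h))
    exact ⟨i, htop.top_eq.trans hi⟩
  · obtain ⟨γ, hγ, htop⟩ := exists_isTop (𝒜 := 𝒜) (w := -c.w) h0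
    obtain ⟨i, hi, -⟩ := c.exists_int (γ := γ) (by
      by_contra h
      exact hγ (hx γ h))
    refine ⟨-i, htop.top_eq.trans ?_⟩
    rw [AddMonoidHom.neg_apply, hi]
    push_cast
    rfl

theorem exists_nat_width {x : E} (hx : x ∈ degSubring 𝒜 Δ) (h0 : x ≠ 0) :
    ∃ n : ℕ, width 𝒜 c.w x = n := by
  obtain ⟨⟨i, hi⟩, ⟨j, hj⟩⟩ := c.exists_int_top hx h0
  have h := width_nonneg (𝒜 := 𝒜) (w := c.w) h0
  have h1 : width 𝒜 c.w x = ((i + j : ℤ) : ℚ) := by rw [width, hi, hj]; push_cast; rfl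
  rw [h1] at h ⊢
  obtain ⟨n, hn⟩ := Int.eq_ofNat_of_zero_le (by exact_mod_cast h)
  exact ⟨n, by rw [hn]; rfl⟩

theorem width_eq_zero {x : E} (hx : x ∈ degSubring 𝒜 Δ') (h0 : x ≠ 0) : width 𝒜 c.w x = 0 :=
  width_eq_zero_of_mem (a := 0) h0 (supportedIn_mono (fun γ hγ => c.w_eq_zero γ hγ) hx)

/-- Elements of constant weight are multiples of elements with degrees in `Δ'`. -/
theorem mul_zpow_mem {x : E} (hx : x ∈ degSubring 𝒜 Δ) {i : ℤ}
    (h : x ∈ supportedIn 𝒜 {γ | c.w γ = i}) : x * ↑(c.unit ^ (-i)) ∈ degSubring 𝒜 Δ' := by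
  have h1 : x ∈ supportedIn 𝒜 ((Δ : Set Γ) ∩ {γ | c.w γ = i}) := fun γ hγ => by
    by_cases hγΔ : γ ∈ Δ
    · exact h γ fun h' => hγ ⟨hγΔ, h'⟩
    · exact hx γ hγΔ
  refine mul_mem_supportedIn h1
    (mem_supportedIn_singleton.mpr (zpow_mem_graded c.unit_mem c.inv_mem (-i))) ?_
  rintro γ ⟨hγΔ, hγ⟩ γ' rfl
  rw [neg_smul, ← sub_eq_add_neg]
  exact c.sub_mem_of_w_eq hγΔ hγ

/-- The division step: a multiple of `e` cancels the component of highest weight of `f`, up to a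
central factor. -/
theorem exists_reduction [IsDomain E] [Module.Finite (Subring.center E) E] {e f : E}
    (he : e ∈ degSubring 𝒜 Δ) (hf : f ∈ degSubring 𝒜 Δ) (he0 : e ≠ 0) (hf0 : f ≠ 0)
    (hef : width 𝒜 c.w e ≤ width 𝒜 c.w f) :
    ∃ t ∈ degCenter 𝒜 Δ', t ≠ 0 ∧ ∃ b ∈ degSubring 𝒜 Δ,
      t * f - b * e = 0 ∨ width 𝒜 c.w (t * f - b * e) < width 𝒜 c.w f := by
  obtain ⟨i, hi⟩ := (c.exists_int_top he he0).1
  obtain ⟨j, hj⟩ := (c.exists_int_top hf hf0).1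
  have hte := isTop_top (𝒜 := 𝒜) (w := c.w) he0
  have htf := isTop_top (𝒜 := 𝒜) (w := c.w) hf0
  rw [hi] at hte
  rw [hj] at htf
  set et := restrict 𝒜 {γ | c.w γ = i} e with het
  set ft := restrict 𝒜 {γ | c.w γ = j} f with hft
  have hetΔ : et ∈ degSubring 𝒜 Δ :=
    supportedIn_mono Set.inter_subset_left (restrict_mem_of_mem he)
  have hftΔ : ft ∈ degSubring 𝒜 Δ :=
    supportedIn_mono Set.inter_subset_left (restrict_mem_of_mem hf)
  have ha := c.mul_zpow_mem hetΔ (restrict_mem _ _)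
  have ha0 : et * ↑(c.unit ^ (-i)) ≠ 0 := mul_ne_zero hte.2 (Units.ne_zero _)
  obtain ⟨a, haΔ, t, htc, htΔ, ht0, hat, -⟩ := exists_mul_eq_center (𝒜 := 𝒜) Δ' ha ha0
  have hzp := zpow_mem_graded c.unit_mem c.inv_mem (-i)
  have hzΔ : ((c.unit ^ (-i) : Eˣ) : E) ∈ degSubring 𝒜 Δ :=
    mem_supportedIn_of_mem hzp (Δ.zsmul_mem c.δ_mem _)
  set b := ft * ↑(c.unit ^ (-i)) * a with hb
  have hbΔ : b ∈ degSubring 𝒜 Δ :=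
    mul_mem (mul_mem hftΔ hzΔ) (degSubring_mono c.le haΔ)
  have hbw : b ∈ supportedIn 𝒜 {γ | c.w γ = j - i} := by
    refine mul_mem_supportedIn (mul_mem_supportedIn (restrict_mem _ _)
      (mem_supportedIn_of_mem (s := {γ | c.w γ = -i}) hzp ?_) (r := {γ | c.w γ = j - i}) ?_) haΔ ?_
    · change c.w _ = _
      rw [map_zsmul, c.w_δ]
      simp
    · intro γ hγ γ' hγ'
      change c.w _ = _
      rw [map_add, hγ, hγ', sub_eq_add_neg]
    · intro γ hγ γ' hγ'
      change c.w _ = _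
      rw [map_add, hγ, c.w_eq_zero γ' hγ', add_zero]
  have htw : t ∈ supportedIn 𝒜 {γ | c.w γ = 0} :=
    supportedIn_mono (fun γ hγ => c.w_eq_zero γ hγ) htΔ
  have hbet : b * et = t * ft := by
    have h1 : et = et * ↑(c.unit ^ (-i)) * ↑(c.unit ^ i) := by
      rw [mul_assoc, ← Units.val_mul, ← zpow_add, neg_add_cancel, zpow_zero, Units.val_one, mul_one]
    rw [hb, h1, mul_assoc, ← mul_assoc a, hat, mul_assoc, ← Subring.mem_center_iff.mp htc,
      ← mul_assoc _ _ t, ← Units.val_mul, ← zpow_add, neg_add_cancel, zpow_zero, Units.val_one,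
      one_mul, Subring.mem_center_iff.mp htc]
  refine ⟨t, ⟨htΔ, htc⟩, ht0, b, hbΔ, ?_⟩
  by_cases hg0 : t * f - b * e = 0
  · exact Or.inl hg0
  right
  have hr : restrict 𝒜 {γ | c.w γ = j} (t * f - b * e) = 0 := by
    rw [map_sub, restrict_mul_of_left_mem (s := {γ | c.w γ = j}) f htw (by
      intro γ hγ γ'
      change c.w (γ + γ') = j ↔ c.w γ' = j
      rw [map_add, hγ, zero_add]), restrict_mul_of_left_mem (s := {γ | c.w γ = i}) e hbw (by
      intro γ hγ γ'
      change c.w (γ + γ') = j ↔ c.w γ' = i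
      rw [map_add, hγ]
      constructor <;> intro h <;> linarith), ← het, ← hft, hbet, sub_self]
  have hmem : t * f - b * e ∈ supportedIn 𝒜
      {γ | -top 𝒜 (-c.w) f ≤ c.w γ ∧ c.w γ ≤ j} := by
    have hf' := mem_supportedIn_neg (𝒜 := 𝒜) (w := c.w) hf0
    have he' := mem_supportedIn_neg (𝒜 := 𝒜) (w := c.w) he0
    rw [width, width, hi, hj] at hef
    refine sub_mem ?_ ?_
    · refine mul_mem_supportedIn (s := {γ | c.w γ = 0})
        (t := {γ | -top 𝒜 (-c.w) f ≤ c.w γ ∧ c.w γ ≤ j}) htw (fun γ hγ => ?_) ?_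
      · by_contra h0
        refine hγ ⟨?_, ?_⟩
        · by_contra h; exact h0 (hf' γ h)
        · by_contra h; exact h0 (htf.1 γ h)
      · rintro γ hγ γ' ⟨h1, h2⟩
        change _ ≤ c.w _ ∧ c.w _ ≤ _
        rw [map_add, hγ, zero_add]
        exact ⟨h1, h2⟩
    · refine mul_mem_supportedIn (t := {γ | -top 𝒜 (-c.w) e ≤ c.w γ ∧ c.w γ ≤ i}) hbw
        (fun γ hγ => ?_) ?_
      · by_contra h0
        refine hγ ⟨?_, ?_⟩
        · by_contra h; exact h0 (he' γ h)
        · by_contra h; exact h0 (hte.1 γ h)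
      · rintro γ hγ γ' ⟨h1, h2⟩
        change _ ≤ c.w _ ∧ c.w _ ≤ _
        rw [map_add, hγ]
        constructor <;> linarith
  have htop := isTop_top (𝒜 := 𝒜) (w := c.w) hg0
  have h1 : top 𝒜 c.w (t * f - b * e) ≤ j := htop.le (supportedIn_mono (fun _ h => h.2) hmem)
  have h2 : top 𝒜 c.w (t * f - b * e) ≠ j := fun h => htop.2 (by rw [h]; exact hr)
  have h3 : top 𝒜 (-c.w) (t * f - b * e) ≤ top 𝒜 (-c.w) f :=
    (isTop_top (𝒜 := 𝒜) (w := -c.w) hg0).le (supportedIn_mono (fun γ h => neg_le.mp h.1) hmem)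
  rw [width, width, hj]
  exact add_lt_add_of_lt_of_le (lt_of_le_of_ne h1 h2) h3

end CyclicStep

end Step

/-! ### Partial localizations inside the quotient division ring -/

section Frac

variable {Γ : Type v} [AddCommGroup Γ] [DecidableEq Γ] {E : Type u} [Ring E]
  {𝒜 : Γ → AddSubgroup E} [GradedRing 𝒜] {Q : Type*} [DivisionRing Q]

/-- The division ring `Q` consists of the fractions of `E` with central denominators. -/
structure IsQuotient (ι : E →+* Q) : Prop where
  injective : Function.Injective ι
  exists_eq : ∀ x : Q, ∃ e : E, ∃ t ∈ Subring.center E, t ≠ 0 ∧ x * ι t = ι e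

variable {ι : E →+* Q}

theorem IsQuotient.map_ne_zero (hι : IsQuotient ι) {x : E} (hx : x ≠ 0) : ι x ≠ 0 := fun h =>
  hx (hι.injective (h.trans (map_zero ι).symm))

theorem IsQuotient.comm (hι : IsQuotient ι) {t : E} (ht : t ∈ Subring.center E) (x : Q) :
    ι t * x = x * ι t := by
  obtain ⟨e, s, hs, hs0, h⟩ := hι.exists_eq x
  have hs0' := hι.map_ne_zero hs0
  apply mul_right_cancel₀ hs0'
  rw [mul_assoc, h, mul_assoc, ← map_mul ι t s, ← Subring.mem_center_iff.mp ht s, map_mul,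
    ← mul_assoc, h, ← map_mul, ← map_mul, Subring.mem_center_iff.mp ht e]

/-- The fractions with numerator in `X` and with central denominator of degrees in `Δ'`. -/
def frac (hι : IsQuotient ι) (Δ' : AddSubgroup Γ) (X : Subring E) (hX : degCenter 𝒜 Δ' ≤ X)
    [IsDomain E] : Subring Q where
  carrier := {x | ∃ t ∈ degCenter 𝒜 Δ', t ≠ 0 ∧ ∃ e ∈ X, x * ι t = ι e}
  zero_mem' := ⟨1, one_mem _, one_ne_zero, 0, zero_mem _, by simp⟩
  one_mem' := ⟨1, one_mem _, one_ne_zero, 1, one_mem _, by simp⟩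
  neg_mem' := by
    rintro x ⟨t, ht, ht0, e, he, h⟩
    exact ⟨t, ht, ht0, -e, neg_mem he, by rw [neg_mul, h, map_neg]⟩
  add_mem' := by
    rintro x y ⟨t, ht, ht0, e, he, h⟩ ⟨t', ht', ht0', e', he', h'⟩
    refine ⟨t * t', mul_mem ht ht', mul_ne_zero ht0 ht0', e * t' + e' * t,
      add_mem (mul_mem he (hX ht')) (mul_mem he' (hX ht)), ?_⟩
    rw [map_add, map_mul, map_mul, map_mul, ← h, ← h', add_mul, mul_assoc x, mul_assoc y,
      hι.comm ht.2 (ι t')]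
  mul_mem' := by
    rintro x y ⟨t, ht, ht0, e, he, h⟩ ⟨t', ht', ht0', e', he', h'⟩
    refine ⟨t * t', mul_mem ht ht', mul_ne_zero ht0 ht0', e * e', mul_mem he he', ?_⟩
    rw [map_mul, map_mul, ← h, ← h', mul_assoc, mul_assoc, hι.comm ht.2, hι.comm ht.2]
    simp only [mul_assoc]

variable (hι : IsQuotient ι)

theorem map_mem_frac [IsDomain E] {Δ' : AddSubgroup Γ} {X : Subring E} {hX : degCenter 𝒜 Δ' ≤ X}
    {x : E} (hx : x ∈ X) : ι x ∈ frac hι Δ' X hX :=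
  ⟨1, one_mem _, one_ne_zero, x, hx, by simp⟩

theorem map_inv_mem_frac [IsDomain E] {Δ' : AddSubgroup Γ} {X : Subring E}
    {hX : degCenter 𝒜 Δ' ≤ X} {t : E} (ht : t ∈ degCenter 𝒜 Δ') (h0 : t ≠ 0) :
    (ι t)⁻¹ ∈ frac hι Δ' X hX :=
  ⟨t, ht, h0, 1, one_mem _, by rw [inv_mul_cancel₀ (hι.map_ne_zero h0), map_one]⟩

section Degree

variable [IsDomain E] {Δ' Δ : AddSubgroup Γ} (c : CyclicStep 𝒜 Δ' Δ)

/-- The twisted Laurent polynomial ring over the quotient division ring of `degSubring 𝒜 Δ'`, as a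
subring of `Q`. -/
abbrev laurent (hι : IsQuotient ι) (c : CyclicStep 𝒜 Δ' Δ) : Subring Q :=
  frac hι Δ' (degSubring 𝒜 Δ) (degCenter_le c.le)

/-- The inclusion of the elements with degrees in `Δ` into the ring `laurent`. -/
def toLaurent : degSubring 𝒜 Δ →+* laurent hι c where
  toFun x := ⟨ι x, map_mem_frac hι x.2⟩
  map_zero' := Subtype.ext (map_zero ι)
  map_one' := Subtype.ext (map_one ι)
  map_add' _ _ := Subtype.ext (map_add ι _ _)
  map_mul' _ _ := Subtype.ext (map_mul ι _ _)

theorem coe_toLaurent (x : degSubring 𝒜 Δ) : (toLaurent hι c x : Q) = ι x := rfl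

theorem toLaurent_ne_zero {x : degSubring 𝒜 Δ} (hx : x ≠ 0) : toLaurent hι c x ≠ 0 := fun h =>
  hx (Subtype.ext (hι.injective ((congrArg Subtype.val h).trans (map_zero ι).symm)))

theorem isUnit_toLaurent_of_mem {x : degSubring 𝒜 Δ} (hx : (x : E) ∈ degCenter 𝒜 Δ')
    (h0 : x ≠ 0) : IsUnit (toLaurent hι c x) := by
  have h0' : (x : E) ≠ 0 := fun h => h0 (Subtype.ext h)
  refine isUnit_of_mul_eq_one_left (x := ⟨(ι x)⁻¹, map_inv_mem_frac hι hx h0'⟩) (Subtype.ext ?_)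
  exact inv_mul_cancel₀ (hι.map_ne_zero h0')

theorem exists_num (x : laurent hι c) : ∃ t : degSubring 𝒜 Δ, (t : E) ∈ degCenter 𝒜 Δ' ∧ t ≠ 0 ∧
    ∃ e, x * toLaurent hι c t = toLaurent hι c e := by
  obtain ⟨t, ht, ht0, e, he, h⟩ := x.2
  exact ⟨⟨t, degCenter_le c.le ht⟩, ht, fun h => ht0 (congrArg Subtype.val h), ⟨e, he⟩,
    Subtype.ext h⟩

/-- The difference between the highest and the lowest exponent of a twisted Laurent polynomial. -/
noncomputable def laurentDegree (x : laurent hι c) : ℕ :=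
  ⌊width 𝒜 c.w ((exists_num hι c x).choose_spec.2.2.choose : E)⌋₊

theorem num_ne_zero {x : laurent hι c} (hx : x ≠ 0) {t e : degSubring 𝒜 Δ} (ht : t ≠ 0)
    (h : x * toLaurent hι c t = toLaurent hι c e) : (e : E) ≠ 0 := fun h0 => by
  rw [Subtype.ext h0 (a2 := (0 : degSubring 𝒜 Δ)), map_zero] at h
  exact mul_ne_zero hx (toLaurent_ne_zero hι c ht) h

theorem width_eq_laurentDegree {x : laurent hι c} (hx : x ≠ 0) {t e : degSubring 𝒜 Δ}
    (ht : (t : E) ∈ degCenter 𝒜 Δ') (h0 : t ≠ 0)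
    (h : x * toLaurent hι c t = toLaurent hι c e) : width 𝒜 c.w (e : E) = laurentDegree hι c x := by
  have hs := (exists_num hι c x).choose_spec.1
  have hs0 := (exists_num hι c x).choose_spec.2.1
  have hf := (exists_num hι c x).choose_spec.2.2.choose_spec
  have hdef : laurentDegree hι c x =
    ⌊width 𝒜 c.w ((exists_num hι c x).choose_spec.2.2.choose : E)⌋₊ := rfl
  set s := (exists_num hι c x).choose
  set f := (exists_num hι c x).choose_spec.2.2.choose
  have hf0 := num_ne_zero hι c hx hs0 hf
  have he0 := num_ne_zero hι c hx h0 h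
  have h1 : (e : E) * s = f * t := by
    apply hι.injective
    have h2 := congrArg Subtype.val h
    have h3 := congrArg Subtype.val hf
    rw [Subring.coe_mul, coe_toLaurent, coe_toLaurent] at h2 h3
    rw [map_mul, map_mul, ← h2, ← h3, mul_assoc, mul_assoc, hι.comm ht.2]
  have ht0' : (t : E) ≠ 0 := fun h => h0 (Subtype.ext h)
  have hs0' : (s : E) ≠ 0 := fun h => hs0 (Subtype.ext h)
  have h2 := congrArg (width 𝒜 c.w) h1
  rw [width_mul he0 hs0', width_mul hf0 ht0', c.width_eq_zero hs.1 hs0',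
    c.width_eq_zero ht.1 ht0', add_zero, add_zero] at h2
  obtain ⟨n, hn⟩ := c.exists_nat_width f.2 hf0
  rw [hdef, h2, hn, Nat.floor_natCast]

theorem isLeftEuclidean_laurent [Module.Finite (Subring.center E) E] :
    IsLeftEuclidean (laurent hι c) (laurentDegree hι c) where
  map_mul x y hx hy := by
    obtain ⟨t, ht, ht0, e, he⟩ := exists_num hι c x
    obtain ⟨s, hs, hs0, f, hf⟩ := exists_num hι c y
    have h : x * y * toLaurent hι c (s * t) = toLaurent hι c (e * f) := by
      have hc : toLaurent hι c f * toLaurent hι c t = toLaurent hι c t * toLaurent hι c f :=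
        Subtype.ext (hι.comm ht.2 _).symm
      rw [map_mul, map_mul, ← he, mul_assoc, ← mul_assoc y, hf, hc, ← mul_assoc]
    have h1 := width_eq_laurentDegree hι c (mul_ne_zero hx hy) (mul_mem hs ht)
      (mul_ne_zero hs0 ht0) h
    rw [Subring.coe_mul, width_mul (num_ne_zero hι c hx ht0 he) (num_ne_zero hι c hy hs0 hf),
      width_eq_laurentDegree hι c hx ht ht0 he, width_eq_laurentDegree hι c hy hs hs0 hf] at h1
    exact_mod_cast h1.symm
  isUnit_of_eq_zero x hx hd := by
    obtain ⟨t, ht, ht0, e, he⟩ := exists_num hι c x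
    have h1 := width_eq_laurentDegree hι c hx ht ht0 he
    have he0 := num_ne_zero hι c hx ht0 he
    rw [hd, Nat.cast_zero] at h1
    obtain ⟨i, hi⟩ := (c.exists_int_top e.2 he0).1
    have h2 := mem_supportedIn_of_width_eq_zero he0 h1
    rw [hi] at h2
    obtain ⟨a, ha, s, hsc, hs, hs0, has, -⟩ := exists_mul_eq_center (𝒜 := 𝒜) Δ'
      (c.mul_zpow_mem e.2 h2) (mul_ne_zero he0 (Units.ne_zero _))
    -- With `a` a left inverse of `e * y ^ (-i)` up to `s`, the element `y ^ (-i) * a` is a left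
    -- inverse of `e` up to `s`.
    have hz : ((c.unit ^ (-i) : Eˣ) : E) ∈ degSubring 𝒜 Δ :=
      mem_supportedIn_of_mem (zpow_mem_graded c.unit_mem c.inv_mem (-i)) (Δ.zsmul_mem c.δ_mem _)
    have h3 : (↑(c.unit ^ (-i)) * a) * (e : E) = s := by
      apply mul_right_cancel₀ (Units.ne_zero (c.unit ^ (-i)))
      rw [mul_assoc, mul_assoc, has, Subring.mem_center_iff.mp hsc]
    let b : degSubring 𝒜 Δ := ⟨_, mul_mem hz (degSubring_mono c.le ha)⟩
    let s' : degSubring 𝒜 Δ := ⟨s, degSubring_mono c.le hs⟩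
    have hs0' : s' ≠ 0 := fun h => hs0 (congrArg Subtype.val h)
    obtain ⟨z, hz⟩ := isUnit_toLaurent_of_mem hι c (x := s') ⟨hs, hsc⟩ hs0'
    obtain ⟨y, hy⟩ := isUnit_toLaurent_of_mem hι c ht ht0
    have h4 : toLaurent hι c b * toLaurent hι c e = z := by
      rw [hz, ← map_mul]
      exact congrArg _ (Subtype.ext h3)
    have h5 : (↑z⁻¹ * toLaurent hι c b) * toLaurent hι c e = 1 := by
      rw [mul_assoc, h4, Units.inv_mul]
    have h6 : x = toLaurent hι c e * ↑y⁻¹ := by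
      rw [← he, ← hy, mul_assoc, Units.mul_inv, mul_one]
    rw [h6]
    exact (isUnit_of_mul_eq_one_left h5).mul (Units.isUnit _)
  exists_div p b hb := by
    induction hn : laurentDegree hι c p using Nat.strong_induction_on generalizing p with
    | _ n ih =>
    by_cases hp : p = 0
    · exact ⟨0, 0, by simp [hp], Or.inl rfl⟩
    by_cases hlt : laurentDegree hι c p < laurentDegree hι c b
    · exact ⟨0, p, by simp, Or.inr hlt⟩
    obtain ⟨t₁, ht₁, ht₁0, f, hf⟩ := exists_num hι c p
    obtain ⟨t₂, ht₂, ht₂0, e, he⟩ := exists_num hι c b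
    have hf0 := num_ne_zero hι c hp ht₁0 hf
    have he0 := num_ne_zero hι c hb ht₂0 he
    have hwf := width_eq_laurentDegree hι c hp ht₁ ht₁0 hf
    have hwe := width_eq_laurentDegree hι c hb ht₂ ht₂0 he
    obtain ⟨t, ht, ht0, a, ha, hred⟩ := c.exists_reduction e.2 f.2 he0 hf0 (by
      rw [hwf, hwe]
      exact_mod_cast not_lt.mp hlt)
    let t' : degSubring 𝒜 Δ := ⟨t, degCenter_le c.le ht⟩
    have ht0' : t' ≠ 0 := fun h => ht0 (congrArg Subtype.val h)
    let a' : degSubring 𝒜 Δ := ⟨a, ha⟩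
    let g : degSubring 𝒜 Δ := t' * f - a' * e
    obtain ⟨z, hz⟩ := isUnit_toLaurent_of_mem hι c (x := t' * t₁) (mul_mem ht ht₁)
      (mul_ne_zero ht0' ht₁0)
    have hcomm : ∀ (s : degSubring 𝒜 Δ), (s : E) ∈ degCenter 𝒜 Δ' → ∀ x : laurent hι c,
        toLaurent hι c s * x = x * toLaurent hι c s := fun s hs x => Subtype.ext (hι.comm hs.2 _)
    have hzc : ∀ x : laurent hι c, (z : laurent hι c) * x = x * z := fun x => by
      rw [hz]; exact hcomm _ (mul_mem ht ht₁) x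
    -- `p = q₀ b + r₀`, where the remainder `r₀ = g / (t t₁)` has smaller degree than `p`.
    let q₀ := toLaurent hι c a' * toLaurent hι c t₂ * ↑z⁻¹
    let r₀ := p - q₀ * b
    have hr₀ : r₀ * toLaurent hι c (t' * t₁) = toLaurent hι c g := by
      have h1 : q₀ * b * toLaurent hι c (t' * t₁) = toLaurent hι c (a' * e) := by
        rw [← hz]
        simp only [q₀]
        rw [mul_assoc, ← hzc b, mul_assoc, mul_assoc, Units.inv_mul_cancel_left, hcomm t₂ ht₂,
          he, map_mul]
      have h2 : p * toLaurent hι c (t' * t₁) = toLaurent hι c (t' * f) := by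
        rw [map_mul, hcomm t' ht, ← mul_assoc, hf, map_mul, hcomm t' ht]
      rw [sub_mul, h1, h2, map_sub]
    have hr₀d : r₀ = 0 ∨ laurentDegree hι c r₀ < laurentDegree hι c p := by
      by_cases h0 : r₀ = 0
      · exact Or.inl h0
      right
      have hg0 := num_ne_zero hι c h0 (mul_ne_zero ht0' ht₁0) hr₀
      have hw := width_eq_laurentDegree hι c h0 (mul_mem ht ht₁) (mul_ne_zero ht0' ht₁0) hr₀
      have h1 := hred.resolve_left hg0
      change width 𝒜 c.w (g : E) < _ at h1
      rw [hw, hwf] at h1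
      exact_mod_cast h1
    have hp' : p = q₀ * b + r₀ := by simp [r₀]
    rcases hr₀d with h | h
    · exact ⟨q₀, r₀, hp', Or.inl h⟩
    · obtain ⟨q₁, r₁, h1, h2⟩ := ih (laurentDegree hι c r₀) (by omega) r₀ rfl
      exact ⟨q₀ + q₁, r₁, by rw [add_mul, add_assoc, ← h1]; exact hp', h2⟩

end Degree

end Frac

/-! ### Classes modulo commutators -/

section Class

variable {Q : Type*} [DivisionRing Q]

open scoped Classical in
/-- The class of a nonzero element of `Q` in the abelianization of the multiplicative group; the
class of `0` is `1`. -/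
noncomputable def unitClass (x : Q) : Abelianization Qˣ :=
  Abelianization.of (if h : x = 0 then 1 else Units.mk0 x h)

theorem unitClass_coe (u : Qˣ) : unitClass (u : Q) = Abelianization.of u := by
  rw [unitClass, dif_neg u.ne_zero, Units.mk0_val]

theorem unitClass_one : unitClass (1 : Q) = 1 := by
  rw [← Units.val_one, unitClass_coe, map_one]

theorem unitClass_mul {x y : Q} (hx : x ≠ 0) (hy : y ≠ 0) :
    unitClass (x * y) = unitClass x * unitClass y := by
  obtain ⟨x, rfl⟩ := hx.isUnit
  obtain ⟨y, rfl⟩ := hy.isUnit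
  rw [← Units.val_mul, unitClass_coe, unitClass_coe, unitClass_coe, map_mul]

theorem unitClass_conj {g x y : Q} (hg : g ≠ 0) (hx : x ≠ 0) (h : y * g = g * x) :
    unitClass y = unitClass x := by
  have hy : y ≠ 0 := by
    rintro rfl
    rw [zero_mul] at h
    exact mul_ne_zero hg hx h.symm
  have h1 := congrArg unitClass h
  rw [unitClass_mul hy hg, unitClass_mul hg hx, mul_comm] at h1
  exact mul_left_cancel h1

end Class

section Frac

variable {Γ : Type v} [AddCommGroup Γ] [DecidableEq Γ] {E : Type u} [Ring E]
  {𝒜 : Γ → AddSubgroup E} [GradedRing 𝒜] {Q : Type*} [DivisionRing Q] {ι : E →+* Q}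

/-- The classes of the units of `E`. -/
def unitClasses (ι : E →+* Q) : Subgroup (Abelianization Qˣ) :=
  ((Abelianization.of).comp (Units.map ι.toMonoidHom)).range

theorem mem_unitClasses (u : Eˣ) : unitClass (ι u) ∈ unitClasses ι :=
  ⟨u, (unitClass_coe (Units.map ι.toMonoidHom u)).symm⟩

theorem exists_of_mem_unitClasses {a : Abelianization Qˣ} (ha : a ∈ unitClasses ι) :
    ∃ u : Eˣ, a = unitClass (ι u) := by
  obtain ⟨u, rfl⟩ := ha
  exact ⟨u, (unitClass_coe (Units.map ι.toMonoidHom u)).symm⟩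

/-- The classes of the products of units of `E` and fractions of elements with degrees in `Δ'`. -/
noncomputable def degClasses [IsDomain E] (𝒜 : Γ → AddSubgroup E) [GradedRing 𝒜]
    (hι : IsQuotient ι) (Δ' : AddSubgroup Γ) :
    Subgroup (Abelianization Qˣ) where
  carrier := {a | ∃ u : Eˣ, ∃ e ∈ degSubring 𝒜 Δ', ∃ f ∈ degSubring 𝒜 Δ', e ≠ 0 ∧ f ≠ 0 ∧
    a = unitClass (ι u) * (unitClass (ι e) / unitClass (ι f))}
  one_mem' := ⟨1, 1, one_mem _, 1, one_mem _, one_ne_zero, one_ne_zero, by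
    simp [unitClass_one]⟩
  mul_mem' := by
    rintro _ _ ⟨u, e, he, f, hf, he0, hf0, rfl⟩ ⟨u', e', he', f', hf', he0', hf0', rfl⟩
    refine ⟨u * u', e * e', mul_mem he he', f * f', mul_mem hf hf', mul_ne_zero he0 he0',
      mul_ne_zero hf0 hf0', ?_⟩
    rw [Units.val_mul, map_mul, map_mul, map_mul,
      unitClass_mul (hι.map_ne_zero u.ne_zero) (hι.map_ne_zero u'.ne_zero),
      unitClass_mul (hι.map_ne_zero he0) (hι.map_ne_zero he0'),
      unitClass_mul (hι.map_ne_zero hf0) (hι.map_ne_zero hf0'), mul_div_mul_comm,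
      mul_mul_mul_comm]
  inv_mem' := by
    rintro _ ⟨u, e, he, f, hf, he0, hf0, rfl⟩
    refine ⟨u⁻¹, f, hf, e, he, hf0, he0, ?_⟩
    have h1 : unitClass (ι (↑u⁻¹ : E)) = (unitClass (ι (u : E)))⁻¹ := by
      rw [eq_inv_iff_mul_eq_one,
        ← unitClass_mul (hι.map_ne_zero u⁻¹.ne_zero) (hι.map_ne_zero u.ne_zero), ← map_mul,
        Units.inv_mul, map_one, unitClass_one]
    rw [h1, mul_inv, inv_div]

variable [IsDomain E] (hι : IsQuotient ι) {Δ' Δ : AddSubgroup Γ}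

theorem unitClass_div_mem_degClasses {e f : E} (he : e ∈ degSubring 𝒜 Δ')
    (hf : f ∈ degSubring 𝒜 Δ') (he0 : e ≠ 0) (hf0 : f ≠ 0) :
    unitClass (ι e) / unitClass (ι f) ∈ degClasses 𝒜 hι Δ' :=
  ⟨1, e, he, f, hf, he0, hf0, by
    rw [Units.val_one, map_one, unitClass_one, one_mul]⟩

theorem unitClass_mem_degClasses {e : E} (he : e ∈ degSubring 𝒜 Δ') (he0 : e ≠ 0) :
    unitClass (ι e) ∈ degClasses 𝒜 hι Δ' := by
  have := unitClass_div_mem_degClasses hι he (one_mem (degSubring 𝒜 Δ')) he0 one_ne_zero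
  rwa [map_one, unitClass_one, div_one] at this

theorem unitClass_coe_mem_degClasses (u : Eˣ) : unitClass (ι u) ∈ degClasses 𝒜 hι Δ' :=
  ⟨u, 1, one_mem _, 1, one_mem _, one_ne_zero, one_ne_zero, by simp⟩

variable (c : CyclicStep 𝒜 Δ' Δ)

theorem unitClass_mul_toLaurent {x : laurent hι c} (hx : x ≠ 0) {t e : degSubring 𝒜 Δ}
    (ht0 : t ≠ 0) (h : x * toLaurent hι c t = toLaurent hι c e) :
    unitClass (x : Q) * unitClass (ι t) = unitClass (ι e) := by
  have h1 := congrArg Subtype.val h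
  rw [Subring.coe_mul, coe_toLaurent, coe_toLaurent] at h1
  rw [← h1, unitClass_mul (fun h => hx (Subtype.ext h))
    (hι.map_ne_zero fun h => ht0 (Subtype.ext h))]

/-- The units of the twisted Laurent polynomial ring are monomials. -/
theorem unitClass_mem_of_isUnit [Module.Finite (Subring.center E) E] {x : laurent hι c}
    (hx : IsUnit x) : unitClass (x : Q) ∈ degClasses 𝒜 hι Δ' := by
  have hx0 := hx.ne_zero
  have hd := (isLeftEuclidean_laurent hι c).eq_zero_of_isUnit hx
  obtain ⟨t, ht, ht0, e, he⟩ := exists_num hι c x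
  have h1 := width_eq_laurentDegree hι c hx0 ht ht0 he
  have he0 := num_ne_zero hι c hx0 ht0 he
  rw [hd, Nat.cast_zero] at h1
  obtain ⟨i, hi⟩ := (c.exists_int_top e.2 he0).1
  have h2 := mem_supportedIn_of_width_eq_zero he0 h1
  rw [hi] at h2
  have h3 := unitClass_mem_degClasses hι (c.mul_zpow_mem e.2 h2)
    (mul_ne_zero he0 (Units.ne_zero _))
  rw [map_mul, unitClass_mul (hι.map_ne_zero he0) (hι.map_ne_zero (Units.ne_zero _))] at h3
  have h4 := ((degClasses 𝒜 hι Δ').mul_mem_cancel_right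
    (unitClass_coe_mem_degClasses hι (c.unit ^ (-i)))).mp h3
  rw [← unitClass_mul_toLaurent hι c hx0 ht0 he] at h4
  exact ((degClasses 𝒜 hι Δ').mul_mem_cancel_right
    (unitClass_mem_degClasses hι ht.1 fun h => ht0 (Subtype.ext h))).mp h4

/-! ### Conjugation by homogeneous units -/

theorem conj_mem_laurent {g : Eˣ} {γ : Γ} (hg : (g : E) ∈ 𝒜 γ) (hg' : (↑g⁻¹ : E) ∈ 𝒜 (-γ))
    {x : Q} (hx : x ∈ laurent hι c) : ι g * x * ι (↑g⁻¹ : E) ∈ laurent hι c := by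
  obtain ⟨t, ht, ht0, e, he, h⟩ := hx
  refine ⟨t, ht, ht0, g * e * ↑g⁻¹, ?_, ?_⟩
  · have h1 := mul_mem_supportedIn (r := {γ' | γ' - γ ∈ Δ}) (mem_supportedIn_singleton.mpr hg) he
      (by rintro _ rfl b hb; simpa using hb)
    refine mul_mem_supportedIn h1 (mem_supportedIn_singleton.mpr hg') ?_
    rintro a ha _ rfl
    rw [← sub_eq_add_neg]
    exact ha
  · rw [map_mul, map_mul, ← h, mul_assoc, ← hι.comm ht.2]
    simp only [mul_assoc]

/-- Conjugation by a homogeneous unit, as an automorphism of the twisted Laurent polynomial ring. -/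
def conjLaurent (g : Eˣ) {γ : Γ} (hg : (g : E) ∈ 𝒜 γ) (hg' : (↑g⁻¹ : E) ∈ 𝒜 (-γ)) :
    laurent hι c ≃+* laurent hι c where
  toFun x := ⟨ι g * x * ι (↑g⁻¹ : E), conj_mem_laurent hι c hg hg' x.2⟩
  invFun x := ⟨ι (↑g⁻¹ : E) * x * ι (g : E), by
    have := conj_mem_laurent hι c (g := g⁻¹) hg' (by rwa [inv_inv, neg_neg]) x.2
    rwa [inv_inv] at this⟩
  left_inv x := Subtype.ext (by
    change ι (↑g⁻¹ : E) * (ι (g : E) * (x : Q) * ι (↑g⁻¹ : E)) * ι (g : E) = x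
    have h : ι (↑g⁻¹ : E) * ι (g : E) = 1 := by rw [← map_mul, Units.inv_mul, map_one]
    rw [mul_assoc, mul_assoc (ι (g : E) * (x : Q)), h, mul_one, ← mul_assoc, h, one_mul])
  right_inv x := Subtype.ext (by
    change ι (g : E) * (ι (↑g⁻¹ : E) * (x : Q) * ι (g : E)) * ι (↑g⁻¹ : E) = x
    have h : ι (g : E) * ι (↑g⁻¹ : E) = 1 := by rw [← map_mul, Units.mul_inv, map_one]
    rw [mul_assoc, mul_assoc (ι (↑g⁻¹ : E) * (x : Q)), h, mul_one, ← mul_assoc, h, one_mul])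
  map_mul' x y := Subtype.ext (by
    change ι (g : E) * ((x : Q) * y) * ι (↑g⁻¹ : E) =
      ι (g : E) * (x : Q) * ι (↑g⁻¹ : E) * (ι (g : E) * (y : Q) * ι (↑g⁻¹ : E))
    have h : ι (↑g⁻¹ : E) * ι (g : E) = 1 := by rw [← map_mul, Units.inv_mul, map_one]
    simp only [mul_assoc]
    rw [← mul_assoc (ι (↑g⁻¹ : E)) (ι (g : E)), h, one_mul])
  map_add' x y := Subtype.ext (by
    change ι (g : E) * ((x : Q) + y) * ι (↑g⁻¹ : E) =
      ι (g : E) * (x : Q) * ι (↑g⁻¹ : E) + ι (g : E) * (y : Q) * ι (↑g⁻¹ : E)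
    rw [mul_add, add_mul])

theorem conjLaurent_mul (g : Eˣ) {γ : Γ} (hg : (g : E) ∈ 𝒜 γ) (hg' : (↑g⁻¹ : E) ∈ 𝒜 (-γ))
    (x : laurent hι c) : (conjLaurent hι c g hg hg' x : Q) * ι g = ι g * x := by
  change ι g * x * ι (↑g⁻¹ : E) * ι g = _
  rw [mul_assoc, ← map_mul, Units.inv_mul, map_one, mul_one]

theorem GeneratesMaximal.map {B : Type*} [Ring B] (f : B ≃+* B) {p : B} (hp : GeneratesMaximal p) :
    GeneratesMaximal (f p) where
  ne_zero h := hp.ne_zero (f.injective (h.trans (map_zero f).symm))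
  not_isUnit h := hp.not_isUnit (by simpa using h)
  exists_eq_one b hb := by
    obtain ⟨x, y, h⟩ := hp.exists_eq_one (f.symm b) fun ⟨z, hz⟩ =>
      hb ⟨f z, by rw [← map_mul, ← hz, RingEquiv.apply_symm_apply]⟩
    exact ⟨f x, f y, by
      have := congrArg f h
      rwa [map_add, map_mul, map_mul, RingEquiv.apply_symm_apply, map_one] at this⟩

/-- The central elements of the twisted Laurent polynomial ring with central numerator. -/
def laurentCenter : Subring (laurent hι c) :=
  (frac hι Δ' (degCenter 𝒜 Δ) fun _ ht => ⟨degSubring_mono c.le ht.1, ht.2⟩).comap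
    (laurent hι c).subtype

theorem mem_laurentCenter {x : laurent hι c} : x ∈ laurentCenter hι c ↔
    ∃ t ∈ degCenter 𝒜 Δ', t ≠ 0 ∧ ∃ e ∈ degCenter 𝒜 Δ, (x : Q) * ι t = ι e := Iff.rfl

theorem laurentCenter_comm {x : laurent hι c} (hx : x ∈ laurentCenter hι c) (y : Q) :
    (x : Q) * y = y * x := by
  obtain ⟨t, ht, ht0, e, he, h⟩ := (mem_laurentCenter hι c).mp hx
  apply mul_right_cancel₀ (hι.map_ne_zero ht0)
  rw [mul_assoc, ← hι.comm ht.2, ← mul_assoc, h, mul_assoc, h, hι.comm he.2]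

theorem laurentCenter_comm' {x : laurent hι c} (hx : x ∈ laurentCenter hι c)
    (y : laurent hι c) : x * y = y * x := Subtype.ext (laurentCenter_comm hι c hx y)

theorem toLaurent_mem_laurentCenter {e : degSubring 𝒜 Δ} (he : (e : E) ∈ Subring.center E) :
    toLaurent hι c e ∈ laurentCenter hι c :=
  (mem_laurentCenter hι c).mpr ⟨1, one_mem _, one_ne_zero, e, ⟨e.2, he⟩, by simp [coe_toLaurent]⟩

theorem laurent_integral [Module.Finite (Subring.center E) E] (b : laurent hι c) :
    ∃ (k : ℕ) (a : ℕ → laurent hι c), (∀ i, a i ∈ laurentCenter hι c) ∧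
      b ^ k = ∑ i ∈ Finset.range k, a i * b ^ i := by
  obtain ⟨t, ht, ht0, e, he⟩ := exists_num hι c b
  obtain ⟨n, a, ha, h⟩ := exists_integral_equation (𝒜 := 𝒜) Δ e.2
  obtain ⟨z, hz⟩ := isUnit_toLaurent_of_mem hι c ht ht0
  have ht0' : (t : E) ≠ 0 := fun h => ht0 (Subtype.ext h)
  have hzc : ∀ x : laurent hι c, x * z = z * x := fun x => by
    rw [hz]
    exact Subtype.ext (hι.comm ht.2 _).symm
  have hzc' : (↑z⁻¹ : laurent hι c) ∈ laurentCenter hι c := by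
    refine (mem_laurentCenter hι c).mpr ⟨t, ht, ht0', 1, one_mem _, ?_⟩
    have h1 := congrArg Subtype.val z.inv_mul
    rw [hz, Subring.coe_mul, coe_toLaurent] at h1
    rw [h1, map_one]
    rfl
  let a' : ℕ → degSubring 𝒜 Δ := fun i => ⟨a i, (ha i).2⟩
  refine ⟨n, fun i => toLaurent hι c (a' i) * ↑z⁻¹ ^ (n - i), fun i => mul_mem
    (toLaurent_mem_laurentCenter hι c (ha i).1) (pow_mem hzc' _), ?_⟩
  have hb : ∀ i, b ^ i * ↑z ^ i = toLaurent hι c (e ^ i) := fun i => by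
    have hcomm : Commute b (z : laurent hι c) := hzc b
    rw [← hcomm.mul_pow, hz, he, map_pow]
  apply (z ^ n).isUnit.mul_right_cancel
  rw [Units.val_pow_eq_pow_val, hb, Finset.sum_mul]
  have h1 : e ^ n = ∑ i ∈ Finset.range n, a' i * e ^ i := Subtype.ext (by
    push_cast
    exact h)
  rw [h1, map_sum]
  refine Finset.sum_congr rfl fun i hi => ?_
  have h2 : (z : laurent hι c) ^ n = (z : laurent hι c) ^ (n - i) * (z : laurent hι c) ^ i := by
    rw [← pow_add, Nat.sub_add_cancel (Finset.mem_range.mp hi).le]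
  have hcomm : b ^ i * (z : laurent hι c) ^ (n - i) = (z : laurent hι c) ^ (n - i) * b ^ i :=
    (Commute.pow_pow (hzc b) i (n - i))
  rw [h2, mul_assoc, ← mul_assoc (b ^ i), hcomm, mul_assoc _ (b ^ i), hb, map_mul, mul_assoc]
  congr 1
  rw [← mul_assoc, ← Units.val_pow_eq_pow_val, ← Units.val_pow_eq_pow_val, ← Units.val_mul,
    inv_pow, inv_mul_cancel, Units.val_one, one_mul]

end Frac

/-! ### Irreducible elements with the same central annihilator -/

section Transitive

variable {Γ : Type v} [AddCommGroup Γ] [DecidableEq Γ] {E : Type u} [Ring E]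
  {𝒜 : Γ → AddSubgroup E} [GradedRing 𝒜] {Q : Type*} [DivisionRing Q] {ι : E →+* Q}
  [IsDomain E] (hι : IsQuotient ι) {Δ' Δ : AddSubgroup Γ} (c : CyclicStep 𝒜 Δ' Δ)

/-- Divisibility by `p` of an element with degrees in `Δ` may be tested after admitting factors of
arbitrary degree: the components of degrees outside `Δ` of the factor can be removed. -/
theorem exists_eq_mul_of_frac {p : laurent hι c} {v : degSubring 𝒜 Δ}
    (h : ∃ y ∈ frac (𝒜 := 𝒜) hι Δ' ⊤ le_top, ι v = y * p) :
    ∃ z, toLaurent hι c v = z * p := by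
  obtain ⟨y, ⟨s, hs, hs0, x, -, hx⟩, hv⟩ := h
  obtain ⟨t, ht, ht0, q, hq⟩ := exists_num hι c p
  have hq' := congrArg Subtype.val hq
  rw [Subring.coe_mul, coe_toLaurent, coe_toLaurent] at hq'
  have hs0' := hι.map_ne_zero hs0
  have ht0' : ι (t : E) ≠ 0 := hι.map_ne_zero fun h => ht0 (Subtype.ext h)
  have h1 : (v : E) * (s * t) = x * q := hι.injective (by
    rw [map_mul, map_mul, map_mul, ← hx, ← hq', hv, mul_assoc, mul_assoc, ← mul_assoc (p : Q),
      ← hι.comm hs.2, mul_assoc])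
  have h2 : (v : E) * (s * t) = restrict 𝒜 Δ x * q := by
    rw [← restrict_addSubgroup_mul Δ x q.2, ← h1, restrict_of_mem]
    exact (degSubring 𝒜 Δ).mul_mem v.2 (mul_mem (degCenter_le c.le hs) t.2)
  have h3 : (ι s)⁻¹ * p * ι s = p := by
    rw [mul_assoc, ← hι.comm hs.2, inv_mul_cancel_left₀ hs0']
  refine ⟨toLaurent hι c ⟨restrict 𝒜 Δ x, restrict_mem (𝒜 := 𝒜) Δ x⟩ *
    ⟨(ι s)⁻¹, map_inv_mem_frac hι hs hs0⟩, Subtype.ext ?_⟩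
  apply mul_right_cancel₀ hs0'
  apply mul_right_cancel₀ ht0'
  calc ι v * ι s * ι t = ι (v * (s * t)) := by rw [map_mul, map_mul, mul_assoc]
    _ = ι (restrict 𝒜 Δ x) * (p * ι t) := by rw [h2, map_mul, hq']
    _ = ι (restrict 𝒜 Δ x) * ((ι s)⁻¹ * p * ι s) * ι t := by rw [h3, mul_assoc]
    _ = ι (restrict 𝒜 Δ x) * (ι s)⁻¹ * p * ι s * ι t := by simp only [mul_assoc]

variable (hE : IsGradedDivisionRing 𝒜) (hfin : Module.Finite (Subring.center E) E)
include hE hfin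

/-- If all products `z g` with homogeneous units `g` are left multiples of `p` up to localization,
then `z` lies in the ideal generated by the central multiples of `p`: the coefficients of `z` in a
basis over the center are linear combinations of elements `a z g`. -/
theorem mem_closure_of_forall_mul {p z : laurent hι c}
    (h : ∀ γ, ∀ g ∈ 𝒜 γ, g ≠ 0 → ∃ y ∈ frac (𝒜 := 𝒜) hι Δ' ⊤ le_top, (z : Q) * ι g = y * p) :
    z ∈ AddSubgroup.closure {y | ∃ x ∈ laurentCenter hι c, (∃ w, x = w * p) ∧ ∃ b, y = x * b} := by
  obtain ⟨t, ht, ht0, e, he⟩ := exists_num hι c z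
  have he' := congrArg Subtype.val he
  rw [Subring.coe_mul, coe_toLaurent, coe_toLaurent] at he'
  have ht0' : ι (t : E) ≠ 0 := hι.map_ne_zero fun h => ht0 (Subtype.ext h)
  let W : AddSubgroup E :=
    { carrier := {v | ∃ y ∈ frac (𝒜 := 𝒜) hι Δ' ⊤ le_top, ι v = y * p}
      zero_mem' := ⟨0, zero_mem _, by simp⟩
      add_mem' := by
        rintro a b ⟨y, hy, h⟩ ⟨y', hy', h'⟩
        exact ⟨y + y', add_mem hy hy', by rw [map_add, h, h', add_mul]⟩
      neg_mem' := by
        rintro a ⟨y, hy, h⟩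
        exact ⟨-y, neg_mem hy, by rw [map_neg, h, neg_mul]⟩ }
  have hWmul : ∀ a v, v ∈ W → a * v ∈ W := by
    rintro a v ⟨y, hy, h⟩
    exact ⟨ι a * y, mul_mem (map_mem_frac hι trivial) hy, by rw [map_mul, h, mul_assoc]⟩
  have hWe : ∀ g : E, (e : E) * g ∈ W := by
    intro g
    refine homogeneous_induction (𝒜 := 𝒜) (p := fun g => (e : E) * g ∈ W) g
      (by rw [mul_zero]; exact zero_mem W) ?_
      fun x y hx hy => by rw [mul_add]; exact add_mem hx hy
    intro γ g hg
    by_cases h0 : g = 0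
    · rw [h0, mul_zero]; exact zero_mem W
    obtain ⟨y, hy, hzy⟩ := h γ g hg h0
    refine ⟨ι t * y, mul_mem (map_mem_frac hι trivial) hy, ?_⟩
    rw [map_mul, ← he', ← hι.comm ht.2, mul_assoc, hzy, mul_assoc]
  obtain ⟨s, _, bas, β, θ, hβ, hθ, hdeg, hrepr⟩ := exists_center_basis hE hfin
  have hcW : ∀ i, (bas.repr e i : E) ∈ W := fun i => by
    rw [← hrepr]
    refine twoSided_induction (hθ i) W fun a _ g => ?_
    rw [mul_assoc]
    exact hWmul a _ (hWe g)
  have hcsupp : ∀ i, (bas.repr e i : E) ∈ supportedIn 𝒜 {γ | γ + β i ∈ Δ} := fun i => by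
    have key : ∀ x ∈ supportedIn 𝒜 (Δ : Set Γ), (bas.repr x i : E) ∈
        supportedIn 𝒜 {γ | γ + β i ∈ Δ} := fun x hx => by
      refine supportedIn_induction (𝒜 := 𝒜)
        (p := fun x => (bas.repr x i : E) ∈ supportedIn 𝒜 {γ | γ + β i ∈ Δ}) ?_ ?_ ?_ hx
      · simp
      · intro γ hγ a ha
        rw [← hrepr]
        refine mem_supportedIn_of_mem (hdeg i γ a ha) ?_
        change γ + -β i + β i ∈ Δ
        rwa [neg_add_cancel_right]
      · intro x y hx hy
        rw [map_add, Finsupp.add_apply, Subring.coe_add]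
        exact add_mem hx hy
    exact key e e.2
  let y : laurent hι c := ⟨(ι t)⁻¹, map_inv_mem_frac hι ht fun h => ht0 (Subtype.ext h)⟩
  have hterm : ∀ i, ∃ x ∈ laurentCenter hι c, (∃ w, x = w * p) ∧ ∃ b : laurent hι c,
      ι ((bas.repr e i : E) * bas i) = x * b := fun i => by
    by_cases h0 : (bas.repr e i : E) = 0
    · exact ⟨0, zero_mem _, ⟨0, by simp⟩, 0, by simp [h0]⟩
    obtain ⟨γ, hγ⟩ := exists_decompose_ne_zero (𝒜 := 𝒜) h0
    set a : E := (DirectSum.decompose 𝒜 (bas.repr e i : E) γ : E)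
    have ha : a ∈ 𝒜 γ := SetLike.coe_mem _
    have hγΔ : γ + β i ∈ Δ := by
      by_contra h
      exact hγ (hcsupp i γ h)
    have hac : a ∈ Subring.center E := isGraded_center _ (bas.repr e i).2 γ
    obtain ⟨a', ha'c, ha', haa⟩ := exists_inverse_mem_center hE ha hac hγ
    -- The central factor `a'` moves the coefficient into the degrees in `Δ`.
    have hv : a' * (bas.repr e i : E) ∈ degSubring 𝒜 Δ := by
      refine mul_mem_supportedIn (mem_supportedIn_singleton.mpr ha') (hcsupp i) ?_
      rintro _ rfl δ hδ
      have := Δ.sub_mem hδ hγΔ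
      rwa [add_sub_add_right_eq_sub, sub_eq_neg_add] at this
    have hab : a * bas i ∈ degSubring 𝒜 Δ :=
      mem_supportedIn_of_mem (SetLike.mul_mem_graded ha (hβ i)) hγΔ
    refine ⟨toLaurent hι c ⟨_, hv⟩,
      toLaurent_mem_laurentCenter hι c (mul_mem ha'c (bas.repr e i).2),
      exists_eq_mul_of_frac hι c (hWmul a' _ (hcW i)), toLaurent hι c ⟨_, hab⟩, ?_⟩
    rw [coe_toLaurent, coe_toLaurent, ← map_mul]
    congr 1
    change _ = a' * (bas.repr e i : E) * (a * bas i)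
    rw [← Subring.mem_center_iff.mp ha'c, mul_assoc, ← mul_assoc a', haa, one_mul]
  choose x hx hxw b hb using hterm
  have hz : z = ∑ i, x i * (b i * y) := by
    apply Subtype.ext
    have h1 : (z : Q) = ι e * (ι t)⁻¹ := by rw [← he', mul_inv_cancel_right₀ ht0']
    have h2 : (e : E) = ∑ i, (bas.repr e i : E) * bas i := (bas.sum_repr e).symm
    rw [h1, h2, map_sum, Finset.sum_mul]
    push_cast
    refine Finset.sum_congr rfl fun i _ => ?_
    rw [hb, mul_assoc]
  rw [hz]
  exact sum_mem fun i _ => AddSubgroup.subset_closure ⟨x i, hx i, hxw i, _, rfl⟩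

/-- Two irreducible elements that divide the same central elements are similar up to conjugation
by a homogeneous unit, and so have the same class. Otherwise the ideal `M` generated by the central
elements that they divide satisfies `M ⊆ r M`, which is absurd for reasons of degree. -/
theorem unitClass_div_mem_of_forall_iff {p r : laurent hι c} (hp : GeneratesMaximal p)
    (hr : GeneratesMaximal r)
    (hpr : ∀ x ∈ laurentCenter hι c, (∃ z, x = z * p) ↔ ∃ z, x = z * r) :
    unitClass (r : Q) / unitClass (p : Q) ∈ degClasses 𝒜 hι Δ' := by
  have hB := isLeftEuclidean_laurent hι c
  have hne : ∀ {x : laurent hι c}, x ≠ 0 → (x : Q) ≠ 0 := fun h h' => h (Subtype.ext h')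
  by_cases hg : ∃ (γ : Γ) (g : Eˣ) (hg : (g : E) ∈ 𝒜 γ) (hg' : (↑g⁻¹ : E) ∈ 𝒜 (-γ)),
      ∃ b a, r * b = a * conjLaurent hι c g hg hg' p ∧ ¬∃ z, b = z * conjLaurent hι c g hg hg' p
  · obtain ⟨γ, g, hg, hg', b, a, h, hb⟩ := hg
    have h1 := hB.div_mem_of_similar (degClasses 𝒜 hι Δ')
      (fun x : laurent hι c => unitClass (x : Q))
      (fun x y hx hy => unitClass_mul (hne hx) (hne hy))
      (fun x hx => unitClass_mem_of_isUnit hι c hx) (GeneratesMaximal.map _ hp) hr h hb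
    rwa [unitClass_conj (hι.map_ne_zero g.ne_zero) (hne hp.ne_zero)
      (conjLaurent_mul hι c g hg hg' p)] at h1
  · exfalso
    push Not at hg
    let M : AddSubgroup (laurent hι c) := AddSubgroup.closure
      {y | ∃ x ∈ laurentCenter hι c, (∃ w, x = w * p) ∧ ∃ b, y = x * b}
    have hMmul : ∀ y ∈ M, ∀ b, y * b ∈ M := fun y hy b => by
      refine AddSubgroup.closure_induction (p := fun y _ => y * b ∈ M) ?_ ?_ ?_ ?_ hy
      · rintro _ ⟨x, hx, hw, b', rfl⟩
        exact AddSubgroup.subset_closure ⟨x, hx, hw, b' * b, mul_assoc _ _ _⟩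
      · rw [zero_mul]; exact zero_mem M
      · intro x y _ _ hx hy
        rw [add_mul]; exact add_mem hx hy
      · intro x _ hx
        rw [neg_mul]; exact neg_mem hx
    have hMr : ∀ y ∈ M, ∃ y' ∈ M, y = r * y' := fun y hy => by
      refine AddSubgroup.closure_induction (p := fun y _ => ∃ y' ∈ M, y = r * y') ?_ ?_ ?_ ?_ hy
      · rintro _ ⟨x, hx, ⟨w, hw⟩, b, rfl⟩
        obtain ⟨z, hz⟩ := (hpr x hx).mp ⟨w, hw⟩
        have hrz : x = r * z := by
          apply mul_right_cancel₀ hr.ne_zero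
          rw [laurentCenter_comm' hι c hx, mul_assoc, ← hz]
        refine ⟨z * b, hMmul z (mem_closure_of_forall_mul hι c hE hfin fun γ g hgγ h0 => ?_) b,
          by rw [hrz, mul_assoc]⟩
        obtain ⟨g', hg', hgg, hgg'⟩ := exists_inverse hE hgγ h0
        let G : Eˣ := ⟨g, g', hgg, hgg'⟩
        -- A central element is fixed by conjugation.
        have hx' : r * z = conjLaurent hι c G hgγ hg' w * conjLaurent hι c G hgγ hg' p := by
          rw [← map_mul, ← hw, ← hrz]
          apply Subtype.ext
          apply mul_right_cancel₀ (hι.map_ne_zero G.ne_zero)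
          rw [conjLaurent_mul, laurentCenter_comm hι c hx]
        obtain ⟨q, hq⟩ := hg γ G hgγ hg' _ _ hx'
        refine ⟨q * ι g, mul_mem ?_ (map_mem_frac hι trivial), ?_⟩
        · obtain ⟨t, ht, ht0, e, -, h⟩ := q.2
          exact ⟨t, ht, ht0, e, trivial, h⟩
        · rw [hq, Subring.coe_mul, mul_assoc, mul_assoc]
          exact congrArg _ (conjLaurent_mul hι c G hgγ hg' p)
      · exact ⟨0, zero_mem _, by simp⟩
      · rintro _ _ _ _ ⟨x, hx, rfl⟩ ⟨y, hy, rfl⟩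
        exact ⟨x + y, add_mem hx hy, by rw [mul_add]⟩
      · rintro _ _ ⟨x, hx, rfl⟩
        exact ⟨-x, neg_mem hx, by rw [mul_neg]⟩
    have hM0 : ∃ y ∈ M, y ≠ 0 := by
      obtain ⟨t, ht, ht0, q, hq⟩ := exists_num hι c p
      obtain ⟨a, ha, s, hs, hsΔ, hs0, has, -⟩ := exists_mul_eq_center (𝒜 := 𝒜) Δ q.2
        (num_ne_zero hι c hp.ne_zero ht0 hq)
      let s' : degSubring 𝒜 Δ := ⟨s, hsΔ⟩
      refine ⟨toLaurent hι c s', AddSubgroup.subset_closure ⟨_,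
        toLaurent_mem_laurentCenter hι c hs, ⟨toLaurent hι c t * toLaurent hι c ⟨a, ha⟩, ?_⟩, 1,
        by rw [mul_one]⟩, toLaurent_ne_zero hι c fun h => hs0 (congrArg Subtype.val h)⟩
      have h1 : s' = ⟨a, ha⟩ * q := Subtype.ext has.symm
      have h2 : ∀ x, toLaurent hι c t * x = x * toLaurent hι c t := fun x =>
        Subtype.ext (hι.comm ht.2 _)
      rw [h1, map_mul, ← hq, mul_assoc, h2, mul_assoc]
    have hdr : laurentDegree hι c r ≠ 0 := fun h =>
      hr.not_isUnit (hB.isUnit_of_eq_zero r hr.ne_zero h)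
    obtain ⟨y, hy, hy0⟩ := hM0
    induction hn : laurentDegree hι c y using Nat.strong_induction_on generalizing y with
    | _ n ih =>
    obtain ⟨y', hy', rfl⟩ := hMr y hy
    have hy'0 := right_ne_zero_of_mul hy0
    have h1 := hB.map_mul r y' hr.ne_zero hy'0
    exact ih _ (by omega) y' hy' hy'0 rfl

end Transitive

/-! ### Norms of elements with the same class -/

section Norm

variable {Γ : Type v} [AddCommGroup Γ] [DecidableEq Γ] {E : Type u} [Ring E]
  {𝒜 : Γ → AddSubgroup E} [GradedRing 𝒜] {Q : Type*} [DivisionRing Q] {ι : E →+* Q}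
  {F : Type*} [CommMonoid F]

theorem map_eq_of_unitClass_eq (f : Q →* F) {x y : Q} (hx : x ≠ 0) (hy : y ≠ 0)
    (h : unitClass x = unitClass y) : f x = f y := by
  obtain ⟨x, rfl⟩ := hx.isUnit
  obtain ⟨y, rfl⟩ := hy.isUnit
  rw [unitClass_coe, unitClass_coe] at h
  have h1 := congrArg (Abelianization.lift (Units.map f)) h
  rw [Abelianization.lift_apply_of, Abelianization.lift_apply_of] at h1
  exact congrArg Units.val h1

/-- The properties of the reduced norms `N` of `E` and `N'` of `Q` that determine the comparison of
the reduced Whitehead groups: on the center, `N` is a power map, an adjoint element exists, and `N`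
is determined by `N'`. -/
structure IsNorm (ι : E →+* Q) (N : E →* Subring.center E) (N' : Q →* F) (n : ℕ) : Prop where
  map_center : ∀ t : Subring.center E, N t = t ^ n
  exists_mul_eq : ∀ e, ∃ x, x * e = (N e : E)
  eq_of_map_eq : ∀ e f, N' (ι e) = N' (ι f) → N e = N f

namespace IsNorm

variable {N : E →* Subring.center E} {N' : Q →* F} {n : ℕ} (hN : IsNorm ι N N' n)
  [IsDomain E] (hι : IsQuotient ι) {Δ' Δ : AddSubgroup Γ}

include hN

omit [IsDomain E] in
include hι in
theorem eq_of_unitClass_eq {e f : E} (he : e ≠ 0) (hf : f ≠ 0)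
    (h : unitClass (ι e) = unitClass (ι f)) : N e = N f :=
  hN.eq_of_map_eq e f (map_eq_of_unitClass_eq N' (hι.map_ne_zero he) (hι.map_ne_zero hf) h)

theorem eq_of_unitClass_div_eq (hι : IsQuotient ι) {x y u e f : E} (hx : x ≠ 0) (hy : y ≠ 0)
    (hu : u ≠ 0) (he : e ≠ 0) (hf : f ≠ 0)
    (h : unitClass (ι x) / unitClass (ι y) =
      unitClass (ι u) * (unitClass (ι e) / unitClass (ι f))) :
    N x * N f = N u * N e * N y := by
  rw [← map_mul, ← map_mul, ← map_mul]
  refine hN.eq_of_unitClass_eq hι (mul_ne_zero hx hf) (mul_ne_zero (mul_ne_zero hu he) hy) ?_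
  have hm : ∀ {a b : E}, a ≠ 0 → b ≠ 0 →
      unitClass (ι (a * b)) = unitClass (ι a) * unitClass (ι b) := fun ha hb => by
    rw [map_mul, unitClass_mul (hι.map_ne_zero ha) (hι.map_ne_zero hb)]
  rw [hm hx hf, hm (mul_ne_zero hu he) hy, hm hu he]
  rw [← mul_div_assoc, div_eq_div_iff_mul_eq_mul] at h
  exact h

variable [Module.Finite (Subring.center E) E]

theorem exists_mul_eq_pow (Δ' : AddSubgroup Γ) {e : E} (he : e ∈ degSubring 𝒜 Δ') (h0 : e ≠ 0) :
    ∃ a, ∃ t : Subring.center E, (t : E) ∈ degSubring 𝒜 Δ' ∧ t ≠ 0 ∧ N e * a = t ^ n := by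
  obtain ⟨a, -, t, ht, htΔ, ht0, -, hea⟩ := exists_mul_eq_center (𝒜 := 𝒜) Δ' he h0
  refine ⟨N a, ⟨t, ht⟩, htΔ, fun h => ht0 (congrArg Subtype.val h), ?_⟩
  rw [← map_mul, hea]
  exact hN.map_center ⟨t, ht⟩

theorem ne_zero (𝒜 : Γ → AddSubgroup E) [GradedRing 𝒜] {e : E} (h0 : e ≠ 0) : N e ≠ 0 := by
  obtain ⟨a, t, -, ht0, h⟩ := hN.exists_mul_eq_pow (𝒜 := 𝒜) ⊤ (mem_supportedIn_univ e) h0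
  intro h'
  rw [h', zero_mul] at h
  exact pow_ne_zero n ht0 h.symm

end IsNorm

/-! ### Norms modulo the elements with degrees in a subgroup -/

variable (𝒜) in
/-- The nonzero central elements with degrees in `Δ'`. -/
def degDenominators [IsDomain E] (Δ' : AddSubgroup Γ) : Submonoid (Subring.center E) where
  carrier := {t | (t : E) ∈ degSubring 𝒜 Δ' ∧ t ≠ 0}
  one_mem' := ⟨one_mem _, one_ne_zero⟩
  mul_mem' h h' := ⟨mul_mem h.1 h'.1, mul_ne_zero h.2 h'.2⟩

theorem degDenominators_le [IsDomain E] (Δ' : AddSubgroup Γ) :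
    degDenominators 𝒜 Δ' ≤ nonZeroDivisors (Subring.center E) :=
  fun _ ht => mem_nonZeroDivisors_of_ne_zero ht.2

variable (𝒜) in
/-- The norm with values in the localization at the nonzero central elements with degrees in
`Δ'`. -/
def localNorm [IsDomain E] (N : E →* Subring.center E) (Δ' : AddSubgroup Γ) :
    E →* Localization (degDenominators 𝒜 Δ') :=
  (algebraMap (Subring.center E) (Localization (degDenominators 𝒜 Δ'))).toMonoidHom.comp N

theorem localNorm_apply [IsDomain E] (N : E →* Subring.center E) (Δ' : AddSubgroup Γ) (e : E) :
    localNorm 𝒜 N Δ' e = algebraMap _ _ (N e) := rfl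

instance [IsDomain E] (Δ' : AddSubgroup Γ) : IsDomain (Localization (degDenominators 𝒜 Δ')) :=
  IsLocalization.isDomain_localization (degDenominators_le Δ')

namespace IsNorm

variable {N : E →* Subring.center E} {N' : Q →* F} {n : ℕ} (hN : IsNorm ι N N' n)
  [IsDomain E] (hι : IsQuotient ι) {Δ' Δ : AddSubgroup Γ} [Module.Finite (Subring.center E) E]

include hN

theorem localNorm_ne_zero {e : E} (h0 : e ≠ 0) : localNorm 𝒜 N Δ' e ≠ 0 := fun h =>
  hN.ne_zero 𝒜 h0 (IsLocalization.injective _ (degDenominators_le (𝒜 := 𝒜) Δ')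
    (h.trans (map_zero _).symm))

theorem isUnit_localNorm_of_mem {e : E} (he : e ∈ degSubring 𝒜 Δ') (h0 : e ≠ 0) :
    IsUnit (localNorm 𝒜 N Δ' e) := by
  obtain ⟨a, t, ht, ht0, h⟩ := hN.exists_mul_eq_pow Δ' he h0
  have ht' : t ∈ degDenominators 𝒜 Δ' := ⟨ht, ht0⟩
  exact (IsLocalization.algebraMap_isUnit_iff (degDenominators 𝒜 Δ')).mpr
    ⟨t ^ n, pow_mem ht' n, Dvd.intro a h⟩

theorem associated_of_unitClass_div_mem {x y : E} (hx : x ≠ 0) (hy : y ≠ 0)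
    (h : unitClass (ι x) / unitClass (ι y) ∈ degClasses 𝒜 hι Δ') :
    Associated (localNorm 𝒜 N Δ' x) (localNorm 𝒜 N Δ' y) := by
  obtain ⟨u, e, he, f, hf, he0, hf0, h⟩ := h
  have h1 := congrArg (algebraMap _ (Localization (degDenominators 𝒜 Δ')))
    (hN.eq_of_unitClass_div_eq hι hx hy u.ne_zero he0 hf0 h)
  simp only [map_mul, ← localNorm_apply] at h1
  have h2 := (hN.isUnit_localNorm_of_mem hf hf0)
  have h3 := (u.isUnit.map (localNorm 𝒜 N Δ')).mul (hN.isUnit_localNorm_of_mem he he0)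
  calc Associated (localNorm 𝒜 N Δ' x) (localNorm 𝒜 N Δ' x * localNorm 𝒜 N Δ' f) :=
        (associated_mul_unit_right _ _ h2)
    _ = localNorm 𝒜 N Δ' u * localNorm 𝒜 N Δ' e * localNorm 𝒜 N Δ' y := h1
    Associated _ (localNorm 𝒜 N Δ' y) := (associated_unit_mul_left _ _ h3)

variable (c : CyclicStep 𝒜 Δ' Δ)

omit [Module.Finite (Subring.center E) E] in
/-- An element is invertible if its norm is, since it divides its norm. -/
theorem isUnit_toLaurent {p : degSubring 𝒜 Δ} (h : IsUnit (localNorm 𝒜 N Δ' (p : E))) :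
    IsUnit (toLaurent hι c p) := by
  obtain ⟨s, ⟨hs, hs0⟩, z, hz⟩ :=
    (IsLocalization.algebraMap_isUnit_iff (degDenominators 𝒜 Δ')).mp h
  obtain ⟨x, hx⟩ := hN.exists_mul_eq p
  have h1 : (s : E) = z * x * p := by
    rw [mul_assoc, hx, Subring.mem_center_iff.mp (N p).2, hz, Subring.coe_mul]
  have hsΔ : (s : E) ∈ degSubring 𝒜 Δ := degSubring_mono c.le hs
  have h2 : (s : E) = restrict 𝒜 Δ ((z : E) * x) * p := by
    rw [← restrict_addSubgroup_mul Δ _ p.2, ← h1, restrict_of_mem hsΔ]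
  let s' : degSubring 𝒜 Δ := ⟨s, hsΔ⟩
  let x' : degSubring 𝒜 Δ := ⟨_, restrict_mem (𝒜 := 𝒜) Δ ((z : E) * x)⟩
  obtain ⟨y, hy⟩ := isUnit_toLaurent_of_mem hι c (x := s') ⟨hs, s.2⟩
    fun h => hs0 (Subtype.ext
      (show (s : E) = 0 from congrArg (fun x : degSubring 𝒜 Δ => (x : E)) h))
  have h3 : toLaurent hι c x' * toLaurent hι c p = y := by
    rw [hy, ← map_mul]
    exact congrArg _ (Subtype.ext h2.symm)
  refine isUnit_of_mul_eq_one_left (x := ↑y⁻¹ * toLaurent hι c x') ?_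
  rw [mul_assoc, h3, Units.inv_mul]

omit [Module.Finite (Subring.center E) E] in
/-- If `p` divides the central fraction `e / t`, then its norm divides the norm `e ^ n` of `e`, up
to the invertible norms of the denominators. -/
theorem localNorm_dvd_pow {p : degSubring 𝒜 Δ} {x : laurent hι c}
    (hx : ∃ z, x = z * toLaurent hι c p) {t : E} (ht : t ∈ degCenter 𝒜 Δ')
    {e : Subring.center E} (h : (x : Q) * ι t = ι e) :
    localNorm 𝒜 N Δ' (p : E) ∣ algebraMap _ _ e ^ n := by
  obtain ⟨z, rfl⟩ := hx
  obtain ⟨s, hs, hs0, f, hf⟩ := exists_num hι c z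
  have hf' := congrArg Subtype.val hf
  rw [Subring.coe_mul, coe_toLaurent, coe_toLaurent] at hf'
  let s' : Subring.center E := ⟨s, hs.2⟩
  have h1 : (f : E) * t * p = (e * s' : Subring.center E) := hι.injective (by
    change ι (f * t * p) = ι (e * s)
    have h2 := hι.comm (mul_mem ht.2 hs.2) (ι (p : E))
    rw [map_mul ι t s] at h2
    rw [map_mul, map_mul, map_mul, ← h, ← hf', Subring.coe_mul, coe_toLaurent, mul_assoc (z : Q),
      ← hι.comm ht.2, mul_assoc (z : Q), h2]
    simp only [mul_assoc])
  have h2 := congrArg N h1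
  rw [hN.map_center, mul_pow, map_mul] at h2
  have h3 : IsUnit (algebraMap _ (Localization (degDenominators 𝒜 Δ')) s' ^ n) :=
    (IsLocalization.map_units (Localization (degDenominators 𝒜 Δ'))
      (⟨s', hs.1, fun h => hs0 (Subtype.ext
      (show (s : E) = 0 from congrArg (fun x : Subring.center E => (x : E)) h))⟩ :
        degDenominators 𝒜 Δ')).pow n
  rw [← h3.dvd_mul_right, ← map_pow, ← map_pow, ← map_mul, ← h2, map_mul]
  exact Dvd.intro_left _ rfl

omit [Module.Finite (Subring.center E) E] in
/-- Irreducible elements that do not divide the same central elements have coprime norms. -/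
theorem isCoprime_localNorm {p r : degSubring 𝒜 Δ}
    (h : ∃ x ∈ laurentCenter hι c, ∃ y ∈ laurentCenter hι c, (∃ z, x = z * toLaurent hι c p) ∧
      (∃ z, y = z * toLaurent hι c r) ∧ x + y = 1) :
    IsCoprime (localNorm 𝒜 N Δ' (p : E)) (localNorm 𝒜 N Δ' (r : E)) := by
  obtain ⟨x, hx, y, -, hxp, hyr, hxy⟩ := h
  obtain ⟨t, ht, ht0, e, he, h⟩ := (mem_laurentCenter hι c).mp hx
  let e' : Subring.center E := ⟨e, he.2⟩
  let t' : Subring.center E := ⟨t, ht.2⟩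
  have h1 := hN.localNorm_dvd_pow hι c hxp ht (e := e') h
  have h2 := hN.localNorm_dvd_pow hι c hyr ht (e := t' - e') (by
    have h3 : (y : Q) = 1 - x := 
      congrArg Subtype.val (eq_sub_iff_add_eq'.mpr hxy)
    rw [h3, sub_mul, one_mul, h]
    exact (map_sub ι t e).symm)
  refine IsCoprime.of_isCoprime_of_dvd_left (IsCoprime.of_isCoprime_of_dvd_right ?_ h2) h1
  refine IsCoprime.pow ?_
  have h4 : IsUnit (algebraMap _ (Localization (degDenominators 𝒜 Δ')) t') :=
    IsLocalization.map_units (Localization (degDenominators 𝒜 Δ'))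
      (⟨t', ht.1, fun h => ht0 (congrArg Subtype.val h)⟩ : degDenominators 𝒜 Δ')
  obtain ⟨z, hz⟩ := h4.exists_left_inv
  exact ⟨z, z, by rw [← mul_add, ← map_add, add_sub_cancel, hz]⟩

variable (hE : IsGradedDivisionRing 𝒜)

omit [Module.Finite (Subring.center E) E] hN in
theorem exists_unitClass_eq_prod (hι : IsQuotient ι) (P : Multiset (degSubring 𝒜 Δ))
    (hP : ∀ p ∈ P, p ≠ 0) : ∃ x : E, x ≠ 0 ∧
      unitClass (ι x) = (P.map fun p : degSubring 𝒜 Δ => unitClass (ι p)).prod ∧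
      localNorm 𝒜 N Δ' x = (P.map fun p : degSubring 𝒜 Δ => localNorm 𝒜 N Δ' (p : E)).prod := by
  induction P using Multiset.induction_on with
  | empty => exact ⟨1, one_ne_zero, by simp [unitClass_one]⟩
  | cons p P ih =>
    obtain ⟨x, hx0, hx, hx'⟩ := ih fun q hq => hP q (Multiset.mem_cons_of_mem hq)
    have hp0 : (p : E) ≠ 0 := fun h => hP p (Multiset.mem_cons_self p P) (Subtype.ext h)
    refine ⟨p * x, mul_ne_zero hp0 hx0, ?_, ?_⟩
    · rw [map_mul, unitClass_mul (hι.map_ne_zero hp0) (hι.map_ne_zero hx0), hx,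
        Multiset.map_cons, Multiset.prod_cons]
    · rw [map_mul, hx', Multiset.map_cons, Multiset.prod_cons]

omit [Module.Finite (Subring.center E) E] in
include hE in
/-- Products of irreducible elements with associated norms have the same class: the factors that
divide the same central elements cancel, and the norms of the others are coprime. -/
theorem prod_div_prod_mem (hfin : Module.Finite (Subring.center E) E)
    (P R : Multiset (degSubring 𝒜 Δ))
    (hP : ∀ p ∈ P, GeneratesMaximal (toLaurent hι c p))
    (hR : ∀ p ∈ R, GeneratesMaximal (toLaurent hι c p))
    (h : Associated (P.map fun p : degSubring 𝒜 Δ => localNorm 𝒜 N Δ' (p : E)).prod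
      (R.map fun p : degSubring 𝒜 Δ => localNorm 𝒜 N Δ' (p : E)).prod) :
    (P.map fun p : degSubring 𝒜 Δ => unitClass (ι p)).prod /
      (R.map fun p : degSubring 𝒜 Δ => unitClass (ι p)).prod ∈ degClasses 𝒜 hι Δ' := by
  classical
  induction P using Multiset.induction_on generalizing R with
  | empty =>
    rcases R.empty_or_exists_mem with rfl | ⟨r, hr⟩
    · simp
    · exfalso
      rw [Multiset.map_zero, Multiset.prod_zero] at h
      refine (hR r hr).not_isUnit (hN.isUnit_toLaurent hι c (isUnit_of_dvd_unit
        
        (Multiset.dvd_prod (Multiset.mem_map_of_mem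
          (fun p : degSubring 𝒜 Δ => localNorm 𝒜 N Δ' (p : E)) hr)) (h.isUnit isUnit_one)))
  | cons p P ih =>
    have hp := hP p (Multiset.mem_cons_self p P)
    have hP' : ∀ q ∈ P, GeneratesMaximal (toLaurent hι c q) := fun q hq =>
      hP q (Multiset.mem_cons_of_mem hq)
    have hne : ∀ {q : degSubring 𝒜 Δ}, GeneratesMaximal (toLaurent hι c q) → (q : E) ≠ 0 :=
      fun hq h => hq.ne_zero (by rw [Subtype.ext h (a2 := (0 : degSubring 𝒜 Δ)), map_zero])
    by_cases hex : ∃ r ∈ R, ∀ x ∈ laurentCenter hι c,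
        (∃ z, x = z * toLaurent hι c p) ↔ ∃ z, x = z * toLaurent hι c r
    · obtain ⟨r, hr, hpr⟩ := hex
      obtain ⟨R, rfl⟩ := Multiset.exists_cons_of_mem hr
      have hr' := hR r hr
      have h1 : unitClass (ι p) / unitClass (ι r) ∈ degClasses 𝒜 hι Δ' :=
        unitClass_div_mem_of_forall_iff hι c hE hfin hr' hp fun x hx => (hpr x hx).symm
      have h2 := hN.associated_of_unitClass_div_mem hι (hne hp) (hne hr') h1
      rw [Multiset.map_cons, Multiset.map_cons, Multiset.prod_cons, Multiset.prod_cons] at h ⊢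
      rw [mul_div_mul_comm]
      exact mul_mem h1 (ih R hP' (fun q hq => hR q (Multiset.mem_cons_of_mem hq))
        (h.of_mul_left h2 (hN.localNorm_ne_zero (hne hp))))
    · exfalso
      push Not at hex
      have hcop : IsCoprime (localNorm 𝒜 N Δ' (p : E))
          (R.map fun p : degSubring 𝒜 Δ => localNorm 𝒜 N Δ' (p : E)).prod := by
        refine Multiset.prod_induction (IsCoprime (localNorm 𝒜 N Δ' (p : E))) _
          (fun a b ha hb => ha.mul_right hb) isCoprime_one_right fun a ha => ?_
        obtain ⟨r, hr, rfl⟩ := Multiset.mem_map.mp ha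
        obtain h1 | h1 := GeneratesMaximal.eq_or_comaximal
          (fun x hx => laurentCenter_comm' hι c hx) (laurent_integral hι c) hp (hR r hr)
        · obtain ⟨x, hx, h2⟩ := hex r hr
          exact absurd (h1 x hx) (by tauto)
        · exact hN.isCoprime_localNorm hι c h1
      refine hp.not_isUnit (hN.isUnit_toLaurent hι c (hcop.isUnit_of_dvd' dvd_rfl ?_))
      rw [← h.dvd_iff_dvd_right, Multiset.map_cons, Multiset.prod_cons]
      exact Dvd.intro _ rfl

end IsNorm

end Norm

/-! ### Elements with associated norms have the same class modulo the units of `E` -/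

theorem GeneratesMaximal.mul_isUnit {B : Type*} [Ring B] {p z : B} (hp : GeneratesMaximal p)
    (hz : IsUnit z) : GeneratesMaximal (p * z) := by
  obtain ⟨z, rfl⟩ := hz
  refine ⟨fun h => hp.ne_zero (by simpa using h), fun h => hp.not_isUnit (by simpa using h),
    fun b hb => ?_⟩
  obtain ⟨x, y, h⟩ := hp.exists_eq_one (b * ↑z⁻¹) fun ⟨w, hw⟩ =>
    hb ⟨w, by rw [← mul_assoc, ← hw, Units.inv_mul_cancel_right]⟩
  refine ⟨↑z⁻¹ * x, ↑z⁻¹ * y, ?_⟩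
  have h1 := congrArg (fun a => ↑z⁻¹ * a * (z : B)) h
  rw [mul_one, Units.inv_mul, mul_add, add_mul] at h1
  rw [← h1]
  simp only [mul_assoc, Units.inv_mul, mul_one]

section Step

variable {Γ : Type v} [AddCommGroup Γ] [DecidableEq Γ] {E : Type u} [Ring E]
  {𝒜 : Γ → AddSubgroup E} [GradedRing 𝒜] {Q : Type*} [DivisionRing Q] {ι : E →+* Q}
  {F : Type*} [CommMonoid F] [IsDomain E] (hι : IsQuotient ι) {Δ' Δ : AddSubgroup Γ}

/-- Up to the group `degClasses`, elements with degrees in `Δ` are products of irreducible ones. -/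
theorem exists_factorization [Module.Finite (Subring.center E) E] (c : CyclicStep 𝒜 Δ' Δ)
    {e : degSubring 𝒜 Δ} (he : e ≠ 0) :
    ∃ P : Multiset (degSubring 𝒜 Δ), (∀ p ∈ P, GeneratesMaximal (toLaurent hι c p)) ∧
      unitClass (ι e) / (P.map fun p : degSubring 𝒜 Δ => unitClass (ι p)).prod ∈
        degClasses 𝒜 hι Δ' := by
  have hne : ∀ {x : laurent hι c}, x ≠ 0 → (x : Q) ≠ 0 := fun h h' => h (Subtype.ext h')
  obtain ⟨u, l, hu, hl, hul⟩ :=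
    (isLeftEuclidean_laurent hι c).exists_factorization (toLaurent_ne_zero hι c he)
  have key : ∀ l : List (laurent hι c), (∀ p ∈ l, GeneratesMaximal p) → l.prod ≠ 0 ∧
      ∃ P : Multiset (degSubring 𝒜 Δ), (∀ p ∈ P, GeneratesMaximal (toLaurent hι c p)) ∧
        unitClass (l.prod : Q) / (P.map fun p : degSubring 𝒜 Δ => unitClass (ι p)).prod ∈
          degClasses 𝒜 hι Δ' := by
    intro l hl
    induction l with
    | nil => exact ⟨one_ne_zero, 0, by simp, by simp [unitClass_one]⟩
    | cons p l ih =>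
      obtain ⟨h0, P, hP, hlP⟩ := ih fun q hq => hl q (List.mem_cons_of_mem p hq)
      have hp := hl p List.mem_cons_self
      obtain ⟨t, ht, ht0, q, hq⟩ := exists_num hι c p
      refine ⟨by rw [List.prod_cons]; exact mul_ne_zero hp.ne_zero h0, q ::ₘ P, fun r hr => ?_, ?_⟩
      · obtain rfl | hr := Multiset.mem_cons.mp hr
        · rw [← hq]
          exact hp.mul_isUnit (isUnit_toLaurent_of_mem hι c ht ht0)
        · exact hP r hr
      · have h1 := unitClass_mul_toLaurent hι c hp.ne_zero ht0 hq
        rw [List.prod_cons, Subring.coe_mul, unitClass_mul (hne hp.ne_zero) (hne h0),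
          Multiset.map_cons, Multiset.prod_cons, ← h1, mul_div_mul_comm]
        refine mul_mem ?_ hlP
        rw [div_mul_cancel_left]
        exact inv_mem (unitClass_mem_degClasses hι ht.1 fun h => ht0 (Subtype.ext h))
  obtain ⟨h0, P, hP, hlP⟩ := key l hl
  refine ⟨P, hP, ?_⟩
  have h1 : ι (e : E) = u * (l.prod : laurent hι c) := congrArg Subtype.val hul
  rw [h1, unitClass_mul (hne hu.ne_zero) (hne h0), mul_div_assoc]
  exact mul_mem (unitClass_mem_of_isUnit hι c hu) hlP

/-- Elements with degrees in `Δ` whose norms differ by a central unit have the same class modulo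
the units of `E`. -/
def NormDeterminesClass (𝒜 : Γ → AddSubgroup E) [GradedRing 𝒜] (ι : E →+* Q)
    (N : E →* Subring.center E) (Δ : AddSubgroup Γ) : Prop :=
  ∀ e ∈ degSubring 𝒜 Δ, ∀ f ∈ degSubring 𝒜 Δ, e ≠ 0 → f ≠ 0 → Associated (N e) (N f) →
    unitClass (ι e) / unitClass (ι f) ∈ unitClasses ι

variable {N : E →* Subring.center E} {N' : Q →* F} {n : ℕ}

omit [IsDomain E] in
theorem normDeterminesClass_bot (hE : IsGradedDivisionRing 𝒜) :
    NormDeterminesClass 𝒜 ι N (⊥ : AddSubgroup Γ) := by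
  have key : ∀ e ∈ degSubring 𝒜 (⊥ : AddSubgroup Γ), e ≠ 0 → unitClass (ι e) ∈ unitClasses ι := by
    intro e he h0
    obtain ⟨u, rfl⟩ := hE.isUnit_of_mem 0 e (mem_supportedIn_singleton.mp he) h0
    exact mem_unitClasses u
  exact fun e he f hf he0 hf0 _ => div_mem (key e he he0) (key f hf hf0)

include hι in
/-- Factoring both elements and cancelling the irreducible factors leaves a fraction with degrees in
`Δ'`, to which the assumption on `Δ'` applies. -/
theorem CyclicStep.normDeterminesClass (c : CyclicStep 𝒜 Δ' Δ) (hN : IsNorm ι N N' n)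
    (hE : IsGradedDivisionRing 𝒜) (hfin : Module.Finite (Subring.center E) E)
    (h : NormDeterminesClass 𝒜 ι N Δ') : NormDeterminesClass 𝒜 ι N Δ := by
  intro e he f hf he0 hf0 hef
  have hne : ∀ {q : degSubring 𝒜 Δ}, GeneratesMaximal (toLaurent hι c q) → q ≠ 0 :=
    fun hq h => hq.ne_zero (by rw [h, map_zero])
  obtain ⟨P, hP, heP⟩ := exists_factorization hι c (e := ⟨e, he⟩)
    fun h => he0 (congrArg Subtype.val h)
  obtain ⟨R, hR, hfR⟩ := exists_factorization hι c (e := ⟨f, hf⟩)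
    fun h => hf0 (congrArg Subtype.val h)
  obtain ⟨x, hx0, hx, hx'⟩ := IsNorm.exists_unitClass_eq_prod (Δ' := Δ') (N := N) hι P
    fun p hp => hne (hP p hp)
  obtain ⟨y, hy0, hy, hy'⟩ := IsNorm.exists_unitClass_eq_prod (Δ' := Δ') (N := N) hι R
    fun p hp => hne (hR p hp)
  have h1 := hN.associated_of_unitClass_div_mem hι (x := e) he0 hx0 (by rwa [hx])
  have h2 := hN.associated_of_unitClass_div_mem hι (x := f) hf0 hy0 (by rwa [hy])
  have h3 : Associated (localNorm 𝒜 N Δ' e) (localNorm 𝒜 N Δ' f) := hef.map (algebraMap _ _)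
  have h4 := hN.prod_div_prod_mem hι c hE hfin P R hP hR (by
    rw [← hx', ← hy']
    exact (h1.symm.trans h3).trans h2)
  have h5 : unitClass (ι e) / unitClass (ι f) ∈ degClasses 𝒜 hι Δ' := by
    have h6 := div_mem (mul_mem heP h4) hfR
    rwa [div_mul_div_cancel, div_div_div_cancel_right] at h6
  obtain ⟨u, e', he', f', hf', he0', hf0', h6⟩ := h5
  have h7 := hN.eq_of_unitClass_div_eq hι he0 hf0 u.ne_zero he0' hf0' h6
  rw [h6]
  refine mul_mem (mem_unitClasses u) (h e' he' f' hf' he0' hf0' ?_)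
  obtain ⟨v, hv⟩ := hef.symm
  have h8 : N e' * N u = N f' * v := by
    apply mul_left_cancel₀ (hN.ne_zero 𝒜 hf0)
    rw [← mul_comm, mul_comm (N e'), ← h7, ← hv]
    ring
  calc Associated (N e') (N e' * N u) := associated_mul_unit_right _ _ (u.isUnit.map N)
    _ = N f' * v := h8
    Associated _ (N f') := associated_mul_unit_left _ _ v.isUnit

end Step

/-! ### Induction on the group of degrees -/

section Induction

variable {Γ : Type v} [AddCommGroup Γ] [DecidableEq Γ] {E : Type u} [Ring E]
  {𝒜 : Γ → AddSubgroup E} [GradedRing 𝒜] {Q : Type*} [DivisionRing Q] {ι : E →+* Q}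
  {F : Type*} [CommMonoid F] [IsDomain E]

omit [IsDomain E] in
/-- A finitely generated subgroup of the grade group is reached from the trivial group by finitely
many extensions with infinite cyclic quotient. -/
theorem CyclicStep.induction (hE : IsGradedDivisionRing 𝒜) {p : AddSubgroup Γ → Prop} (bot : p ⊥)
    (step : ∀ Δ' Δ, CyclicStep 𝒜 Δ' Δ → p Δ' → p Δ) (s : Finset Γ)
    (hs : ∀ γ ∈ s, γ ∈ gradeGroup hE) :
    p (AddSubgroup.closure s) := by
  set Δ := AddSubgroup.closure (s : Set Γ)
  have hΔ : Δ ≤ gradeGroup hE := (AddSubgroup.closure_le _).mpr hs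
  have hfin : Module.Finite ℤ Δ := Module.Finite.iff_addGroup_fg.mpr inferInstance
  have htf : IsAddTorsionFree Δ := ⟨fun k hk x y h => by
    have h1 : k • ((x - y : Δ) : Γ) = 0 := by
      rw [← AddSubgroup.coe_nsmul, nsmul_sub, sub_eq_zero.mpr h, AddSubgroup.coe_zero]
    exact sub_eq_zero.mp (Subtype.ext (gradeGroup_torsionFree hE (hΔ (x - y).2) hk h1))⟩
  have hfree : Module.Free ℤ Δ := inferInstance
  let b := Module.finBasis ℤ Δ
  let H : ℕ → AddSubgroup Δ := fun k =>
    { carrier := {x | ∀ i, k ≤ i.val → b.repr x i = 0}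
      zero_mem' := by simp
      add_mem' := fun {x y} hx hy i hi => by simp [hx i hi, hy i hi]
      neg_mem' := fun {x} hx i hi => by simp [hx i hi] }
  have key : ∀ k ≤ Module.finrank ℤ Δ, p ((H k).map Δ.subtype) := by
    intro k hk
    induction k with
    | zero =>
      have h : H 0 = ⊥ := eq_bot_iff.mpr fun x hx => b.repr.map_eq_zero_iff.mp
        (Finsupp.ext fun i => hx i (Nat.zero_le _))
      rw [h, AddSubgroup.map_bot]
      exact bot
    | succ k ih =>
      let i : Fin (Module.finrank ℤ Δ) := ⟨k, hk⟩
      obtain ⟨a, ha, ha0⟩ := hΔ (b i).2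
      obtain ⟨a', ha', haa, haa'⟩ := exists_inverse hE ha ha0
      -- The `i`-th coordinate, extended to `Γ` since `ℚ` is divisible.
      obtain ⟨w, hw⟩ := (Module.Baer.of_divisible ℚ).extension_property_addMonoidHom Δ.subtype
        Δ.subtype_injective ((Int.castAddHom ℚ).comp (b.coord i).toAddMonoidHom)
      have hw' : ∀ x : Δ, w x = (b.repr x i : ℚ) := fun x => DFunLike.congr_fun hw x
      refine step _ _ ?_ (ih (by omega))
      exact
        { le := AddSubgroup.map_mono fun x hx j hj => hx j (by omega)
          unit := ⟨a, a', haa, haa'⟩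
          δ := b i
          unit_mem := ha
          inv_mem := ha'
          w := w
          w_eq_zero := by
            rintro _ ⟨x, hx, rfl⟩
            have := hx i le_rfl
            rw [AddSubgroup.subtype_apply, hw', this, Int.cast_zero]
          w_δ := by rw [hw', b.repr_self, Finsupp.single_eq_same, Int.cast_one]
          δ_mem := ⟨b i, fun j hj => by
            rw [b.repr_self, Finsupp.single_eq_of_ne]
            rintro rfl
            exact absurd hj (Nat.not_succ_le_self k), rfl⟩
          exists_sub_mem := by
            rintro _ ⟨x, hx, rfl⟩
            refine ⟨b.repr x i, x - b.repr x i • b i, fun j hj => ?_, by simp⟩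
            rw [map_sub, map_zsmul, b.repr_self, Finsupp.sub_apply, Finsupp.smul_apply]
            by_cases hij : j = i
            · rw [hij, Finsupp.single_eq_same]
              simp
            · rw [Finsupp.single_eq_of_ne hij, hx j (by
                have : j.val ≠ k := fun h => hij (Fin.ext h)
                omega)]
              simp }
  have h := key _ le_rfl
  have h1 : H (Module.finrank ℤ Δ) = ⊤ := eq_top_iff.mpr fun x _ i hi => absurd i.2 (not_lt.mpr hi)
  rwa [h1, ← AddMonoidHom.range_eq_map, AddSubgroup.range_subtype] at h

/-- Elements of `E` whose norms differ by a central unit differ, modulo commutators of `Q`, by a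
unit of `E`. -/
theorem IsNorm.unitClass_div_mem (hι : IsQuotient ι) {N : E →* Subring.center E} {N' : Q →* F}
    {n : ℕ} (hN : IsNorm ι N N' n) (hE : IsGradedDivisionRing 𝒜)
    (hfin : Module.Finite (Subring.center E) E) {e f : E} (he : e ≠ 0) (hf : f ≠ 0)
    (h : Associated (N e) (N f)) : unitClass (ι e) / unitClass (ι f) ∈ unitClasses ι := by
  classical
  let s := (DirectSum.decompose 𝒜 e).support ∪ (DirectSum.decompose 𝒜 f).support
  have hs : ∀ γ, γ ∉ AddSubgroup.closure (s : Set Γ) → (DirectSum.decompose 𝒜 e γ : E) = 0 ∧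
      (DirectSum.decompose 𝒜 f γ : E) = 0 := fun γ hγ => by
    have h1 : γ ∉ s := fun h => hγ (AddSubgroup.subset_closure h)
    simpa [s, not_or] using h1
  have h1 : NormDeterminesClass 𝒜 ι N (AddSubgroup.closure (s : Set Γ)) := by
    refine CyclicStep.induction (𝒜 := 𝒜) hE (p := NormDeterminesClass 𝒜 ι N)
      (normDeterminesClass_bot hE) (fun Δ' Δ c => c.normDeterminesClass hι hN hE hfin) s ?_
    intro γ hγ
    obtain h | h := Finset.mem_union.mp hγ
    · exact mem_gradeGroup hE (SetLike.coe_mem (DirectSum.decompose 𝒜 e γ)) (by simpa using h)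
    · exact mem_gradeGroup hE (SetLike.coe_mem (DirectSum.decompose 𝒜 f γ)) (by simpa using h)
  exact h1 e (fun γ hγ => (hs γ hγ).1) f (fun γ hγ => (hs γ hγ).2) he hf h

end Induction

/-! ### Leading terms -/

section Leading

variable {Γ : Type v} [AddCommGroup Γ] [DecidableEq Γ] {E : Type u} [Ring E]
  {𝒜 : Γ → AddSubgroup E} [GradedRing 𝒜]

/-- The leading term with respect to an ordering of the grade group is multiplicative, and is the
identity on units, since these are homogeneous. -/
theorem exists_leadingTerm (hE : IsGradedDivisionRing 𝒜) :
    ∃ l : E → E, (∀ e, e ≠ 0 → IsUnit (l e)) ∧ (∀ e f, e ≠ 0 → f ≠ 0 → l (e * f) = l e * l f) ∧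
      (∀ t ∈ Subring.center E, l t ∈ Subring.center E) ∧ ∀ e, IsUnit e → l e = e := by
  obtain ⟨O, i1, i2, i3, o, ho⟩ := exists_order hE
  have := isDomain hE
  refine ⟨fun e => restrict 𝒜 {γ | o γ = top 𝒜 o e} e,
    fun e he => isUnit_restrict_top hE ho (isTop_top he), fun e f he hf => ?_,
    fun t ht => restrict_mem_center _ ht, fun e he => ?_⟩
  · dsimp only
    rw [top_mul he hf, restrict_mul_of_le o (isTop_top he).1 (isTop_top hf).1]
  · obtain ⟨γ, hγ⟩ := exists_mem_of_isUnit hE he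
    have h1 : e ∈ supportedIn 𝒜 {γ' | o γ' = o γ} := mem_supportedIn_of_mem hγ rfl
    dsimp only
    rw [(isTop_of_mem he.ne_zero h1).top_eq, restrict_of_mem h1]

variable {Q : Type*} [DivisionRing Q] {ι : E →+* Q}

/-- The leading term extends to fractions, as a retraction of the inclusion of the unit groups. -/
theorem exists_retraction (hE : IsGradedDivisionRing 𝒜) (hι : IsQuotient ι) :
    ∃ r : Qˣ →* Eˣ, ∀ u, r (Units.map ι.toMonoidHom u) = u := by
  have := isDomain hE
  obtain ⟨l, hunit, hmul, hcenter, hid⟩ := exists_leadingTerm hE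
  have hnum : ∀ x : Qˣ, ∃ e t, t ∈ Subring.center E ∧ t ≠ 0 ∧ e ≠ 0 ∧ x * ι t = ι e := fun x => by
    obtain ⟨e, t, ht, ht0, h⟩ := hι.exists_eq x
    refine ⟨e, t, ht, ht0, ?_, h⟩
    rintro rfl
    rw [map_zero] at h
    exact mul_ne_zero x.ne_zero (hι.map_ne_zero ht0) h
  choose num den hden hden0 hnum0 hfrac using hnum
  let r : Qˣ → Eˣ := fun x => (hunit _ (hnum0 x)).unit * (hunit _ (hden0 x)).unit⁻¹
  have hr : ∀ (x : Qˣ) (e t : E), t ∈ Subring.center E → t ≠ 0 → e ≠ 0 → x * ι t = ι e →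
      r x * l t = l e := by
    intro x e t ht ht0 he0 h
    have h1 : num x * t = e * den x := hι.injective (by
      rw [map_mul, map_mul, ← hfrac, ← h, mul_assoc, mul_assoc, hι.comm ht])
    have h2 := congrArg l h1
    rw [hmul _ _ (hnum0 x) ht0, hmul _ _ he0 (hden0 x)] at h2
    have h3 : (r x : E) = l (num x) * ↑(hunit _ (hden0 x)).unit⁻¹ := rfl
    rw [h3, mul_assoc, Subring.mem_center_iff.mp (hcenter t ht), ← mul_assoc, h2, mul_assoc,
      IsUnit.mul_val_inv, mul_one]
  have hr' : ∀ (x : Qˣ) (v : Eˣ) (e t : E), t ∈ Subring.center E → t ≠ 0 → e ≠ 0 →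
      x * ι t = ι e → v * l t = l e → r x = v := fun x v e t ht ht0 he0 h h' =>
    Units.ext ((hunit t ht0).mul_right_cancel ((hr x e t ht ht0 he0 h).trans h'.symm))
  refine ⟨MonoidHom.mk' r fun x y => ?_, fun u => ?_⟩
  · refine hr' _ _ (num x * num y) (den y * den x) (mul_mem (hden y) (hden x))
      (mul_ne_zero (hden0 y) (hden0 x)) (mul_ne_zero (hnum0 x) (hnum0 y)) ?_ ?_
    · rw [Units.val_mul, map_mul, map_mul, mul_assoc, ← mul_assoc (y : Q), hfrac,
        ← hι.comm (hden x), ← mul_assoc, hfrac]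
    · have h1 := hr x _ _ (hden x) (hden0 x) (hnum0 x) (hfrac x)
      have h2 := hr y _ _ (hden y) (hden0 y) (hnum0 y) (hfrac y)
      rw [hmul _ _ (hden0 y) (hden0 x), hmul _ _ (hnum0 x) (hnum0 y), ← h1, ← h2, Units.val_mul,
        mul_assoc, ← mul_assoc (r y : E), Subring.mem_center_iff.mp (hcenter _ (hden x)),
        mul_assoc]
  · refine hr' _ u u 1 (one_mem _) one_ne_zero u.ne_zero ?_ ?_
    · rw [map_one, mul_one]
      rfl
    · rw [hid 1 isUnit_one, mul_one, hid u u.isUnit]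

end Leading

/-! ### Comparison of the reduced Whitehead groups -/

section Compare

variable {Γ : Type v} [AddCommGroup Γ] [DecidableEq Γ] {E : Type u} [Ring E]
  {𝒜 : Γ → AddSubgroup E} [GradedRing 𝒜] {Q : Type*} {F : Type*} [CommMonoid F]

/-- Injectivity: a retraction maps commutators of `Q` to commutators of `E`. -/
theorem mem_commutator_of_map_mem [DivisionRing Q] {ι : E →+* Q} (hE : IsGradedDivisionRing 𝒜)
    (hι : IsQuotient ι) {u : Eˣ} (h : Units.map ι.toMonoidHom u ∈ commutator Qˣ) :
    u ∈ commutator Eˣ := by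
  obtain ⟨r, hr⟩ := exists_retraction hE hι
  rw [← hr u]
  have h1 : (commutator Qˣ).map r ≤ commutator Eˣ := by
    rw [commutator_def, Subgroup.map_commutator, commutator_def]
    exact Subgroup.commutator_mono le_top le_top
  exact h1 (Subgroup.mem_map_of_mem r h)

/-- Surjectivity: if `x = e / t` has norm `1`, then `e` and the central element `t` have the same
norm. -/
theorem exists_mul_mem_commutator [DivisionRing Q] {ι : E →+* Q} (hE : IsGradedDivisionRing 𝒜)
    (hfin : Module.Finite (Subring.center E) E) (hι : IsQuotient ι) {N : E →* Subring.center E}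
    {N' : Q →* F} {n : ℕ} (hN : IsNorm ι N N' n) {x : Qˣ} (hx : N' x = 1) :
    ∃ u : Eˣ, N u = 1 ∧ (Units.map ι.toMonoidHom u)⁻¹ * x ∈ commutator Qˣ := by
  have := isDomain hE
  obtain ⟨e, t, ht, ht0, h⟩ := hι.exists_eq x
  have he0 : e ≠ 0 := by
    rintro rfl
    rw [map_zero] at h
    exact mul_ne_zero x.ne_zero (hι.map_ne_zero ht0) h
  have h1 : N e = N t := hN.eq_of_map_eq _ _ (by rw [← h, map_mul, hx, one_mul])
  obtain ⟨u, hu⟩ := exists_of_mem_unitClasses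
    (hN.unitClass_div_mem hι hE hfin he0 ht0 (by rw [h1]))
  rw [← h, unitClass_mul x.ne_zero (hι.map_ne_zero ht0), mul_div_cancel_right] at hu
  have h2 := map_eq_of_unitClass_eq N' x.ne_zero (hι.map_ne_zero u.ne_zero) hu
  refine ⟨u, ?_, ?_⟩
  · rw [hN.eq_of_map_eq u 1 (by rw [← h2, hx, map_one, map_one]), map_one]
  · rw [unitClass_coe] at hu
    have h3 : Abelianization.of x = Abelianization.of (Units.map ι.toMonoidHom u) := by
      rw [hu]
      exact unitClass_coe (Units.map ι.toMonoidHom u)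
    exact QuotientGroup.eq.mp h3.symm

end Compare

/-! ### The quotient division ring -/

section Quotient

variable {E : Type u} [Ring E]

theorem toQuotientDivisionRing_injective [Module.Flat (Subring.center E) E] :
    Function.Injective (toQuotientDivisionRing E) :=
  Algebra.TensorProduct.includeRight_injective (R := Subring.center E)
    (A := FractionRing (Subring.center E)) (B := E)
    (IsFractionRing.injective (Subring.center E) (FractionRing (Subring.center E)))

theorem toQuotientDivisionRing_center (t : Subring.center E) :
    toQuotientDivisionRing E t = algebraMap (Subring.center E) (QuotientDivisionRing E) t :=
  (Algebra.TensorProduct.includeRight : E →ₐ[Subring.center E] QuotientDivisionRing E).commutes t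

theorem exists_mul_eq_toQuotientDivisionRing [IsDomain E] (x : QuotientDivisionRing E) :
    ∃ e : E, ∃ t ∈ Subring.center E, t ≠ 0 ∧
      x * toQuotientDivisionRing E t = toQuotientDivisionRing E e := by
  let f : E →ₗ[Subring.center E] QuotientDivisionRing E :=
    TensorProduct.mk (Subring.center E) (FractionRing (Subring.center E)) E 1
  have hf : IsLocalizedModule (nonZeroDivisors (Subring.center E)) f :=
    (isLocalizedModule_iff_isBaseChange (nonZeroDivisors (Subring.center E))
      (FractionRing (Subring.center E)) f).mpr (TensorProduct.isBaseChange _ E _)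
  obtain ⟨⟨e, t⟩, h⟩ := IsLocalizedModule.surj (nonZeroDivisors (Subring.center E)) f x
  refine ⟨e, t, t.1.2, fun h0 => nonZeroDivisors.ne_zero t.2 (Subtype.ext h0), ?_⟩
  rw [toQuotientDivisionRing_center, ← Algebra.commutes, ← Algebra.smul_def]
  exact h

theorem isUnit_or_eq_zero [IsDomain E] [Module.Finite (Subring.center E) E]
    {Γ : Type v} [AddCommGroup Γ] [DecidableEq Γ] (𝒜 : Γ → AddSubgroup E) [GradedRing 𝒜]
    (x : QuotientDivisionRing E) : IsUnit x ∨ x = 0 := by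
  have hunit : ∀ t ∈ Subring.center E, t ≠ 0 → IsUnit (toQuotientDivisionRing E t) := by
    intro t ht ht0
    let t' : Subring.center E := ⟨t, ht⟩
    have ht0' : t' ≠ 0 := fun h => ht0 (congrArg Subtype.val h)
    have h1 : IsUnit (algebraMap (Subring.center E) (FractionRing (Subring.center E)) t') :=
      IsLocalization.map_units _ (⟨t', mem_nonZeroDivisors_of_ne_zero ht0'⟩ :
        nonZeroDivisors (Subring.center E))
    have h2 := h1.map (algebraMap (FractionRing (Subring.center E)) (QuotientDivisionRing E))
    rw [← IsScalarTower.algebraMap_apply, ← toQuotientDivisionRing_center] at h2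
    exact h2
  obtain ⟨e, t, ht, ht0, h⟩ := exists_mul_eq_toQuotientDivisionRing x
  obtain ⟨y, hy⟩ := hunit t ht ht0
  have hx : x = toQuotientDivisionRing E e * ↑y⁻¹ := by
    rw [← h, ← hy, Units.mul_inv_cancel_right]
  by_cases he0 : e = 0
  · right
    rw [hx, he0, map_zero, zero_mul]
  left
  obtain ⟨a, -, s, hs, -, hs0, hae, hea⟩ := exists_mul_eq_center (𝒜 := 𝒜) ⊤
    (mem_supportedIn_univ e) he0
  obtain ⟨z, hz⟩ := hunit s hs hs0
  have h1 : toQuotientDivisionRing E e * (toQuotientDivisionRing E a * ↑z⁻¹) = 1 := by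
    rw [← mul_assoc, ← map_mul, hea, ← hz, Units.mul_inv]
  have h2 : (↑z⁻¹ * toQuotientDivisionRing E a) * toQuotientDivisionRing E e = 1 := by
    rw [mul_assoc, ← map_mul, hae, ← hz, Units.inv_mul]
  rw [hx]
  exact (isUnit_iff_exists.mpr ⟨_, h1, by rwa [← left_inv_eq_right_inv h2 h1]⟩).mul y⁻¹.isUnit

/-- An isomorphism of reduced Whitehead groups, from the two facts that express injectivity and
surjectivity in terms of commutator subgroups. -/
theorem exists_SK1_mulEquiv {R K A Q : Type*} [CommRing R] [Ring A] [Algebra R A] [CommRing K]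
    [Ring Q] [Algebra K Q] (ι : A →+* Q)
    (hmap : ∀ a : Aˣ, reducedNorm K Q (ι a) = 1 ↔ reducedNorm R A a = 1)
    (hinj : ∀ a : Aˣ, Units.map ι.toMonoidHom a ∈ commutator Qˣ → a ∈ commutator Aˣ)
    (hsurj : ∀ x : Qˣ, reducedNorm K Q x = 1 → ∃ a : Aˣ, reducedNorm R A a = 1 ∧
      (Units.map ι.toMonoidHom a)⁻¹ * x ∈ commutator Qˣ) :
    ∃ ξ : SK1 R A ≃* SK1 K Q, ∀ a : reducedNormOne R A,
      ∃ ha : Units.map ι.toMonoidHom (a : Aˣ) ∈ reducedNormOne K Q,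
        ξ (QuotientGroup.mk a) = QuotientGroup.mk ⟨Units.map ι.toMonoidHom (a : Aˣ), ha⟩ := by
  have hmem : ∀ a : reducedNormOne R A, Units.map ι.toMonoidHom (a : Aˣ) ∈ reducedNormOne K Q :=
    fun a => (hmap a).mpr a.2
  let f : reducedNormOne R A →* reducedNormOne K Q :=
    ((Units.map ι.toMonoidHom).comp (reducedNormOne R A).subtype).codRestrict _ hmem
  have hf : (commutator Aˣ).subgroupOf (reducedNormOne R A) ≤
      ((commutator Qˣ).subgroupOf (reducedNormOne K Q)).comap f := by
    intro a ha
    have h1 : (commutator Aˣ).map (Units.map ι.toMonoidHom) ≤ commutator Qˣ := by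
      rw [commutator_def, Subgroup.map_commutator, commutator_def]
      exact Subgroup.commutator_mono le_top le_top
    exact h1 (Subgroup.mem_map_of_mem _ ha)
  let g : SK1 R A →* SK1 K Q := QuotientGroup.map _ _ f hf
  have hg : Function.Bijective g := by
    refine ⟨(injective_iff_map_eq_one g).mpr fun a => ?_, fun x => ?_⟩
    · induction a using QuotientGroup.induction_on with
      | H a =>
        intro h
        exact (QuotientGroup.eq_one_iff _).mpr (hinj a ((QuotientGroup.eq_one_iff (f a)).mp h))
    · induction x using QuotientGroup.induction_on with
      | H x =>
        obtain ⟨a, ha, hax⟩ := hsurj x x.2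
        exact ⟨QuotientGroup.mk (⟨a, ha⟩ : reducedNormOne R A), QuotientGroup.eq.mpr hax⟩
  exact ⟨MulEquiv.ofBijective g hg, fun a => ⟨hmem a, rfl⟩⟩

end Quotient

end GradedDivisionRing

open GradedDivisionRing

theorem mainTheorem2 {Γ : Type v} [AddCommGroup Γ] [DecidableEq Γ] {E : Type u} [Ring E]
    (𝒜 : Γ → AddSubgroup E) [GradedRing 𝒜] (hE : IsGradedDivisionRing 𝒜)
    (hfin : Module.Finite (Subring.center E) E) :
    Nonempty (SplittingDatum (Subring.center E) E) ∧
    Nonempty (SplittingDatum (FractionRing (Subring.center E)) (QuotientDivisionRing E)) ∧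
    ∃ ξ : SK1 (Subring.center E) E ≃*
        SK1 (FractionRing (Subring.center E)) (QuotientDivisionRing E),
      ∀ a : reducedNormOne (Subring.center E) E,
        ∃ ha : Units.map (toQuotientDivisionRing E).toMonoidHom (a : Eˣ) ∈
            reducedNormOne (FractionRing (Subring.center E)) (QuotientDivisionRing E),
          ξ (QuotientGroup.mk a) =
            QuotientGroup.mk
              ⟨Units.map (toQuotientDivisionRing E).toMonoidHom (a : Eˣ), ha⟩ := by
  have := isDomain hE
  obtain ⟨s, hs⟩ := exists_splittingDatum hE hfin
  obtain ⟨t, -⟩ := exists_splittingDatum_baseChange (F := FractionRing (Subring.center E)) s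
  refine ⟨⟨s⟩, ⟨t⟩, ?_⟩
  obtain ⟨b, _, bas, -⟩ := exists_center_basis hE hfin
  have hfree : Module.Free (Subring.center E) E := Module.Free.of_basis bas
  have hinj := toQuotientDivisionRing_injective (E := E)
  have hnorm : ∀ e, reducedNorm (FractionRing (Subring.center E)) (QuotientDivisionRing E)
      (toQuotientDivisionRing E e) = algebraMap _ _ (reducedNorm (Subring.center E) E e) :=
    fun e => reducedNorm_baseChange s e
  have hinjK := IsFractionRing.injective (Subring.center E) (FractionRing (Subring.center E))
  have : Nontrivial (QuotientDivisionRing E) := hinj.nontrivial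
  let _ : DivisionRing (QuotientDivisionRing E) :=
    DivisionRing.ofIsUnitOrEqZero (isUnit_or_eq_zero 𝒜)
  have hι : IsQuotient (toQuotientDivisionRing E) :=
    ⟨hinj, exists_mul_eq_toQuotientDivisionRing⟩
  have hN : IsNorm (toQuotientDivisionRing E) (reducedNorm (Subring.center E) E)
      (reducedNorm (FractionRing (Subring.center E)) (QuotientDivisionRing E)) s.n :=
    { map_center := fun t => reducedNorm_algebraMap s t
      exists_mul_eq := fun e => hs e _ (algebraMap_reducedNorm s e)
      eq_of_map_eq := fun e f h => hinjK (by rw [← hnorm, ← hnorm, h]) }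
  refine exists_SK1_mulEquiv (toQuotientDivisionRing E) (fun a => ?_)
    (fun a => mem_commutator_of_map_mem hE hι) fun x => exists_mul_mem_commutator hE hfin hι hN
  rw [hnorm, ← map_one (algebraMap (Subring.center E) (FractionRing (Subring.center E))),
    hinjK.eq_iff]
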